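/- Let $\Omega\subset\mathbb{R}^2$ be a bounded polygonal domain, i.e. the interior of a finite union of closed non-degenerate triangles, and let $\kappa_0>0$ and $M\in\mathbb{N}$. Then there is a constant $C>0$, depending only on $\Omega$, $\kappa_0$ and $M$, such that the following holds. **Setting.** Let $\mathcal T_h$ be a conforming triangulation of $\Omega$, and let $V_h(\Omega)$ be the space of complex-valued continuous functions on $\overline\Omega$ that are polynomials of degree $\le p$ on each triangle ($p\ge 1$), with nodal interpolation $\pi_h$ at the Lagrange nodes of order $p$. Let $\Omega_1,\dots,\Omega_N$ be (overlapping) subdomains, each a union of elements of $\mathcal T_h$ (that is, the interior of the union of the closed elements), that cover $\Omega$ and have finite overlap: $\#\{j:\Omega_j\cap\Omega_l\neq\emptyset\}\le M$ for all $l$. Let $\chi_1,\dots,\chi_N:\overline\Omega\to[0,1]$ be continuous with $\operatorname{supp}\chi_l\subseteq\overline\Omega_l$ and $\sum_l\chi_l=1$. Let $\kappa\ge\kappa_0$, $0<\epsilon\le\kappa^2$ and $\rho\in(0,1)$. For $G\in\{\Omega,\Omega_1,\dots,\Omega_N\}$ put $$(v,w)_{1,\kappa,G}=\int_G\nabla v\cdot\nabla\bar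 w\,dx+\kappa^2\int_G v\bar w\,dx,\qquad \|v\|_{1,\kappa,G}=(v,v)_{1,\kappa,G}^{1/2},$$ $$a_{\epsilon,G}(v,w)=\int_G\nabla v\cdot\nabla\bar w\,dx-(\kappa^2+\mathrm i\epsilon)\int_G v\bar w\,dx-\mathrm i\kappa\int_{\partial G}v\bar w\,ds ,$$ and write $\|\cdot\|_{1,\kappa}=\|\cdot\|_{1,\kappa,\Omega}$, $a_\epsilon=a_{\epsilon,\Omega}$, $a_{\epsilon,l}=a_{\epsilon,\Omega_l}$. Let $R_lv=v|_{\Omega_l}$ and $V_h(\Omega_l)=R_lV_h(\Omega)$; let $E_l:V_h(\Omega_l)\to V_h(\Omega)$ keep the nodal values at the nodes in $\overline\Omega_l$ and set all other nodal values to $0$; let $D_lv=\pi_h(\chi_lv)$. Let $V_h^\partial(\Omega_l)$ be the space of all $v\in V_h(\Omega_l)$ for which there is a trace $\lambda_h$ on $\partial\Omega_l$ of a function in $V_h(\Omega_l)$ with $a_{\epsilon,l}(v,w)=\int_{\partial\Omega_l}\lambda_h\bar w\,ds$ for all $w\in V_h(\Omega_l)$. Let $V^\rho_{h,0}(\Omega_l)$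 be the span of the eigenfunctions $\xi\in V_h^\partial(\Omega_l)$ of $$(D_lE_l\xi,D_lE_l\theta)_{1,\kappa,\Omega_l}=\lambda\,(\xi,\theta)_{1,\kappa,\Omega_l}\qquad\forall\,\theta\in V_h^\partial(\Omega_l)$$ with eigenvalue $\lambda\ge\rho^2$, and let $V^\rho_{h,0}(\Omega)=\{\sum_lD_lE_lv_l:\ v_l\in V^\rho_{h,0}(\Omega_l)\}$. For $v\in V_h(\Omega)$ let $P_{\epsilon,l}v\in V_h(\Omega_l)$ solve $a_{\epsilon,l}(P_{\epsilon,l}v,w)=a_\epsilon(v,E_lw)$ for all $w\in V_h(\Omega_l)$, and let $P_0^\rho v\in V^\rho_{h,0}(\Omega)$ solve $a_\epsilon(P_0^\rho v,w)=a_\epsilon(v,w)$ for all $w\in V^\rho_{h,0}(\Omega)$. **Claim.** For every $v_h\in V_h(\Omega)$, with $v_{h,l}^\partial=P_{\epsilon,l}v_h-R_lv_h$ and $v_h^\partial=\sum_{l=1}^ND_lE_lv_{h,l}^\partial$, $$\|(I-P_0^\rho)v_h^\partial\|_{1,\kappa}\ \le\ C\,\frac{\rho\kappa^2}{\epsilon}\Bigl(\sum_{l=1}^N\|v_{h,l}^\partial\|_{1,\kappa,\Omega_l}^2\Bigr)^{1/2}.$$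 -/

import Mathlib

open MeasureTheory

namespace HelmholtzDD

noncomputable section

/-- The Euclidean plane `ℝ²`. -/
abbrev Plane := EuclideanSpace ℝ (Fin 2)

/-- The closed region covered by a finite set of triangles; a triangle is given by its vertices. -/
def region (S : Finset (Finset Plane)) : Set Plane :=
  ⋃ τ ∈ S, convexHull ℝ (τ : Set Plane)

/-- A conforming triangulation of the open set `Ω ⊆ ℝ²`: finitely many non-degenerate triangles,
any two of which meet exactly in the convex hull of their common vertices, and whose union is
the closure of `Ω`. (Since the triangles are non-degenerate, `interior (region elems) = Ω` yields
`region elems = closure Ω`.) -/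
structure Mesh (Ω : Set Plane) where
  elems : Finset (Finset Plane)
  card_eq : ∀ τ ∈ elems, τ.card = 3
  indep : ∀ τ ∈ elems, AffineIndependent ℝ ((↑) : τ → Plane)
  conforming : ∀ σ ∈ elems, ∀ τ ∈ elems,
    convexHull ℝ (σ : Set Plane) ∩ convexHull ℝ (τ : Set Plane)
      = convexHull ℝ ((σ : Set Plane) ∩ (τ : Set Plane))
  cover : interior (region elems) = Ω

/-- The Lagrange nodes of order `p` of the triangle `τ`: the points whose barycentric coordinates
are integer multiples of `1 / p`. -/
def triangleNodes (p : ℕ) (τ : Finset Plane) : Set Plane :=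
  {x | ∃ α : Plane → ℕ, ∑ a ∈ τ, α a = p ∧ x = ∑ a ∈ τ, ((α a : ℝ) / (p : ℝ)) • a}

/-- A discrete setting on `Ω`: a mesh, a polynomial order `p ≥ 1`, subdomains `Ω_1, …, Ω_N` that
are unions of mesh elements and cover `Ω`, and a continuous partition of unity on `closure Ω`
whose `l`-th function is supported in the closure of `Ω_l`. -/
structure Discretization (Ω : Set Plane) where
  mesh : Mesh Ω
  /-- polynomial order of the finite elements -/
  p : ℕ
  one_le_p : 1 ≤ p
  /-- number of subdomains -/
  N : ℕ
  /-- the mesh elements that make up the `l`-th subdomain -/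
  subElems : Fin N → Finset (Finset Plane)
  subElems_subset : ∀ l, subElems l ⊆ mesh.elems
  subElems_cover : ∀ τ ∈ mesh.elems, ∃ l, τ ∈ subElems l
  /-- the partition of unity -/
  χ : Fin N → Plane → ℝ
  χ_continuous : ∀ l, ContinuousOn (χ l) (closure Ω)
  χ_support : ∀ l, ∀ x ∈ closure Ω, x ∉ region (subElems l) → χ l x = 0
  χ_nonneg : ∀ l, ∀ x ∈ closure Ω, 0 ≤ χ l x
  χ_le_one : ∀ l, ∀ x ∈ closure Ω, χ l x ≤ 1
  χ_sum : ∀ x ∈ closure Ω, ∑ l, χ l x = 1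

/-! ### Sesquilinear forms

All functions below are finite element functions: continuous and piecewise polynomial on the
closure of the open set `G` under consideration. For these the weak gradient is the classical
gradient, which exists off the edges of the mesh (a Lebesgue null set), and the trace on `∂G` is
the restriction to `frontier G`. -/

/-- `(∇v, ∇w)_G = ∫_G ∇v · conj ∇w dx`. -/
def gradInner (G : Set Plane) (v w : Plane → ℂ) : ℂ :=
  ∫ x in G, ∑ i : Fin 2, fderiv ℝ v x (EuclideanSpace.single i 1) *
    (starRingEnd ℂ) (fderiv ℝ w x (EuclideanSpace.single i 1))

/-- `(v, w)_G = ∫_G v conj w dx`. -/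
def l2Inner (G : Set Plane) (v w : Plane → ℂ) : ℂ :=
  ∫ x in G, v x * (starRingEnd ℂ) (w x)

/-- `⟨v, w⟩_{∂G} = ∫_{∂G} v conj w ds`, where `ds` is arc length. -/
def bdryInner (G : Set Plane) (v w : Plane → ℂ) : ℂ :=
  ∫ x in frontier G, v x * (starRingEnd ℂ) (w x) ∂(Measure.hausdorffMeasure 1)

/-- The `κ`-weighted inner product `(v, w)_{1,κ,G}`. -/
def kInner (κ : ℝ) (G : Set Plane) (v w : Plane → ℂ) : ℂ :=
  gradInner G v w + (κ : ℂ) ^ 2 * l2Inner G v w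

/-- The `κ`-weighted norm `‖v‖_{1,κ,G} = (v, v)_{1,κ,G}^{1/2}`. -/
def kNorm (κ : ℝ) (G : Set Plane) (v : Plane → ℂ) : ℝ :=
  Real.sqrt (kInner κ G v v).re

/-- The Helmholtz form with absorption and impedance boundary condition on `G`:
`(∇v, ∇w)_G - (κ² + iε) (v, w)_G - iκ ⟨v, w⟩_{∂G}`. -/
def helmholtzForm (κ ε : ℝ) (G : Set Plane) (v w : Plane → ℂ) : ℂ :=
  gradInner G v w - ((κ : ℂ) ^ 2 + Complex.I * (ε : ℂ)) * l2Inner G v w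
    - Complex.I * (κ : ℂ) * bdryInner G v w

/-- The solution `u ∈ V` of the Galerkin problem `a(u, w) = F(w)` for all `w ∈ V`
(`0` if there is none). -/
def galerkinSolution (V : Set (Plane → ℂ)) (a : (Plane → ℂ) → (Plane → ℂ) → ℂ)
    (F : (Plane → ℂ) → ℂ) : Plane → ℂ :=
  open Classical in
  if h : ∃ u ∈ V, ∀ w ∈ V, a u w = F w then h.choose else 0

namespace Discretization

variable {Ω : Set Plane} (D : Discretization Ω)

/-- The finite element space `V_h(Ω)` of complex-valued functions that are continuous on
`closure Ω` and polynomial of degree at most `p` on each element. As functions on the plane they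
are set to `0` outside `closure Ω`. -/
def feSpace : Set (Plane → ℂ) :=
  {v | ContinuousOn v (closure Ω) ∧
    (∀ τ ∈ D.mesh.elems, ∃ q : MvPolynomial (Fin 2) ℂ, q.totalDegree ≤ D.p ∧
      ∀ x ∈ convexHull ℝ (τ : Set Plane), v x = MvPolynomial.eval (fun i => (x i : ℂ)) q) ∧
    ∀ x, x ∉ closure Ω → v x = 0}

/-- The set of all finite element nodes on `closure Ω`. -/
def nodes : Set Plane := ⋃ τ ∈ D.mesh.elems, triangleNodes D.p τ

/-- The nodal interpolant `π_h f ∈ V_h(Ω)`, determined by its values at the nodes. -/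
def interp (f : Plane → ℂ) : Plane → ℂ :=
  open Classical in
  if h : ∃ v ∈ D.feSpace, ∀ x ∈ D.nodes, v x = f x then h.choose else 0

/-- The closure of the `l`-th subdomain. -/
def closedSub (l : Fin D.N) : Set Plane := region (D.subElems l)

/-- The `l`-th subdomain `Ω_l` (an open set). -/
def sub (l : Fin D.N) : Set Plane := interior (D.closedSub l)

/-- The index set `Λ(l) = {j : Ω_j ∩ Ω_l ≠ ∅}`. -/
def neighbours (l : Fin D.N) : Set (Fin D.N) := {j | (D.sub j ∩ D.sub l).Nonempty}

/-- The restriction `R_l v = v|_{Ω_l}`. A function on the closure of `Ω_l` is represented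
by its extension by `0`. -/
def restr (l : Fin D.N) (v : Plane → ℂ) : Plane → ℂ := (D.closedSub l).indicator v

/-- The local finite element space `V_h(Ω_l) = {R_l v : v ∈ V_h(Ω)}`. -/
def localSpace (l : Fin D.N) : Set (Plane → ℂ) := D.restr l '' D.feSpace

/-- The prolongation `E_l : V_h(Ω_l) → V_h(Ω)`: nodal values at nodes in the closure of `Ω_l` are
kept, all other nodal values are `0`. -/
def prolong (l : Fin D.N) (v : Plane → ℂ) : Plane → ℂ :=
  D.interp ((D.closedSub l).indicator v)

/-- The weighting operator `D_l v = π_h (χ_l v)`. -/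
def weight (l : Fin D.N) (v : Plane → ℂ) : Plane → ℂ :=
  D.interp (fun x => (D.χ l x : ℂ) * v x)

/-- The local discrete Helmholtz-harmonic space `V_h^∂(Ω_l)`: all `v ∈ V_h(Ω_l)` with
`a_{ε,l}(v, w) = ⟨g, w⟩_{∂Ω_l}` for all `w ∈ V_h(Ω_l)`, for some impedance data `g` that is the
trace on `∂Ω_l` of a function in `V_h(Ω_l)`. -/
def harmonicSpace (κ ε : ℝ) (l : Fin D.N) : Set (Plane → ℂ) :=
  {v | v ∈ D.localSpace l ∧ ∃ g ∈ D.localSpace l, ∀ w ∈ D.localSpace l,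
    helmholtzForm κ ε (D.sub l) v w = bdryInner (D.sub l) g w}

/-- `ξ ∈ V_h^∂(Ω_l)` solves the local generalized eigenvalue problem with eigenvalue `μ`:
`(D_l E_l ξ, D_l E_l θ)_{1,κ,Ω_l} = μ (ξ, θ)_{1,κ,Ω_l}` for all `θ ∈ V_h^∂(Ω_l)`. -/
def IsEigenfunction (κ ε : ℝ) (l : Fin D.N) (μ : ℝ) (ξ : Plane → ℂ) : Prop :=
  ξ ∈ D.harmonicSpace κ ε l ∧ ∀ θ ∈ D.harmonicSpace κ ε l,
    kInner κ (D.sub l) (D.weight l (D.prolong l ξ)) (D.weight l (D.prolong l θ))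
      = (μ : ℂ) * kInner κ (D.sub l) ξ θ

/-- The local coarse space `V_{h,0}^ρ(Ω_l)`: the span of all eigenfunctions with eigenvalue at
least `ρ²`. -/
def localCoarse (κ ε ρ : ℝ) (l : Fin D.N) : Submodule ℂ (Plane → ℂ) :=
  Submodule.span ℂ {ξ | ∃ μ : ℝ, ρ ^ 2 ≤ μ ∧ D.IsEigenfunction κ ε l μ ξ}

/-- The coarse space `V_{h,0}^ρ(Ω) = {∑ D_l E_l v_l : v_l ∈ V_{h,0}^ρ(Ω_l)}`. -/
def coarseSpace (κ ε ρ : ℝ) : Set (Plane → ℂ) :=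
  {v | ∃ z : Fin D.N → Plane → ℂ, (∀ l, z l ∈ D.localCoarse κ ε ρ l) ∧
    v = ∑ l, D.weight l (D.prolong l (z l))}

/-- The local projection `P_{ε,l} v ∈ V_h(Ω_l)`:
`a_{ε,l}(P_{ε,l} v, w) = a_ε(v, E_l w)` for all `w ∈ V_h(Ω_l)`. -/
def localProj (κ ε : ℝ) (l : Fin D.N) (v : Plane → ℂ) : Plane → ℂ :=
  galerkinSolution (D.localSpace l) (helmholtzForm κ ε (D.sub l))
    (fun w => helmholtzForm κ ε Ω v (D.prolong l w))

/-- The coarse projection `P_0^ρ v ∈ V_{h,0}^ρ(Ω)`: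
`a_ε(P_0^ρ v, w) = a_ε(v, w)` for all `w ∈ V_{h,0}^ρ(Ω)`. -/
def coarseProj (κ ε ρ : ℝ) (v : Plane → ℂ) : Plane → ℂ :=
  galerkinSolution (D.coarseSpace κ ε ρ) (helmholtzForm κ ε Ω) (helmholtzForm κ ε Ω v)

/-- `v_{h,l}^∂ = P_{ε,l} v_h - R_l v_h`. -/
def localDefect (κ ε : ℝ) (v : Plane → ℂ) (l : Fin D.N) : Plane → ℂ :=
  D.localProj κ ε l v - D.restr l v

/-- `v_h^∂ = ∑ D_l E_l v_{h,l}^∂`. -/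
def defect (κ ε : ℝ) (v : Plane → ℂ) : Plane → ℂ :=
  ∑ l, D.weight l (D.prolong l (D.localDefect κ ε v l))

end Discretization

end

end HelmholtzDD

namespace HelmholtzDD

noncomputable section

open scoped ComplexConjugate ENNReal NNReal Topology

/-! ### Sesquilinear forms on finite-dimensional spaces -/

section Sesquilinear

variable {V : Type*} [AddCommGroup V] [Module ℂ V]

/-! The estimate is Céa's lemma for the coarse problem, combined with a spectral truncation in each
subdomain.

Absorption makes `a_ε` coercive at the price of a factor `κ²/ε` (`helmholtzForm_coercive`), and a
trace inequality on `Ω` makes it bounded in the weighted norm uniformly in `κ ≥ κ₀`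
(`norm_helmholtzForm_le`). Hence `P_0^ρ` is quasi-optimal with constant of order `κ²/ε`
(`kNorm_sub_coarseProj_le`). The competitor is `∑ D_l E_l z_l`, where `z_l` is the part of
`v_{h,l}^∂` carried by eigenfunctions with eigenvalue at least `ρ²`. What is left over loses a
factor `ρ` under `D_l E_l` (`exists_localCoarse_approx`), and since the functions `D_l E_l u` vanish
off `Ω_l`, finite overlap sums the local errors at the cost of `√M` (`kNorm_sum_sq_le`).

Truncation is available only inside `V_h^∂(Ω_l)`, so the defect has to be shown to lie there
(`localDefect_mem`). If `w` vanishes on `∂Ω_l`, then `E_l w` is `w` extended by zero, and the local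
and global forms agree on it. So `w ↦ a_{ε,l}(v_{h,l}^∂, w)` depends only on the trace of `w`, and
Riesz representation for the boundary form provides `λ_h`. This uses that `∂Ω_l` has positive length
near each of its points.

The constant must not see the mesh. The only geometric input is the trace inequality on `Ω`; its
constant comes from one fixed triangulation and then serves piecewise polynomials on every other one
(`Mesh.exists_trace`). No trace inequality on a subdomain is needed. -/

theorem galerkin_exists [FiniteDimensional ℂ V] (a : V →ₗ[ℂ] V →ₗ⋆[ℂ] ℂ)
    (ha : ∀ u, a u u = 0 → u = 0) (F : V →ₗ⋆[ℂ] ℂ) : ∃ u, a u = F := by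
  classical
  let b := Module.finBasis ℂ V
  -- Recording a conjugate-linear functional by its values on a basis makes this a ℂ-linear map
  -- between spaces of equal dimension, so injectivity yields surjectivity.
  let Φ : V →ₗ[ℂ] (Fin (Module.finrank ℂ V) → ℂ) :=
    LinearMap.pi fun i => LinearMap.mk ⟨fun u => a u (b i), by intros; simp⟩ (by intros; simp)
  have hΦ : ∀ u i, Φ u i = a u (b i) := fun _ _ => rfl
  have ext : ∀ G H : V →ₗ⋆[ℂ] ℂ, (∀ i, G (b i) = H (b i)) → G = H := fun G H h => b.ext h
  have hinj : Function.Injective Φ := by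
    rw [← LinearMap.ker_eq_bot, LinearMap.ker_eq_bot']
    intro u hu
    apply ha
    have : a u = 0 := ext _ _ fun i => by rw [← hΦ, hu]; rfl
    rw [this]; rfl
  have hsurj : Function.Surjective Φ :=
    (LinearMap.injective_iff_surjective_of_finrank_eq_finrank (by simp)).1 hinj
  obtain ⟨u, hu⟩ := hsurj fun i => F (b i)
  exact ⟨u, ext _ _ fun i => by rw [← hΦ, hu]⟩

/-- Definiteness is deliberately absent: the gradient form kills constants and the boundary form
kills functions with zero trace. The arguments are swapped in `inner` because `inner` is
conjugate-linear in its first slot. -/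
theorem cauchySchwarz_psd (b : V →ₗ[ℂ] V →ₗ⋆[ℂ] ℂ) (hherm : ∀ u w, conj (b u w) = b w u)
    (hpos : ∀ u, 0 ≤ (b u u).re) (u w : V) :
    ‖b u w‖ ^ 2 ≤ (b u u).re * (b w w).re := by
  let c : PreInnerProductSpace.Core ℂ V :=
    { inner := fun x y => b y x
      conj_inner_symm := fun x y => hherm _ _
      re_inner_nonneg := hpos
      add_left := fun x y z => by simp
      smul_left := fun x y r => by simp }
  have h : ‖b w u‖ * ‖b u w‖ ≤ (b u u).re * (b w w).re :=
    @InnerProductSpace.Core.inner_mul_inner_self_le ℂ V _ _ _ c u w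
  rw [← hherm u w, RCLike.norm_conj] at h
  rwa [sq]

/-- By Cauchy–Schwarz the isotropic vectors form the kernel of `b`. On a complement of the kernel
`b` is definite and the Galerkin problem is solvable; on the kernel both sides vanish. It is used
for the boundary form, to produce impedance data. -/
theorem riesz_psd [FiniteDimensional ℂ V] (b : V →ₗ[ℂ] V →ₗ⋆[ℂ] ℂ)
    (hherm : ∀ u w, conj (b u w) = b w u) (hpos : ∀ u, 0 ≤ (b u u).re) (F : V →ₗ⋆[ℂ] ℂ)
    (hF : ∀ w, b w w = 0 → F w = 0) : ∃ g, b g = F := by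
  have hker : ∀ w, b w w = 0 → b w = 0 := fun w hw => by
    ext v
    have := cauchySchwarz_psd b hherm hpos w v
    rw [hw] at this
    simp only [Complex.zero_re, zero_mul] at this
    have h2 : ‖b w v‖ = 0 := by
      have := le_antisymm this (sq_nonneg _)
      exact pow_eq_zero_iff (two_ne_zero) |>.1 this
    simpa using h2
  obtain ⟨W, hW⟩ := Submodule.exists_isCompl (LinearMap.ker b)
  let bW : W →ₗ[ℂ] W →ₗ⋆[ℂ] ℂ := LinearMap.mk₂'ₛₗ _ _ (fun u w => b u.1 w.1)
    (by intros; simp) (by intros; simp) (by intros; simp) (by intros; simp)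
  obtain ⟨g, hg⟩ := galerkin_exists bW (fun u hu => by
    have h1 : u.1 ∈ LinearMap.ker b := LinearMap.mem_ker.2 (hker _ hu)
    have := Submodule.disjoint_def.1 hW.disjoint _ h1 u.2
    exact Subtype.ext this) (F.comp W.subtype)
  refine ⟨g.1, ?_⟩
  ext v
  obtain ⟨k, hk, w, hw, rfl⟩ := Submodule.mem_sup.1
    (show v ∈ LinearMap.ker b ⊔ W by rw [hW.sup_eq_top]; trivial)
  have hk0 : b k = 0 := LinearMap.mem_ker.1 hk
  have h1 : b g.1 k = 0 := by rw [← hherm, hk0]; simp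
  have h2 : F k = 0 := hF k (by rw [hk0]; rfl)
  have h3 : b g.1 w = F w := LinearMap.congr_fun hg (⟨w, hw⟩ : W)
  rw [map_add, map_add, h1, h2, h3]

/-- The operator `T` with `B (T u) · = b u ·` is self-adjoint for `B`, so it has a `B`-orthonormal
eigenbasis diagonalising both forms. Take for `z` the components of `v` with eigenvalue at least
`t`; on the remaining ones `b` is at most `t` times `B`. -/
theorem exists_span_eigen_approx [FiniteDimensional ℂ V] (B b : V →ₗ[ℂ] V →ₗ⋆[ℂ] ℂ)
    (hB : ∀ u w, conj (B u w) = B w u) (hBpos : ∀ u, 0 ≤ (B u u).re)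
    (hBdef : ∀ u, B u u = 0 → u = 0) (hb : ∀ u w, conj (b u w) = b w u) (t : ℝ) (ht : 0 ≤ t)
    (v : V) :
    ∃ z ∈ Submodule.span ℂ {ξ | ∃ μ : ℝ, t ≤ μ ∧ ∀ θ, b ξ θ = (μ : ℂ) * B ξ θ},
      (b (v - z) (v - z)).re ≤ t * (B v v).re := by
  classical
  let c : InnerProductSpace.Core ℂ V :=
    { inner := fun x y => B y x
      conj_inner_symm := fun x y => hB _ _
      re_inner_nonneg := hBpos
      add_left := fun x y z => by simp
      smul_left := fun x y r => by simp
      definite := hBdef }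
  let _ : NormedAddCommGroup V := @InnerProductSpace.Core.toNormedAddCommGroup ℂ V _ _ _ c
  let _ : InnerProductSpace ℂ V := InnerProductSpace.ofCore c.toCore
  have hin : ∀ x y : V, inner ℂ x y = B y x := fun _ _ => rfl
  have huniq : ∀ x y : V, (∀ θ, B x θ = B y θ) → x = y := fun x y h => by
    rw [← sub_eq_zero]; apply hBdef
    have : B (x - y) = 0 := by ext θ; simp [h θ]
    rw [this]; rfl
  choose T hT using fun u => galerkin_exists B hBdef (b u)
  let TL : V →ₗ[ℂ] V :=
    { toFun := T
      map_add' := fun x y => huniq _ _ fun θ => by rw [hT]; simp [hT]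
      map_smul' := fun r x => huniq _ _ fun θ => by rw [hT]; simp [hT] }
  have hTL : ∀ u θ, B (TL u) θ = b u θ := fun u θ => by
    change B (T u) θ = _; rw [hT]
  have hsymm : TL.IsSymmetric := fun x y => by
    rw [hin, hin, hTL, ← hB, hTL, hb]
  let e := hsymm.eigenvectorBasis rfl
  let l := hsymm.eigenvalues rfl
  let r : V := ∑ i with l i < t, e.repr v i • e i
  let z : V := ∑ i with ¬ l i < t, e.repr v i • e i
  have hv : v = r + z := by
    rw [Finset.sum_filter_add_sum_filter_not]; exact (e.sum_repr v).symm
  refine ⟨z, ?_, ?_⟩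
  · refine Submodule.sum_mem _ fun i hi => Submodule.smul_mem _ _ (Submodule.subset_span ?_)
    refine ⟨l i, not_lt.1 (Finset.mem_filter.1 hi).2, fun θ => ?_⟩
    have h1 : TL (e i) = ((l i : ℝ) : ℂ) • e i := hsymm.apply_eigenvectorBasis rfl i
    rw [← hTL, h1]; simp
  · have hr : v - z = r := by rw [hv]; abel
    have hrep : ∀ i, e.repr r i = if l i < t then e.repr v i else 0 := fun i => by
      simp only [r, map_sum, map_smul, OrthonormalBasis.repr_self]
      rw [WithLp.ofLp_sum, Finset.sum_apply]
      simp [PiLp.single_apply]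
    have hTr : ∀ i, e.repr (TL r) i = l i * e.repr r i := fun i =>
      hsymm.eigenvectorBasis_apply_self_apply rfl r i
    have hinner : ∀ x y : V, B y x = ∑ i, conj (e.repr x i) * e.repr y i := fun x y => by
      rw [← hin, ← e.repr.inner_map_map, PiLp.inner_apply]
      exact Finset.sum_congr rfl fun i _ => by rw [RCLike.inner_apply, mul_comm]
    rw [hr, ← hTL, hinner, hinner, Complex.re_sum, Complex.re_sum, Finset.mul_sum]
    refine Finset.sum_le_sum fun i _ => ?_
    rw [hTr, hrep]
    have h1 : (conj (e.repr v i) * e.repr v i).re = Complex.normSq (e.repr v i) := by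
      rw [mul_comm, Complex.mul_conj]; simp
    -- Components with eigenvalue below `t` are compared termwise; the others are missing from `v -
    -- z` and only need `0 ≤ t`.
    split_ifs with h
    · rw [mul_left_comm, Complex.re_ofReal_mul, h1]
      exact mul_le_mul_of_nonneg_right h.le (Complex.normSq_nonneg _)
    · rw [h1]; simpa using mul_nonneg ht (Complex.normSq_nonneg _)

end Sesquilinear

/-! ### Triangles and barycentric coordinates -/

/-- `τ` is the vertex set of a non-degenerate triangle. -/
def IsTriangle (τ : Finset Plane) : Prop :=
  τ.card = 3 ∧ AffineIndependent ℝ ((↑) : τ → Plane)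

/-- The closed convex hull of a finite set of vertices. -/
abbrev hull (τ : Finset Plane) : Set Plane := convexHull ℝ (τ : Set Plane)

/-- The coordinates are indexed by all points of the plane, not by the vertices of `τ`, so that
different triangles sharing a face can be handled with the same indices. -/
theorem IsTriangle.exists_bary {τ : Finset Plane} (h : IsTriangle τ) :
    ∃ l : Plane → (Plane →ᵃ[ℝ] ℝ), (∀ x, ∑ a ∈ τ, l a x = 1) ∧ (∀ x, ∑ a ∈ τ, l a x • a = x) ∧
      (∀ w : Plane → ℝ, ∑ a ∈ τ, w a = 1 → ∀ a ∈ τ, l a (∑ b ∈ τ, w b • b) = w a) ∧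
      interior (hull τ) = {x | ∀ a ∈ τ, 0 < l a x} := by
  classical
  have htop : affineSpan ℝ (Set.range ((↑) : τ → Plane)) = ⊤ := by
    rw [h.2.affineSpan_eq_top_iff_card_eq_finrank_add_one]
    simp [h.1]
  let b : AffineBasis τ ℝ Plane := ⟨(↑), h.2, htop⟩
  have hb : ∀ a, b a = a.1 := fun _ => rfl
  refine ⟨fun a => if ha : a ∈ τ then b.coord ⟨a, ha⟩ else 0, fun x => ?_, fun x => ?_,
    fun w hw a ha => ?_, ?_⟩
  · rw [← Finset.sum_coe_sort, ← b.sum_coord_apply_eq_one x]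
    exact Finset.sum_congr rfl fun a _ => by simp
  · rw [← Finset.sum_coe_sort τ]
    conv_rhs => rw [← b.linear_combination_coord_eq_self x]
    exact Finset.sum_congr rfl fun a _ => by simp [hb]
  · change (if ha : a ∈ τ then b.coord ⟨a, ha⟩ else 0 : Plane →ᵃ[ℝ] ℝ) _ = _
    have hw' : ∑ a : τ, w a = 1 := by rw [Finset.sum_coe_sort τ w]; exact hw
    have h1 := b.coord_apply_combination_of_mem (Finset.mem_univ (⟨a, ha⟩ : τ)) hw'
    rw [Finset.affineCombination_eq_linear_combination _ _ _ hw'] at h1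
    rw [dif_pos ha, ← h1, ← Finset.sum_coe_sort τ]
    rfl
  · have h1 := b.interior_convexHull
    have h2 : Set.range b = (τ : Set Plane) := by
      ext x; simp [hb]
    rw [h2] at h1
    rw [hull, h1]
    ext x
    constructor
    · intro hx a ha
      simpa [ha] using hx ⟨a, ha⟩
    · intro hx a
      simpa using hx a.1 a.2

/-- The barycentric coordinate of the triangle `τ` that belongs to the vertex `a`. -/
def bary (τ : Finset Plane) (a : Plane) : Plane →ᵃ[ℝ] ℝ :=
  open Classical in if h : IsTriangle τ then h.exists_bary.choose a else 0

namespace IsTriangle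

variable {τ : Finset Plane}

theorem bary_spec (h : IsTriangle τ) : (∀ x, ∑ a ∈ τ, bary τ a x = 1) ∧ (∀ x, ∑ a ∈ τ, bary τ a x • a = x) ∧
      (∀ w : Plane → ℝ, ∑ a ∈ τ, w a = 1 → ∀ a ∈ τ, bary τ a (∑ b ∈ τ, w b • b) = w a) ∧
      interior (hull τ) = {x | ∀ a ∈ τ, 0 < bary τ a x} := by
  have : bary τ = h.exists_bary.choose := by
    funext a; rw [bary, dif_pos h]
  rw [this]
  exact h.exists_bary.choose_spec

theorem sum_bary (h : IsTriangle τ) (x : Plane) : ∑ a ∈ τ, bary τ a x = 1 := h.bary_spec.1 x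

theorem sum_bary_smul (h : IsTriangle τ) (x : Plane) : ∑ a ∈ τ, bary τ a x • a = x := h.bary_spec.2.1 x

theorem bary_combination (h : IsTriangle τ) {w : Plane → ℝ} (hw : ∑ a ∈ τ, w a = 1) {a : Plane} (ha : a ∈ τ) :
    bary τ a (∑ b ∈ τ, w b • b) = w a := h.bary_spec.2.2.1 w hw a ha

theorem interior_hull (h : IsTriangle τ) : interior (hull τ) = {x | ∀ a ∈ τ, 0 < bary τ a x} := h.bary_spec.2.2.2

/-- Barycentric coordinates are unique, so a face is cut out by the vanishing of the coordinates at
the other vertices. Conformity makes the intersection of two mesh triangles such a face of both. -/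
theorem mem_hull_of_subset (h : IsTriangle τ) {s : Finset Plane} (hs : s ⊆ τ) {x : Plane} :
    x ∈ hull s ↔ (∀ a ∈ τ, 0 ≤ bary τ a x) ∧ ∀ a ∈ τ, a ∉ s → bary τ a x = 0 := by
  classical
  rw [hull, Finset.mem_convexHull']
  constructor
  · rintro ⟨w, hw0, hw1, rfl⟩
    let w' : Plane → ℝ := fun a => if a ∈ s then w a else 0
    have h1 : ∑ a ∈ τ, w' a = 1 := by
      rw [← hw1]; simp only [w', Finset.sum_ite_mem, Finset.inter_eq_right.2 hs]
    have h2 : ∑ a ∈ s, w a • a = ∑ a ∈ τ, w' a • a := by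
      simp only [w', ite_smul, zero_smul, Finset.sum_ite_mem, Finset.inter_eq_right.2 hs]
    rw [h2]
    refine ⟨fun a ha => ?_, fun a ha has => ?_⟩
    · rw [h.bary_combination h1 ha]
      by_cases has : a ∈ s
      · simp only [w', if_pos has]; exact hw0 a has
      · simp only [w', if_neg has]; exact le_rfl
    · rw [h.bary_combination h1 ha]; simp only [w', if_neg has]
  · rintro ⟨h0, h1⟩
    refine ⟨fun a => bary τ a x, fun a ha => h0 a (hs ha), ?_, ?_⟩
    · rw [← h.sum_bary x]
      exact Finset.sum_subset hs fun a ha has => h1 a ha has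
    · conv_rhs => rw [← h.sum_bary_smul x]
      exact Finset.sum_subset hs fun a ha has => by
        change bary τ a x • a = 0; rw [h1 a ha has, zero_smul]

theorem mem_hull (h : IsTriangle τ) {x : Plane} : x ∈ hull τ ↔ ∀ a ∈ τ, 0 ≤ bary τ a x := by
  rw [h.mem_hull_of_subset (Finset.Subset.refl τ)]
  exact ⟨fun h => h.1, fun h => ⟨h, fun a ha h' => absurd ha h'⟩⟩

theorem interior_nonempty (h : IsTriangle τ) : (interior (hull τ)).Nonempty := by
  refine ⟨∑ b ∈ τ, (3⁻¹ : ℝ) • b, ?_⟩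
  rw [h.interior_hull]
  intro a ha
  rw [h.bary_combination (w := fun _ => 3⁻¹) (by simp [h.1]) ha]
  norm_num

theorem closure_interior (h : IsTriangle τ) : closure (interior (hull τ)) = hull τ := by
  rw [(convex_convexHull ℝ _).closure_interior_eq_closure_of_nonempty_interior h.interior_nonempty]
  exact (Set.Finite.isClosed_convexHull ℝ τ.finite_toSet).closure_eq

theorem frontier_hull_subset (h : IsTriangle τ) [DecidableEq Plane] :
    frontier (hull τ) ⊆ ⋃ a ∈ τ, hull (τ.erase a) := by
  intro x hx
  have h1 : x ∈ hull τ := (Set.Finite.isClosed_convexHull ℝ τ.finite_toSet).frontier_subset hx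
  have h2 : x ∉ interior (hull τ) := hx.2
  rw [h.interior_hull] at h2
  rw [h.mem_hull] at h1
  simp only [Set.mem_ofPred_eq, not_forall, not_lt] at h2
  obtain ⟨a, ha, h3⟩ := h2
  refine Set.mem_biUnion ha ?_
  rw [h.mem_hull_of_subset (Finset.erase_subset _ _)]
  refine ⟨h1, fun b hb hb' => ?_⟩
  have : b = a := by by_contra hne; exact hb' (Finset.mem_erase.2 ⟨hne, hb⟩)
  rw [this]; exact le_antisymm h3 (h1 a ha)

end IsTriangle

theorem isClosed_hull (s : Finset Plane) : IsClosed (hull s) :=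
  Set.Finite.isClosed_convexHull ℝ s.finite_toSet

theorem isCompact_hull (s : Finset Plane) : IsCompact (hull s) :=
  Set.Finite.isCompact_convexHull ℝ s.finite_toSet

/-- The value at `x` of a polynomial in the two coordinates. -/
abbrev evalAt (x : Plane) (q : MvPolynomial (Fin 2) ℂ) : ℂ :=
  MvPolynomial.eval (fun i => (x i : ℂ)) q

theorem exists_affine_polynomial (f : Plane →ᵃ[ℝ] ℝ) :
    ∃ q : MvPolynomial (Fin 2) ℂ, q.totalDegree ≤ 1 ∧ ∀ x, evalAt x q = (f x : ℂ) := by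
  refine ⟨(∑ i, MvPolynomial.X i * MvPolynomial.C (f.linear (EuclideanSpace.single i 1) : ℂ))
    + MvPolynomial.C (f 0 : ℂ), ?_, fun x => ?_⟩
  · refine (MvPolynomial.totalDegree_add _ _).trans (max_le ?_ (by simp))
    refine MvPolynomial.totalDegree_finsetSum_le fun i _ => ?_
    refine (MvPolynomial.totalDegree_mul _ _).trans ?_
    simp
  · have h1 : f x = f.linear x + f 0 := by
      have := f.map_vadd 0 x
      simpa using this
    have h2 : x = ∑ i, x i • EuclideanSpace.single i (1 : ℝ) := by
      ext j; fin_cases j <;> simp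
    rw [h1]
    conv_rhs => rw [h2]
    simp

/-! ### Lagrange interpolation on a triangle -/

section Lagrange

open scoped Classical

/-- The polynomial in one variable of degree `n` that vanishes at `0, …, n - 1` and is `1`
at `n`. -/
def fallingBasis (n : ℕ) (y : ℂ) : ℂ := ∏ j ∈ Finset.range n, ((n : ℂ) - j)⁻¹ * (y - j)

theorem fallingBasis_zero (y : ℂ) : fallingBasis 0 y = 1 := by simp [fallingBasis]

theorem fallingBasis_of_lt {m n : ℕ} (h : m < n) : fallingBasis n m = 0 :=
  Finset.prod_eq_zero (Finset.mem_range.2 h) (by simp)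

theorem fallingBasis_self (n : ℕ) : fallingBasis n n = 1 := by
  refine Finset.prod_eq_one fun j hj => inv_mul_cancel₀ ?_
  rw [sub_ne_zero]
  exact_mod_cast (Finset.mem_range.1 hj).ne'

/-- The node with multi-index `α` of the simplex with vertex set `s`. -/
def nodePoint (p : ℕ) (s : Finset Plane) (α : Plane → ℕ) : Plane :=
  ∑ a ∈ s, ((α a : ℝ) / (p : ℝ)) • a

theorem nodePoint_subset {p : ℕ} {s t : Finset Plane} (hst : s ⊆ t) {α : Plane → ℕ}
    (hα : ∀ a, a ∉ s → α a = 0) : nodePoint p t α = nodePoint p s α :=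
  (Finset.sum_subset hst fun a _ ha => by simp [hα a ha]).symm

/-- The Lagrange interpolant in terms of barycentric coordinates `w`. -/
def lagrangeSum (p : ℕ) (s : Finset Plane) (c : (Plane → ℕ) → ℂ) (w : Plane → ℝ) : ℂ :=
  ∑ α ∈ s.piAntidiag p, c α * ∏ a ∈ s, fallingBasis (α a) (p * w a)

/-- A multi-index charging a vertex outside `s` carries a factor that vanishes where that vertex has
coordinate `0`. Hence on a face the interpolant sees only the nodal values of that face, which is
why elementwise interpolants glue continuously. -/
theorem lagrangeSum_subset {p : ℕ} {s t : Finset Plane} (hst : s ⊆ t) {c d : (Plane → ℕ) → ℂ}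
    (hcd : ∀ α, (∀ a, a ∉ s → α a = 0) → c α = d α) {v w : Plane → ℝ} (hvw : ∀ a ∈ s, v a = w a)
    (hw : ∀ a ∈ t, a ∉ s → w a = 0) :
    lagrangeSum p t c w = lagrangeSum p s d v := by
  symm
  rw [lagrangeSum, lagrangeSum]
  have hsub : s.piAntidiag p ⊆ t.piAntidiag p := by
    intro α hα
    rw [Finset.mem_piAntidiag] at hα ⊢
    refine ⟨?_, fun i hi => hst (hα.2 i hi)⟩
    rw [← hα.1]
    exact (Finset.sum_subset hst fun a _ ha => by by_contra h; exact ha (hα.2 a h)).symm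
  have h1 : ∑ α ∈ s.piAntidiag p, d α * ∏ a ∈ s, fallingBasis (α a) (p * v a)
      = ∑ α ∈ s.piAntidiag p, c α * ∏ a ∈ t, fallingBasis (α a) (p * w a) := by
    refine Finset.sum_congr rfl fun α hα => ?_
    rw [Finset.mem_piAntidiag] at hα
    have h0 : ∀ a, a ∉ s → α a = 0 := fun a ha => by by_contra h; exact ha (hα.2 a h)
    rw [hcd α h0]
    congr 1
    rw [← Finset.prod_subset hst fun a _ ha => by rw [h0 a ha, fallingBasis_zero]]
    exact Finset.prod_congr rfl fun a ha => by rw [hvw a ha]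
  rw [h1]
  refine Finset.sum_subset hsub fun α hα hα' => ?_
  rw [Finset.mem_piAntidiag] at hα hα'
  have : ∃ a, α a ≠ 0 ∧ a ∉ s := by
    by_contra hcon
    push Not at hcon
    refine hα' ⟨?_, fun a ha => hcon a ha⟩
    rw [← hα.1]
    exact Finset.sum_subset hst fun a _ ha => by by_contra h; exact ha (hcon a h)
  obtain ⟨a, ha, has⟩ := this
  refine mul_eq_zero_of_right _ (Finset.prod_eq_zero (hα.2 a ha) ?_)
  rw [hw a (hα.2 a ha) has]
  have := fallingBasis_of_lt (Nat.pos_of_ne_zero ha)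
  simpa using this

/-- Two distinct multi-indices of the same total satisfy `β a < α a` at some vertex, and there the
factor of `α` vanishes at the node `β`. -/
theorem lagrangeSum_node {p : ℕ} (hp : 1 ≤ p) {s : Finset Plane} (c : (Plane → ℕ) → ℂ)
    {β : Plane → ℕ} (hβ : β ∈ s.piAntidiag p) {w : Plane → ℝ}
    (hw : ∀ a ∈ s, w a = (β a : ℝ) / p) : lagrangeSum p s c w = c β := by
  have hp0 : (p : ℂ) ≠ 0 := by exact_mod_cast (by omega : p ≠ 0)
  have hval : ∀ a ∈ s, (p : ℂ) * (w a : ℂ) = (β a : ℂ) := fun a ha => by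
    rw [hw a ha]; push_cast; field_simp
  rw [lagrangeSum, Finset.sum_eq_single_of_mem β hβ]
  · rw [Finset.prod_eq_one fun a ha => ?_, mul_one]
    rw [hval a ha, fallingBasis_self]
  · intro α hα hne
    rw [Finset.mem_piAntidiag] at hα hβ
    have : ∃ a ∈ s, β a < α a := by
      by_contra hcon
      push Not at hcon
      apply hne
      have heq := (Finset.sum_eq_sum_iff_of_le hcon).1 (hα.1.trans hβ.1.symm)
      funext a
      by_cases ha : a ∈ s
      · exact heq a ha
      · have h1 : α a = 0 := by by_contra h; exact ha (hα.2 a h)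
        have h2 : β a = 0 := by by_contra h; exact ha (hβ.2 a h)
        rw [h1, h2]
    obtain ⟨a, ha, hlt⟩ := this
    refine mul_eq_zero_of_right _ (Finset.prod_eq_zero ha ?_)
    rw [hval a ha, fallingBasis_of_lt hlt]

theorem mem_triangleNodes {p : ℕ} {τ : Finset Plane} {x : Plane} :
    x ∈ triangleNodes p τ ↔ ∃ α ∈ τ.piAntidiag p, x = nodePoint p τ α := by
  constructor
  · rintro ⟨α, hα, rfl⟩
    refine ⟨fun a => if a ∈ τ then α a else 0, ?_, ?_⟩
    · rw [Finset.mem_piAntidiag]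
      refine ⟨?_, fun i hi => by by_contra h; simp [h] at hi⟩
      rw [← hα]; exact Finset.sum_congr rfl fun a ha => by simp [ha]
    · exact Finset.sum_congr rfl fun a ha => by simp [ha]
  · rintro ⟨α, hα, rfl⟩
    exact ⟨α, (Finset.mem_piAntidiag.1 hα).1, rfl⟩

theorem sum_div_of_mem_piAntidiag {p : ℕ} (hp : 1 ≤ p) {s : Finset Plane} {α : Plane → ℕ}
    (hα : α ∈ s.piAntidiag p) : ∑ a ∈ s, (α a : ℝ) / p = 1 := by
  have hp0 : (p : ℝ) ≠ 0 := by exact_mod_cast (by omega : p ≠ 0)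
  rw [← Finset.sum_div, div_eq_one_iff_eq hp0]
  exact_mod_cast (Finset.mem_piAntidiag.1 hα).1

theorem IsTriangle.bary_nodePoint {τ : Finset Plane} (h : IsTriangle τ) {p : ℕ} (hp : 1 ≤ p)
    {α : Plane → ℕ} (hα : α ∈ τ.piAntidiag p) {a : Plane} (ha : a ∈ τ) :
    bary τ a (nodePoint p τ α) = (α a : ℝ) / p :=
  h.bary_combination (w := fun a => (α a : ℝ) / p) (sum_div_of_mem_piAntidiag hp hα) ha

theorem triangleNodes_subset_hull {p : ℕ} (hp : 1 ≤ p) (τ : Finset Plane) :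
    triangleNodes p τ ⊆ hull τ := by
  intro x hx
  obtain ⟨α, hα, rfl⟩ := mem_triangleNodes.1 hx
  exact Finset.mem_convexHull'.2 ⟨fun a => (α a : ℝ) / p, fun a _ => by positivity,
    sum_div_of_mem_piAntidiag hp hα, rfl⟩

theorem finite_triangleNodes (p : ℕ) (τ : Finset Plane) : (triangleNodes p τ).Finite := by
  refine ((τ.piAntidiag p).image (nodePoint p τ)).finite_toSet.subset fun x hx => ?_
  obtain ⟨α, hα, rfl⟩ := mem_triangleNodes.1 hx
  exact Finset.mem_coe.2 (Finset.mem_image_of_mem _ hα)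

/-- `f` is a polynomial function of degree at most `d`. -/
def IsPolyFun (d : ℕ) (f : Plane → ℂ) : Prop :=
  ∃ q : MvPolynomial (Fin 2) ℂ, q.totalDegree ≤ d ∧ ∀ x, evalAt x q = f x

namespace IsPolyFun

theorem const (c : ℂ) (d : ℕ) : IsPolyFun d fun _ => c :=
  ⟨MvPolynomial.C c, (MvPolynomial.totalDegree_C _).le.trans (Nat.zero_le _), fun _ => by
    rw [evalAt, MvPolynomial.eval_C]⟩

theorem add {d : ℕ} {f g : Plane → ℂ} (hf : IsPolyFun d f) (hg : IsPolyFun d g) :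
    IsPolyFun d fun x => f x + g x := by
  obtain ⟨q, hq, hq'⟩ := hf
  obtain ⟨r, hr, hr'⟩ := hg
  exact ⟨q + r, (MvPolynomial.totalDegree_add _ _).trans (max_le hq hr), fun x => by
    rw [evalAt, map_add]; exact congrArg₂ _ (hq' x) (hr' x)⟩

theorem mul {d e : ℕ} {f g : Plane → ℂ} (hf : IsPolyFun d f) (hg : IsPolyFun e g) :
    IsPolyFun (d + e) fun x => f x * g x := by
  obtain ⟨q, hq, hq'⟩ := hf
  obtain ⟨r, hr, hr'⟩ := hg
  exact ⟨q * r, (MvPolynomial.totalDegree_mul _ _).trans (add_le_add hq hr), fun x => by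
    rw [evalAt, map_mul]; exact congrArg₂ _ (hq' x) (hr' x)⟩

theorem const_mul {d : ℕ} {f : Plane → ℂ} (hf : IsPolyFun d f) (c : ℂ) :
    IsPolyFun d fun x => c * f x := by
  simpa using (const c 0).mul hf

theorem sum {ι : Type*} {d : ℕ} {s : Finset ι} {f : ι → Plane → ℂ}
    (hf : ∀ i ∈ s, IsPolyFun d (f i)) : IsPolyFun d fun x => ∑ i ∈ s, f i x := by
  induction s using Finset.induction_on with
  | empty => simpa using const 0 d
  | insert i s hi ih =>
    simp only [Finset.sum_insert hi]
    exact (hf i (Finset.mem_insert_self _ _)).add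
      (ih fun j hj => hf j (Finset.mem_insert_of_mem hj))

theorem prod {ι : Type*} {d : ι → ℕ} {s : Finset ι} {f : ι → Plane → ℂ}
    (hf : ∀ i ∈ s, IsPolyFun (d i) (f i)) : IsPolyFun (∑ i ∈ s, d i) fun x => ∏ i ∈ s, f i x := by
  induction s using Finset.induction_on with
  | empty => simpa using const 1 0
  | insert i s hi ih =>
    simp only [Finset.prod_insert hi, Finset.sum_insert hi]
    exact (hf i (Finset.mem_insert_self _ _)).mul
      (ih fun j hj => hf j (Finset.mem_insert_of_mem hj))

end IsPolyFun

theorem isPolyFun_lagrangeSum (p : ℕ) (τ : Finset Plane) (c : (Plane → ℕ) → ℂ) :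
    IsPolyFun p fun x => lagrangeSum p τ c (fun a => bary τ a x) := by
  refine IsPolyFun.sum fun α hα => IsPolyFun.const_mul ?_ _
  have h : IsPolyFun (∑ a ∈ τ, α a) fun x => ∏ a ∈ τ, fallingBasis (α a) (p * (bary τ a x : ℝ)) := ?_
  · rwa [(Finset.mem_piAntidiag.1 hα).1] at h
  refine IsPolyFun.prod fun a _ => ?_
  have h1 : ∀ j ∈ Finset.range (α a), IsPolyFun 1
      fun x => ((α a : ℂ) - j)⁻¹ * ((p : ℂ) * (bary τ a x : ℂ) - j) := fun j _ => by
    obtain hl : IsPolyFun 1 fun x => (bary τ a x : ℂ) := exists_affine_polynomial _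
    simpa only [sub_eq_add_neg] using ((hl.const_mul p).add (.const (-(j : ℂ)) 1)).const_mul _
  simpa [fallingBasis] using IsPolyFun.prod h1

/-- The monomial with exponents `(i, j)` is sent to the multi-index `(i, j, p - i - j)`, which is an
injection. -/
theorem finrank_restrictTotalDegree_le {τ : Finset Plane} (hτ : τ.card = 3) (p : ℕ) :
    Module.finrank ℂ (MvPolynomial.restrictTotalDegree (Fin 2) ℂ p) ≤ (τ.piAntidiag p).card := by
  obtain ⟨a, b, c, hab, hac, hbc, rfl⟩ := Finset.card_eq_three.1 hτ
  rw [MvPolynomial.restrictTotalDegree,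
    Module.finrank_eq_nat_card_basis (MvPolynomial.basisRestrictSupport ℂ _),
    ← Nat.card_eq_finsetCard]
  have hdeg : ∀ n : {n : Fin 2 →₀ ℕ | (n.sum fun _ e => e) ≤ p}, n.1 0 + n.1 1 ≤ p := fun n => by
    have := n.2
    rw [Set.mem_ofPred_eq, Finsupp.sum_fintype _ _ fun _ => rfl] at this
    simpa using this
  let g : {n : Fin 2 →₀ ℕ | (n.sum fun _ e => e) ≤ p} → (({a, b, c} : Finset Plane).piAntidiag p) :=
    fun n => ⟨fun x => if x = a then n.1 0 else if x = b then n.1 1 else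
      if x = c then p - n.1 0 - n.1 1 else 0, by
      rw [Finset.mem_piAntidiag]
      refine ⟨?_, fun x hx => by
        by_contra h
        simp only [Finset.mem_insert, Finset.mem_singleton, not_or] at h
        simp [h.1, h.2.1, h.2.2] at hx⟩
      rw [Finset.sum_insert (by simp [hab, hac]), Finset.sum_insert (by simp [hbc]),
        Finset.sum_singleton]
      have := hdeg n
      simp only [if_true, if_neg hab.symm, if_neg hac.symm, if_neg hbc.symm]
      omega⟩
  refine Nat.card_le_card_of_injective g fun n m hnm => ?_
  have h := congrArg Subtype.val hnm
  have h0 := congrFun h a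
  have h1 := congrFun h b
  simp only [g, if_true, if_neg hab.symm] at h0 h1
  refine Subtype.ext (Finsupp.ext fun i => ?_)
  fin_cases i
  · exact h0
  · exact h1

/-- Unisolvence: evaluation at the nodes is surjective because of the Lagrange interpolant, and the
polynomial space has no larger dimension than the target, so evaluation is injective too. -/
theorem IsTriangle.evalAt_eq_zero {τ : Finset Plane} (h : IsTriangle τ) {p : ℕ} (hp : 1 ≤ p)
    {q : MvPolynomial (Fin 2) ℂ} (hq : q.totalDegree ≤ p)
    (h0 : ∀ x ∈ triangleNodes p τ, evalAt x q = 0) (x : Plane) : evalAt x q = 0 := by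
  let ev : MvPolynomial.restrictTotalDegree (Fin 2) ℂ p →ₗ[ℂ] (τ.piAntidiag p → ℂ) :=
    { toFun := fun q α => evalAt (nodePoint p τ α) q.1
      map_add' := fun _ _ => by ext; simp
      map_smul' := fun _ _ => by ext; simp }
  have hsurj : Function.Surjective ev := fun c => by
    obtain ⟨q, hq1, hq2⟩ := isPolyFun_lagrangeSum p τ
      (fun α => if hα : α ∈ τ.piAntidiag p then c ⟨α, hα⟩ else 0)
    refine ⟨⟨q, (MvPolynomial.mem_restrictTotalDegree _ _ _).2 hq1⟩, ?_⟩
    ext α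
    change evalAt (nodePoint p τ α) q = _
    rw [hq2]
    beta_reduce
    rw [lagrangeSum_node hp _ α.2 fun a ha => h.bary_nodePoint hp α.2 ha, dif_pos α.2]
  have hfin : Module.finrank ℂ (MvPolynomial.restrictTotalDegree (Fin 2) ℂ p)
      = Module.finrank ℂ (τ.piAntidiag p → ℂ) := by
    refine le_antisymm ?_ (LinearMap.finrank_le_finrank_of_surjective hsurj)
    simpa using finrank_restrictTotalDegree_le h.1 p
  have hinj := (LinearMap.injective_iff_surjective_of_finrank_eq_finrank hfin).2 hsurj
  let q' : MvPolynomial.restrictTotalDegree (Fin 2) ℂ p :=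
    ⟨q, (MvPolynomial.mem_restrictTotalDegree _ _ _).2 hq⟩
  have : q' = 0 := hinj (by
    rw [map_zero]; ext α
    exact h0 _ (mem_triangleNodes.2 ⟨α, α.2, rfl⟩))
  have hq0 : q = 0 := congrArg Subtype.val this
  rw [hq0, evalAt, map_zero]

end Lagrange

/-! ### Piecewise polynomial functions -/

theorem mem_region {T : Finset (Finset Plane)} {x : Plane} :
    x ∈ region T ↔ ∃ τ ∈ T, x ∈ hull τ := by
  simp [region]

theorem isClosed_region (T : Finset (Finset Plane)) : IsClosed (region T) :=
  T.finite_toSet.isClosed_biUnion fun τ _ => isClosed_hull τ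

theorem isCompact_region (T : Finset (Finset Plane)) : IsCompact (region T) :=
  T.finite_toSet.isCompact_biUnion fun τ _ => isCompact_hull τ

theorem hull_subset_region {T : Finset (Finset Plane)} {τ : Finset Plane} (hτ : τ ∈ T) :
    hull τ ⊆ region T := fun _ hx => mem_region.2 ⟨τ, hτ, hx⟩

theorem region_mono {S T : Finset (Finset Plane)} (h : S ⊆ T) : region S ⊆ region T :=
  fun _ hx => by
    obtain ⟨τ, hτ, hx⟩ := mem_region.1 hx
    exact mem_region.2 ⟨τ, h hτ, hx⟩

theorem closure_interior_region {T : Finset (Finset Plane)} (hT : ∀ τ ∈ T, IsTriangle τ) :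
    closure (interior (region T)) = region T := by
  refine Set.Subset.antisymm ?_ fun x hx => ?_
  · exact (isClosed_region T).closure_subset_iff.2 interior_subset
  · obtain ⟨τ, hτ, hx⟩ := mem_region.1 hx
    rw [← (hT τ hτ).closure_interior] at hx
    exact closure_mono (interior_mono (hull_subset_region hτ)) hx

/-- The functions that are polynomial on each of the triangles in `T`. -/
def piecewisePoly (T : Finset (Finset Plane)) : Submodule ℂ (Plane → ℂ) where
  carrier := {v | ∀ τ ∈ T, ∃ d f, IsPolyFun d f ∧ Set.EqOn v f (hull τ)}
  zero_mem' := fun τ _ => ⟨0, fun _ => 0, .const 0 0, fun _ _ => rfl⟩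
  add_mem' := fun {v w} hv hw τ hτ => by
    obtain ⟨d, f, ⟨q, _, hq⟩, hf⟩ := hv τ hτ
    obtain ⟨e, g, ⟨r, _, hr⟩, hg⟩ := hw τ hτ
    exact ⟨_, fun x => f x + g x, ⟨q + r, le_rfl, fun x => by
      rw [evalAt, map_add]; exact congrArg₂ _ (hq x) (hr x)⟩, fun x hx =>
      congrArg₂ (· + ·) (hf hx) (hg hx)⟩
  smul_mem' := fun c v hv τ hτ => by
    obtain ⟨d, f, hf, hvf⟩ := hv τ hτ
    exact ⟨d, _, hf.const_mul c, fun x hx => congrArg (c * ·) (hvf hx)⟩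

theorem piecewisePoly_anti {S T : Finset (Finset Plane)} (h : S ⊆ T) :
    piecewisePoly T ≤ piecewisePoly S := fun _ hv τ hτ => hv τ (h hτ)

theorem piecewisePoly_congr {T : Finset (Finset Plane)} {v w : Plane → ℂ}
    (hv : v ∈ piecewisePoly T) (h : Set.EqOn w v (region T)) : w ∈ piecewisePoly T :=
  fun τ hτ => by
    obtain ⟨d, f, hf, hvf⟩ := hv τ hτ
    exact ⟨d, f, hf, (h.mono (hull_subset_region hτ)).trans hvf⟩

theorem IsPolyFun.contDiff {d : ℕ} {f : Plane → ℂ} (hf : IsPolyFun d f) : ContDiff ℝ 1 f := by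
  obtain ⟨q, -, hq⟩ := hf
  have : f = fun x => evalAt x q := funext fun x => (hq x).symm
  rw [this]
  clear hq this
  induction q using MvPolynomial.induction_on with
  | C a => simp only [evalAt, MvPolynomial.eval_C]; exact contDiff_const
  | add p q hp hq => simp only [evalAt, map_add]; exact hp.add hq
  | mul_X p i hp =>
    simp only [evalAt, map_mul, MvPolynomial.eval_X]
    refine hp.mul (Complex.ofRealCLM.contDiff.comp ?_)
    exact (EuclideanSpace.proj (𝕜 := ℝ) i).contDiff

theorem continuousOn_region {T : Finset (Finset Plane)} {v : Plane → ℂ}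
    (h : ∀ τ ∈ T, ContinuousOn v (hull τ)) : ContinuousOn v (region T) := by
  have : region T = ⋃ τ : T, hull τ.1 := by
    ext x; simp [mem_region]
  rw [this]
  exact (locallyFinite_of_finite _).continuousOn_iUnion (fun τ => isClosed_hull τ.1)
    fun τ => h τ.1 τ.2

/-- A single function that is polynomial on each of finitely many closed triangles is continuous by
pasting; this is why `piecewisePoly` carries no continuity clause. -/
theorem continuousOn_of_mem_piecewisePoly {T : Finset (Finset Plane)} {v : Plane → ℂ}
    (hv : v ∈ piecewisePoly T) : ContinuousOn v (region T) :=
  continuousOn_region fun τ hτ => by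
    obtain ⟨d, f, hf, hvf⟩ := hv τ hτ
    exact hf.contDiff.continuous.continuousOn.congr hvf

/-! ### Conforming meshes. -/

namespace Mesh

variable {Ω : Set Plane} (m : Mesh Ω)

theorem isTriangle {τ : Finset Plane} (hτ : τ ∈ m.elems) : IsTriangle τ :=
  ⟨m.card_eq τ hτ, m.indep τ hτ⟩

theorem region_eq : region m.elems = closure Ω := by
  have := closure_interior_region fun τ hτ => m.isTriangle hτ
  rw [m.cover] at this
  exact this.symm

theorem hull_inter [DecidableEq Plane] {σ τ : Finset Plane} (hσ : σ ∈ m.elems)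
    (hτ : τ ∈ m.elems) : hull σ ∩ hull τ = hull (σ ∩ τ) := by
  rw [hull, hull, m.conforming σ hσ τ hτ, hull, Finset.coe_inter]

/-- By conformity a common point lies in the face spanned by the common vertices. Some vertex of `σ`
is missing from `τ`, so its coordinate vanishes there, while it is positive inside `σ`. -/
theorem disjoint_interior_hull {σ τ : Finset Plane} (hσ : σ ∈ m.elems) (hτ : τ ∈ m.elems)
    (hne : σ ≠ τ) : Disjoint (interior (hull σ)) (hull τ) := by
  classical
  rw [Set.disjoint_left]
  intro x hx hx'
  have h1 : x ∈ hull (σ ∩ τ) := by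
    rw [← m.hull_inter hσ hτ]; exact ⟨interior_subset hx, hx'⟩
  rw [(m.isTriangle hσ).mem_hull_of_subset Finset.inter_subset_left] at h1
  rw [(m.isTriangle hσ).interior_hull] at hx
  have : ¬ σ ⊆ τ := fun h => hne (Finset.eq_of_subset_of_card_le h (by
    rw [m.card_eq σ hσ, m.card_eq τ hτ]))
  obtain ⟨a, ha, ha'⟩ := Finset.not_subset.1 this
  exact (hx a ha).ne' (h1.2 a ha fun h => ha' (Finset.mem_inter.1 h).2)

end Mesh

/-! ### Nodal interpolation, finite element spaces and the operators `R_l`, `E_l`, `D_l`. -/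

namespace Discretization

variable {Ω : Set Plane} (D : Discretization Ω)

open scoped Classical in
-- The elementwise Lagrange interpolants agree on `σ ∩ τ`, since both reduce there to the
-- interpolant of the shared face. Thus `interp` never takes its default value.
theorem exists_interp (f : Plane → ℂ) : ∃ v ∈ D.feSpace, ∀ x ∈ D.nodes, v x = f x := by
  let c : Finset Plane → (Plane → ℕ) → ℂ := fun τ α => f (nodePoint D.p τ α)
  let I : Finset Plane → Plane → ℂ := fun τ x => lagrangeSum D.p τ (c τ) fun a => bary τ a x
  have agree : ∀ σ ∈ D.mesh.elems, ∀ τ ∈ D.mesh.elems, ∀ x ∈ hull σ, x ∈ hull τ →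
      I σ x = I τ x := by
    intro σ hσ τ hτ x hxσ hxτ
    have hx : x ∈ hull (σ ∩ τ) := by rw [← D.mesh.hull_inter hσ hτ]; exact ⟨hxσ, hxτ⟩
    obtain ⟨w, hw0, hw1, hwx⟩ := Finset.mem_convexHull'.1 hx
    have key : ∀ τ' ∈ D.mesh.elems, σ ∩ τ ⊆ τ' →
        I τ' x = lagrangeSum D.p (σ ∩ τ) (c (σ ∩ τ)) w := by
      intro τ' hτ' hsub
      have hT := D.mesh.isTriangle hτ'
      refine lagrangeSum_subset hsub (fun α hα => ?_) (fun a ha => ?_) fun a ha ha' => ?_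
      · simp only [c, nodePoint_subset hsub hα]
      · let w' : Plane → ℝ := fun a => if a ∈ σ ∩ τ then w a else 0
        have h1 : ∑ a ∈ τ', w' a = 1 := by
          rw [← hw1]; simp only [w', Finset.sum_ite_mem, Finset.inter_eq_right.2 hsub]
        have h2 : x = ∑ a ∈ τ', w' a • a := by
          simp only [w', ite_smul, zero_smul, Finset.sum_ite_mem, Finset.inter_eq_right.2 hsub]
          exact hwx.symm
        rw [h2, hT.bary_combination h1 (hsub ha)]
        simp only [w', if_pos ha]
      · exact ((hT.mem_hull_of_subset hsub).1 hx).2 a ha ha'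
    rw [key σ hσ Finset.inter_subset_left, key τ hτ Finset.inter_subset_right]
  let v : Plane → ℂ := fun x => if h : ∃ τ ∈ D.mesh.elems, x ∈ hull τ then I h.choose x else 0
  have hv : ∀ τ ∈ D.mesh.elems, ∀ x ∈ hull τ, v x = I τ x := by
    intro τ hτ x hx
    have h : ∃ τ ∈ D.mesh.elems, x ∈ hull τ := ⟨τ, hτ, hx⟩
    change (if h : ∃ τ ∈ D.mesh.elems, x ∈ hull τ then I h.choose x else 0) = _
    rw [dif_pos h]
    exact agree _ h.choose_spec.1 _ hτ x h.choose_spec.2 hx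
  have hpoly : ∀ τ, IsPolyFun D.p (I τ) := fun τ => isPolyFun_lagrangeSum _ _ _
  refine ⟨v, ⟨?_, fun τ hτ => ?_, fun x hx => ?_⟩, fun x hx => ?_⟩
  · rw [← D.mesh.region_eq]
    exact continuousOn_region fun τ hτ => (hpoly τ).contDiff.continuous.continuousOn.congr (hv τ hτ)
  · obtain ⟨q, hq, hq'⟩ := hpoly τ
    exact ⟨q, hq, fun x hx => (hv τ hτ x hx).trans (hq' x).symm⟩
  · rw [← D.mesh.region_eq, mem_region] at hx
    exact dif_neg hx
  · obtain ⟨τ, hτ, hx⟩ := Set.mem_iUnion₂.1 hx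
    rw [hv τ hτ x (triangleNodes_subset_hull D.one_le_p τ hx)]
    obtain ⟨α, hα, rfl⟩ := mem_triangleNodes.1 hx
    exact lagrangeSum_node D.one_le_p _ hα fun a ha =>
      (D.mesh.isTriangle hτ).bary_nodePoint D.one_le_p hα ha

/-- The finite element space as a submodule. -/
def feSubmodule : Submodule ℂ (Plane → ℂ) where
  carrier := D.feSpace
  zero_mem' := ⟨continuousOn_const, fun _ _ => ⟨0, by simp, by simp⟩, fun _ _ => rfl⟩
  add_mem' := fun {v w} hv hw => ⟨hv.1.add hw.1, fun τ hτ => by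
    obtain ⟨q, hq, hq'⟩ := hv.2.1 τ hτ
    obtain ⟨r, hr, hr'⟩ := hw.2.1 τ hτ
    exact ⟨q + r, (MvPolynomial.totalDegree_add _ _).trans (max_le hq hr), fun x hx => by
      rw [map_add, ← hq' x hx, ← hr' x hx]; rfl⟩, fun x hx => by
    rw [Pi.add_apply, hv.2.2 x hx, hw.2.2 x hx, add_zero]⟩
  smul_mem' := fun c v hv => ⟨hv.1.const_smul c, fun τ hτ => by
    obtain ⟨q, hq, hq'⟩ := hv.2.1 τ hτ
    exact ⟨c • q, (MvPolynomial.totalDegree_smul_le _ _).trans hq, fun x hx => by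
      rw [MvPolynomial.smul_eval, ← hq' x hx]; rfl⟩, fun x hx => by
    rw [Pi.smul_apply, hv.2.2 x hx, smul_zero]⟩

theorem feSubmodule_le : D.feSubmodule ≤ piecewisePoly D.mesh.elems := fun v hv τ hτ => by
  obtain ⟨q, hq, hq'⟩ := hv.2.1 τ hτ
  exact ⟨D.p, fun x => evalAt x q, ⟨q, hq, fun _ => rfl⟩, hq'⟩

theorem eqOn_hull_of_nodes {v : Plane → ℂ} (hv : v ∈ D.feSpace) {τ : Finset Plane}
    (hτ : τ ∈ D.mesh.elems) (h : ∀ x ∈ triangleNodes D.p τ, v x = 0) : ∀ x ∈ hull τ, v x = 0 := by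
  obtain ⟨q, hq, hq'⟩ := hv.2.1 τ hτ
  intro x hx
  rw [hq' x hx]
  refine (D.mesh.isTriangle hτ).evalAt_eq_zero D.one_le_p hq (fun y hy => ?_) x
  exact (hq' y (triangleNodes_subset_hull D.one_le_p τ hy)).symm.trans (h y hy)

theorem eq_zero_of_nodes {v : Plane → ℂ} (hv : v ∈ D.feSpace) (h : ∀ x ∈ D.nodes, v x = 0) :
    v = 0 := by
  funext x
  by_cases hx : x ∈ closure Ω
  · rw [← D.mesh.region_eq] at hx
    obtain ⟨τ, hτ, hx⟩ := mem_region.1 hx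
    exact D.eqOn_hull_of_nodes hv hτ (fun y hy => h y (Set.mem_biUnion hτ hy)) x hx
  · exact hv.2.2 x hx

theorem eq_of_nodes {v w : Plane → ℂ} (hv : v ∈ D.feSpace) (hw : w ∈ D.feSpace)
    (h : ∀ x ∈ D.nodes, v x = w x) : v = w := by
  rw [← sub_eq_zero]
  refine D.eq_zero_of_nodes (D.feSubmodule.sub_mem hv hw) fun x hx => ?_
  rw [Pi.sub_apply, h x hx, sub_self]

theorem interp_spec (f : Plane → ℂ) :
    D.interp f ∈ D.feSpace ∧ ∀ x ∈ D.nodes, D.interp f x = f x := by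
  rw [interp, dif_pos (D.exists_interp f)]
  exact (D.exists_interp f).choose_spec

theorem interp_eq {f v : Plane → ℂ} (hv : v ∈ D.feSpace) (h : ∀ x ∈ D.nodes, v x = f x) :
    D.interp f = v :=
  D.eq_of_nodes (D.interp_spec f).1 hv fun x hx => ((D.interp_spec f).2 x hx).trans (h x hx).symm

/-- Nodal interpolation as a linear map. -/
def interpLin : (Plane → ℂ) →ₗ[ℂ] (Plane → ℂ) where
  toFun := D.interp
  map_add' := fun f g => D.interp_eq
    (D.feSubmodule.add_mem (D.interp_spec f).1 (D.interp_spec g).1) fun x hx => by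
      rw [Pi.add_apply, Pi.add_apply, (D.interp_spec f).2 x hx, (D.interp_spec g).2 x hx]
  map_smul' := fun c f => D.interp_eq (D.feSubmodule.smul_mem c (D.interp_spec f).1) fun x hx => by
      rw [RingHom.id_apply, Pi.smul_apply, Pi.smul_apply, (D.interp_spec f).2 x hx]

/-- The restriction `R_l` as a linear map. -/
def restrLin (l : Fin D.N) : (Plane → ℂ) →ₗ[ℂ] (Plane → ℂ) where
  toFun := D.restr l
  map_add' := fun f g => Set.indicator_add _ f g
  map_smul' := fun c f => Set.indicator_const_smul _ c f

/-- The prolongation `E_l` as a linear map. -/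
def prolongLin (l : Fin D.N) : (Plane → ℂ) →ₗ[ℂ] (Plane → ℂ) := D.interpLin ∘ₗ D.restrLin l

/-- The weighting operator `D_l` as a linear map. -/
def weightLin (l : Fin D.N) : (Plane → ℂ) →ₗ[ℂ] (Plane → ℂ) :=
  D.interpLin ∘ₗ LinearMap.mulLeft ℂ fun x => (D.χ l x : ℂ)

/-- The weighted prolongation `D_l E_l`. -/
def weightedProlong (l : Fin D.N) : (Plane → ℂ) →ₗ[ℂ] (Plane → ℂ) :=
  D.weightLin l ∘ₗ D.prolongLin l

theorem weightedProlong_apply (l : Fin D.N) (v : Plane → ℂ) :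
    D.weightedProlong l v = D.weight l (D.prolong l v) := rfl

theorem weightedProlong_mem (l : Fin D.N) (v : Plane → ℂ) :
    D.weightedProlong l v ∈ D.feSubmodule := (D.interp_spec _).1

theorem finite_nodes : D.nodes.Finite :=
  D.mesh.elems.finite_toSet.biUnion fun τ _ => finite_triangleNodes D.p τ

instance : FiniteDimensional ℂ D.feSubmodule := by
  have : Finite D.nodes := D.finite_nodes
  let f : D.feSubmodule →ₗ[ℂ] (D.nodes → ℂ) :=
    { toFun := fun v x => v.1 x.1
      map_add' := fun _ _ => rfl
      map_smul' := fun _ _ => rfl }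
  refine FiniteDimensional.of_injective f ?_
  rw [← LinearMap.ker_eq_bot, LinearMap.ker_eq_bot']
  intro v hv
  exact Subtype.ext (D.eq_zero_of_nodes v.2 fun x hx => congrFun hv ⟨x, hx⟩)

/-- The local finite element space as a submodule. -/
def localSubmodule (l : Fin D.N) : Submodule ℂ (Plane → ℂ) := D.feSubmodule.map (D.restrLin l)

instance (l : Fin D.N) : FiniteDimensional ℂ (D.localSubmodule l) :=
  inferInstanceAs (FiniteDimensional ℂ (D.feSubmodule.map (D.restrLin l)))

theorem localSubmodule_le (l : Fin D.N) : D.localSubmodule l ≤ piecewisePoly (D.subElems l) := by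
  rintro _ ⟨v, hv, rfl⟩
  exact piecewisePoly_congr (piecewisePoly_anti (D.subElems_subset l) (D.feSubmodule_le hv))
    fun x hx => Set.indicator_of_mem hx v

theorem localSubmodule_eq_zero {l : Fin D.N} {v : Plane → ℂ} (hv : v ∈ D.localSubmodule l)
    {x : Plane} (hx : x ∉ region (D.subElems l)) : v x = 0 := by
  obtain ⟨v, hv, rfl⟩ := hv
  exact Set.indicator_of_notMem hx v

theorem isTriangle_sub {l : Fin D.N} : ∀ τ ∈ D.subElems l, IsTriangle τ :=
  fun _ hτ => D.mesh.isTriangle (D.subElems_subset l hτ)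

/-- The interior of an element outside `Ω_l` misses the closed subdomain, so `χ_l` vanishes there
and, by continuity, on the whole element. This includes nodes on `∂Ω_l`, where `E_l v` itself need
not vanish. -/
theorem weightedProlong_eq_zero (l : Fin D.N) (v : Plane → ℂ) {τ : Finset Plane}
    (hτ : τ ∈ D.mesh.elems) (hτl : τ ∉ D.subElems l) : ∀ x ∈ hull τ, D.weightedProlong l v x = 0 := by
  refine D.eqOn_hull_of_nodes (D.weightedProlong_mem l v) hτ fun x hx => ?_
  have hsub : hull τ ⊆ closure Ω := by
    rw [← D.mesh.region_eq]; exact hull_subset_region hτ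
  have hxτ := triangleNodes_subset_hull D.one_le_p τ hx
  have hint : Set.EqOn (D.χ l) 0 (interior (hull τ)) := fun y hy => by
    refine D.χ_support l y (hsub (interior_subset hy)) fun hy' => ?_
    obtain ⟨σ, hσ, hyσ⟩ := mem_region.1 hy'
    exact Set.disjoint_left.1 (D.mesh.disjoint_interior_hull hτ (D.subElems_subset l hσ)
      (fun h => hτl (h ▸ hσ))) hy hyσ
  have hχ : D.χ l x = 0 := by
    have h1 : Set.EqOn (D.χ l) 0 (hull τ) :=
      hint.of_subset_closure ((D.χ_continuous l).mono hsub) continuousOn_const interior_subset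
        (D.mesh.isTriangle hτ).closure_interior.ge
    exact h1 hxτ
  rw [weightedProlong_apply, weight, (D.interp_spec _).2 x (Set.mem_biUnion hτ hx), hχ]
  simp

theorem closure_interior_closedSub (l : Fin D.N) : closure (D.sub l) = D.closedSub l :=
  closure_interior_region D.isTriangle_sub

/-- An element outside `Ω_l` can meet the closed subdomain only along `∂Ω_l`, so a zero trace makes
the extension by zero continuous across it. -/
theorem mem_feSpace_of_frontier {l : Fin D.N} {w : Plane → ℂ} (hw : w ∈ D.localSubmodule l)
    (h0 : ∀ x ∈ frontier (D.sub l), w x = 0) :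
    w ∈ D.feSubmodule ∧ ∀ τ ∈ D.mesh.elems, τ ∉ D.subElems l → ∀ x ∈ hull τ, w x = 0 := by
  have hout : ∀ τ ∈ D.mesh.elems, τ ∉ D.subElems l → ∀ x ∈ hull τ, w x = 0 := by
    intro τ hτ hτl x hx
    by_cases hx' : x ∈ region (D.subElems l)
    · apply h0
      rw [frontier, D.closure_interior_closedSub, sub, interior_interior]
      refine ⟨hx', fun hint => ?_⟩
      -- Were `x` interior to the subdomain, interior points of `τ` close to `x` would lie in an
      -- element of the subdomain, against disjointness.
      rw [← (D.mesh.isTriangle hτ).closure_interior, mem_closure_iff] at hx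
      obtain ⟨y, hy, hy'⟩ := hx _ isOpen_interior hint
      obtain ⟨σ, hσ, hyσ⟩ := mem_region.1 (interior_subset hy)
      exact Set.disjoint_left.1 (D.mesh.disjoint_interior_hull hτ (D.subElems_subset l hσ)
        (fun h => hτl (h ▸ hσ))) hy' hyσ
    · exact D.localSubmodule_eq_zero hw hx'
  refine ⟨?_, hout⟩
  obtain ⟨v, hv, hvw⟩ := hw
  have hval : ∀ τ ∈ D.mesh.elems, τ ∈ D.subElems l → ∀ x ∈ hull τ, w x = v x := by
    intro τ _ hτ x hx
    rw [← hvw]; exact Set.indicator_of_mem (hull_subset_region hτ hx) v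
  have hpoly : ∀ τ ∈ D.mesh.elems, ∃ q : MvPolynomial (Fin 2) ℂ, q.totalDegree ≤ D.p ∧
      ∀ x ∈ convexHull ℝ (τ : Set Plane), w x = MvPolynomial.eval (fun i => (x i : ℂ)) q := by
    intro τ hτ
    by_cases hτl : τ ∈ D.subElems l
    · obtain ⟨q, hq, hq'⟩ := hv.2.1 τ hτ
      exact ⟨q, hq, fun x hx => (hval τ hτ hτl x hx).trans (hq' x hx)⟩
    · exact ⟨0, by simp, fun x hx => by rw [map_zero]; exact hout τ hτ hτl x hx⟩
  refine ⟨?_, hpoly, fun x hx => ?_⟩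
  · rw [← D.mesh.region_eq]
    refine continuousOn_of_mem_piecewisePoly fun τ hτ => ?_
    obtain ⟨q, hq, hq'⟩ := hpoly τ hτ
    exact ⟨D.p, fun x => evalAt x q, ⟨q, hq, fun _ => rfl⟩, hq'⟩
  · rw [← hvw]
    refine Set.indicator_of_notMem (fun h => hx ?_) v
    rw [← D.mesh.region_eq]
    exact region_mono (D.subElems_subset l) h

theorem prolong_eq_self {l : Fin D.N} {w : Plane → ℂ} (hw : w ∈ D.localSubmodule l)
    (h0 : ∀ x ∈ frontier (D.sub l), w x = 0) : D.prolong l w = w := by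
  refine D.interp_eq (D.mem_feSpace_of_frontier hw h0).1 fun x _ => ?_
  by_cases hx : x ∈ D.closedSub l
  · rw [Set.indicator_of_mem hx]
  · rw [Set.indicator_of_notMem hx]; exact D.localSubmodule_eq_zero hw hx

end Discretization

/-! ### The sesquilinear forms on piecewise polynomial functions -/

section IntegralForm

variable {V : Type*} [AddCommGroup V] [Module ℂ V] {X : Type*} [MeasurableSpace X]

theorem integrable_mul_conj {μ : Measure X} {f g : X → ℂ} (hf : MemLp f 2 μ) (hg : MemLp g 2 μ) :
    Integrable (fun x => f x * conj (g x)) μ := hf.integrable_mul hg.star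

/-- The form `(v, w) ↦ ∫ U v conj (U w) dμ` for an operator `U` that is linear up to null sets. -/
def integralForm (μ : Measure X) (U : V → X → ℂ) (hU : ∀ v, MemLp (U v) 2 μ)
    (hadd : ∀ v w, U (v + w) =ᵐ[μ] U v + U w) (hsmul : ∀ (c : ℂ) v, U (c • v) =ᵐ[μ] c • U v) :
    V →ₗ[ℂ] V →ₗ⋆[ℂ] ℂ :=
  LinearMap.mk₂'ₛₗ _ _ (fun v w => ∫ x, U v x * conj (U w x) ∂μ)
    (fun u v w => by
      rw [← integral_add (integrable_mul_conj (hU u) (hU w)) (integrable_mul_conj (hU v) (hU w))]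
      refine integral_congr_ae ?_
      filter_upwards [hadd u v] with x hx
      rw [hx, Pi.add_apply, add_mul])
    (fun c v w => by
      rw [smul_eq_mul, RingHom.id_apply, ← integral_const_mul]
      refine integral_congr_ae ?_
      filter_upwards [hsmul c v] with x hx
      rw [hx, Pi.smul_apply, smul_eq_mul, mul_assoc])
    (fun u v w => by
      rw [← integral_add (integrable_mul_conj (hU u) (hU v)) (integrable_mul_conj (hU u) (hU w))]
      refine integral_congr_ae ?_
      filter_upwards [hadd v w] with x hx
      rw [hx, Pi.add_apply, map_add, mul_add])
    (fun c v w => by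
      rw [smul_eq_mul, ← integral_const_mul]
      refine integral_congr_ae ?_
      filter_upwards [hsmul c w] with x hx
      rw [hx, Pi.smul_apply, smul_eq_mul, map_mul, mul_left_comm])

theorem conj_integral_mul_conj (μ : Measure X) (f g : X → ℂ) :
    conj (∫ x, f x * conj (g x) ∂μ) = ∫ x, g x * conj (f x) ∂μ := by
  rw [← integral_conj]
  exact integral_congr_ae (Filter.Eventually.of_forall fun x => by simp [mul_comm])

theorem integral_mul_conj_self (μ : Measure X) (f : X → ℂ) :
    ∫ x, f x * conj (f x) ∂μ = ((∫ x, ‖f x‖ ^ 2 ∂μ : ℝ) : ℂ) := by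
  refine Eq.trans ?_ integral_complex_ofReal
  exact integral_congr_ae (Filter.Eventually.of_forall fun x => by
    simp [Complex.mul_conj, Complex.normSq_eq_norm_sq])

end IntegralForm

variable {T : Finset (Finset Plane)}

/-- Boundaries of convex sets are null. Almost everywhere, then, a piecewise polynomial coincides
locally with one polynomial and its classical gradient is linear in the function. -/
theorem ae_mem_interior_hull (T : Finset (Finset Plane)) :
    ∀ᵐ x : Plane, x ∈ region T → ∃ τ ∈ T, x ∈ interior (hull τ) := by
  have h : ∀ᵐ x : Plane, ∀ τ ∈ T, x ∉ frontier (hull τ) := by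
    refine (ae_ball_iff T.countable_toSet).2 fun τ _ => ?_
    exact measure_eq_zero_iff_ae_notMem.1
      ((convex_convexHull ℝ (τ : Set Plane)).addHaar_frontier volume)
  filter_upwards [h] with x hx hxT
  obtain ⟨τ, hτ, hxτ⟩ := mem_region.1 hxT
  refine ⟨τ, hτ, ?_⟩
  by_contra hcon
  exact hx τ hτ ⟨subset_closure hxτ, hcon⟩

theorem differentiableAt_of_mem_interior {v : Plane → ℂ} (hv : v ∈ piecewisePoly T)
    {τ : Finset Plane} (hτ : τ ∈ T) {x : Plane} (hx : x ∈ interior (hull τ)) :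
    DifferentiableAt ℝ v x := by
  obtain ⟨d, f, hf, hvf⟩ := hv τ hτ
  have h : v =ᶠ[nhds x] f :=
    Filter.eventually_of_mem (mem_interior_iff_mem_nhds.1 hx) fun y hy => hvf hy
  exact h.differentiableAt_iff.2 (hf.contDiff.differentiable one_ne_zero x)

theorem exists_fderiv_bound {v : Plane → ℂ} (hv : v ∈ piecewisePoly T) :
    ∃ K : ℝ, ∀ τ ∈ T, ∀ x ∈ interior (hull τ), ‖fderiv ℝ v x‖ ≤ K := by
  have h : ∀ τ ∈ T, ∃ K : ℝ, ∀ x ∈ interior (hull τ), ‖fderiv ℝ v x‖ ≤ K := by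
    intro τ hτ
    obtain ⟨d, f, hf, hvf⟩ := hv τ hτ
    obtain ⟨K, hK⟩ := (isCompact_hull τ).exists_bound_of_continuousOn
      (hf.contDiff.continuous_fderiv one_ne_zero).continuousOn
    refine ⟨K, fun x hx => ?_⟩
    have h : v =ᶠ[nhds x] f :=
      Filter.eventually_of_mem (mem_interior_iff_mem_nhds.1 hx) fun y hy => hvf hy
    rw [h.fderiv_eq]
    exact hK x (interior_subset hx)
  choose! K hK using h
  obtain ⟨K', hK'⟩ := (T.image K).bddAbove
  exact ⟨K', fun τ hτ x hx => (hK τ hτ x hx).trans (hK' (Finset.mem_image_of_mem K hτ))⟩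

/-- The partial derivative in the direction of the `i`-th coordinate. -/
def partialDeriv (i : Fin 2) (v : Plane → ℂ) (x : Plane) : ℂ :=
  fderiv ℝ v x (EuclideanSpace.single i 1)

theorem volume_interior_region_lt_top (T : Finset (Finset Plane)) :
    volume (interior (region T)) < ∞ :=
  (measure_mono interior_subset).trans_lt (isCompact_region T).measure_lt_top

instance (T : Finset (Finset Plane)) :
    IsFiniteMeasure (volume.restrict (interior (region T))) :=
  ⟨by simpa using volume_interior_region_lt_top T⟩

theorem frontier_interior_region_subset [DecidableEq Plane] (hT : ∀ τ ∈ T, IsTriangle τ) :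
    frontier (interior (region T)) ⊆ ⋃ τ ∈ T, ⋃ a ∈ τ, hull (τ.erase a) := by
  intro x hx
  rw [frontier, closure_interior_region hT, interior_interior] at hx
  obtain ⟨τ, hτ, hxτ⟩ := mem_region.1 hx.1
  refine Set.mem_biUnion hτ ((hT τ hτ).frontier_hull_subset ⟨subset_closure hxτ, fun h => ?_⟩)
  exact hx.2 (interior_mono (hull_subset_region hτ) h)

theorem frontier_interior_region_subset_region (hT : ∀ τ ∈ T, IsTriangle τ) :
    frontier (interior (region T)) ⊆ region T := by
  rw [frontier, closure_interior_region hT]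
  exact Set.sdiff_subset

theorem hull_erase_eq_segment [DecidableEq Plane] {τ : Finset Plane} (hτ : τ.card = 3) {a : Plane}
    (ha : a ∈ τ) : ∃ b c, b ∈ τ ∧ c ∈ τ ∧ b ≠ c ∧ b ≠ a ∧ c ≠ a ∧
      hull (τ.erase a) = segment ℝ b c := by
  have : (τ.erase a).card = 2 := by rw [Finset.card_erase_of_mem ha, hτ]
  obtain ⟨b, c, hbc, h⟩ := Finset.card_eq_two.1 this
  have hb : b ∈ τ.erase a := by rw [h]; simp
  have hc : c ∈ τ.erase a := by rw [h]; simp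
  refine ⟨b, c, Finset.mem_of_mem_erase hb, Finset.mem_of_mem_erase hc, hbc,
    Finset.ne_of_mem_erase hb, Finset.ne_of_mem_erase hc, ?_⟩
  rw [hull, h]
  simp [convexHull_pair]

theorem hausdorffMeasure_frontier_lt_top (hT : ∀ τ ∈ T, IsTriangle τ) :
    Measure.hausdorffMeasure 1 (frontier (interior (region T))) < ∞ := by
  classical
  refine (measure_mono (frontier_interior_region_subset hT)).trans_lt ?_
  refine measure_biUnion_lt_top T.finite_toSet fun τ hτ => ?_
  refine measure_biUnion_lt_top τ.finite_toSet fun a ha => ?_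
  obtain ⟨b, c, -, -, -, -, -, h⟩ := hull_erase_eq_segment (hT τ hτ).1 ha
  rw [h, hausdorffMeasure_segment]
  exact edist_lt_top _ _

theorem memLp_region {v : Plane → ℂ} (hv : v ∈ piecewisePoly T) :
    MemLp v 2 (volume.restrict (interior (region T))) := by
  obtain ⟨K, hK⟩ := (isCompact_region T).exists_bound_of_continuousOn
    (continuousOn_of_mem_piecewisePoly hv)
  refine MemLp.of_bound (((continuousOn_of_mem_piecewisePoly hv).mono
    interior_subset).aestronglyMeasurable isOpen_interior.measurableSet) K ?_
  exact ae_restrict_of_forall_mem isOpen_interior.measurableSet fun x hx => hK x (interior_subset hx)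

theorem ae_restrict_mem_interior_hull (T : Finset (Finset Plane)) :
    ∀ᵐ x : Plane ∂(volume.restrict (interior (region T))), ∃ τ ∈ T, x ∈ interior (hull τ) := by
  rw [ae_restrict_iff' isOpen_interior.measurableSet]
  filter_upwards [ae_mem_interior_hull T] with x hx hxT
  exact hx (interior_subset hxT)

theorem memLp_partialDeriv (i : Fin 2) {v : Plane → ℂ} (hv : v ∈ piecewisePoly T) :
    MemLp (partialDeriv i v) 2 (volume.restrict (interior (region T))) := by
  obtain ⟨K, hK⟩ := exists_fderiv_bound hv
  refine MemLp.of_bound (measurable_fderiv_apply_const ℝ v _).aestronglyMeasurable K ?_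
  filter_upwards [ae_restrict_mem_interior_hull T] with x ⟨τ, hτ, hx⟩
  refine (ContinuousLinearMap.le_opNorm _ _).trans ?_
  simpa using hK τ hτ x hx

theorem memLp_frontier (hT : ∀ τ ∈ T, IsTriangle τ) {v : Plane → ℂ} (hv : v ∈ piecewisePoly T) :
    MemLp v 2 ((Measure.hausdorffMeasure 1).restrict (frontier (interior (region T)))) := by
  have : IsFiniteMeasure
      ((Measure.hausdorffMeasure 1).restrict (frontier (interior (region T)))) :=
    ⟨by simpa using hausdorffMeasure_frontier_lt_top hT⟩
  have hsub := frontier_interior_region_subset_region hT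
  obtain ⟨K, hK⟩ := (isCompact_region T).exists_bound_of_continuousOn
    (continuousOn_of_mem_piecewisePoly hv)
  refine MemLp.of_bound (((continuousOn_of_mem_piecewisePoly hv).mono hsub).aestronglyMeasurable
    isClosed_frontier.measurableSet) K ?_
  exact ae_restrict_of_forall_mem isClosed_frontier.measurableSet fun x hx => hK x (hsub hx)

/-- The form `∫ ∂_i v conj (∂_i w)` on piecewise polynomial functions. -/
def partialForm (T : Finset (Finset Plane)) (i : Fin 2) :
    piecewisePoly T →ₗ[ℂ] piecewisePoly T →ₗ⋆[ℂ] ℂ :=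
  integralForm (volume.restrict (interior (region T))) (fun v => partialDeriv i v.1)
    (fun v => memLp_partialDeriv i v.2)
    (fun v w => by
      filter_upwards [ae_restrict_mem_interior_hull T] with x ⟨τ, hτ, hx⟩
      have := fderiv_add (differentiableAt_of_mem_interior v.2 hτ hx)
        (differentiableAt_of_mem_interior w.2 hτ hx)
      exact DFunLike.congr_fun this (EuclideanSpace.single i 1))
    (fun c v => by
      filter_upwards [ae_restrict_mem_interior_hull T] with x ⟨τ, hτ, hx⟩
      have := fderiv_const_smul (differentiableAt_of_mem_interior v.2 hτ hx) c
      exact DFunLike.congr_fun this (EuclideanSpace.single i 1))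

/-- The gradient form on piecewise polynomial functions. -/
def gradForm (T : Finset (Finset Plane)) : piecewisePoly T →ₗ[ℂ] piecewisePoly T →ₗ⋆[ℂ] ℂ :=
  ∑ i, partialForm T i

theorem gradForm_apply (v w : piecewisePoly T) :
    gradForm T v w = gradInner (interior (region T)) v w := by
  rw [gradForm, gradInner, integral_finsetSum, LinearMap.sum_apply, LinearMap.sum_apply]
  · rfl
  · exact fun i _ => integrable_mul_conj (memLp_partialDeriv i v.2) (memLp_partialDeriv i w.2)

/-- The `L²` form on piecewise polynomial functions. -/
def l2Form (T : Finset (Finset Plane)) : piecewisePoly T →ₗ[ℂ] piecewisePoly T →ₗ⋆[ℂ] ℂ :=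
  integralForm (volume.restrict (interior (region T))) (fun v => v.1) (fun v => memLp_region v.2)
    (fun _ _ => .rfl) (fun _ _ => .rfl)

theorem l2Form_apply (v w : piecewisePoly T) :
    l2Form T v w = l2Inner (interior (region T)) v w := rfl

/-- The boundary form on piecewise polynomial functions. -/
def bdryForm (hT : ∀ τ ∈ T, IsTriangle τ) :
    piecewisePoly T →ₗ[ℂ] piecewisePoly T →ₗ⋆[ℂ] ℂ :=
  integralForm ((Measure.hausdorffMeasure 1).restrict (frontier (interior (region T))))
    (fun v => v.1) (fun v => memLp_frontier hT v.2) (fun _ _ => .rfl) (fun _ _ => .rfl)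

theorem bdryForm_apply (hT : ∀ τ ∈ T, IsTriangle τ) (v w : piecewisePoly T) :
    bdryForm hT v w = bdryInner (interior (region T)) v w := rfl

/-- The `κ`-weighted inner product on piecewise polynomial functions. -/
def kForm (T : Finset (Finset Plane)) (κ : ℝ) :
    piecewisePoly T →ₗ[ℂ] piecewisePoly T →ₗ⋆[ℂ] ℂ :=
  gradForm T + (κ : ℂ) ^ 2 • l2Form T

theorem kForm_apply (κ : ℝ) (v w : piecewisePoly T) :
    kForm T κ v w = kInner κ (interior (region T)) v w := by
  simp [kForm, kInner, gradForm_apply, l2Form_apply]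

/-- The Helmholtz form on piecewise polynomial functions. -/
def hForm (hT : ∀ τ ∈ T, IsTriangle τ) (κ ε : ℝ) :
    piecewisePoly T →ₗ[ℂ] piecewisePoly T →ₗ⋆[ℂ] ℂ :=
  gradForm T - ((κ : ℂ) ^ 2 + Complex.I * (ε : ℂ)) • l2Form T
    - (Complex.I * (κ : ℂ)) • bdryForm hT

theorem hForm_apply (hT : ∀ τ ∈ T, IsTriangle τ) (κ ε : ℝ) (v w : piecewisePoly T) :
    hForm hT κ ε v w = helmholtzForm κ ε (interior (region T)) v w := by
  simp [hForm, helmholtzForm, gradForm_apply, l2Form_apply, bdryForm_apply hT]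

/-! #### Symmetry, positivity, definiteness -/

theorem conj_l2Inner (G : Set Plane) (v w : Plane → ℂ) : conj (l2Inner G v w) = l2Inner G w v :=
  conj_integral_mul_conj _ _ _

theorem conj_bdryInner (G : Set Plane) (v w : Plane → ℂ) :
    conj (bdryInner G v w) = bdryInner G w v :=
  conj_integral_mul_conj _ _ _

theorem conj_gradForm (v w : piecewisePoly T) : conj (gradForm T v w) = gradForm T w v := by
  simp only [gradForm, LinearMap.sum_apply, map_sum]
  exact Finset.sum_congr rfl fun i _ => conj_integral_mul_conj _ _ _

theorem conj_kForm (κ : ℝ) (v w : piecewisePoly T) : conj (kForm T κ v w) = kForm T κ w v := by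
  simp only [kForm, LinearMap.add_apply, LinearMap.smul_apply, map_add, smul_eq_mul, map_mul,
    map_pow, Complex.conj_ofReal, conj_gradForm, l2Form_apply, conj_l2Inner]

theorem l2Inner_self (G : Set Plane) (v : Plane → ℂ) :
    l2Inner G v v = ((∫ x in G, ‖v x‖ ^ 2 : ℝ) : ℂ) := integral_mul_conj_self _ _

theorem bdryInner_self (G : Set Plane) (v : Plane → ℂ) :
    bdryInner G v v
      = ((∫ x in frontier G, ‖v x‖ ^ 2 ∂(Measure.hausdorffMeasure 1) : ℝ) : ℂ) :=
  integral_mul_conj_self _ _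

theorem l2Inner_self_nonneg (G : Set Plane) (v : Plane → ℂ) : 0 ≤ (l2Inner G v v).re := by
  rw [l2Inner_self, Complex.ofReal_re]; exact integral_nonneg fun _ => sq_nonneg _

theorem bdryInner_self_nonneg (G : Set Plane) (v : Plane → ℂ) : 0 ≤ (bdryInner G v v).re := by
  rw [bdryInner_self, Complex.ofReal_re]; exact integral_nonneg fun _ => sq_nonneg _

theorem gradInner_self (G : Set Plane) (v : Plane → ℂ) :
    gradInner G v v = ((∫ x in G, ∑ i, ‖partialDeriv i v x‖ ^ 2 : ℝ) : ℂ) := by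
  refine Eq.trans ?_ integral_complex_ofReal
  exact integral_congr_ae (Filter.Eventually.of_forall fun x => by
    simp [partialDeriv, Complex.mul_conj, Complex.normSq_eq_norm_sq])

theorem gradInner_self_nonneg (G : Set Plane) (v : Plane → ℂ) : 0 ≤ (gradInner G v v).re := by
  rw [gradInner_self, Complex.ofReal_re]
  exact integral_nonneg fun _ => Finset.sum_nonneg fun _ _ => sq_nonneg _

theorem kInner_self_re (κ : ℝ) (G : Set Plane) (v : Plane → ℂ) :
    (kInner κ G v v).re = (gradInner G v v).re + κ ^ 2 * (l2Inner G v v).re := by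
  rw [kInner, l2Inner_self, gradInner_self, ← Complex.ofReal_pow, ← Complex.ofReal_mul,
    ← Complex.ofReal_add]
  simp only [Complex.ofReal_re]

theorem kInner_self_nonneg (κ : ℝ) (G : Set Plane) (v : Plane → ℂ) : 0 ≤ (kInner κ G v v).re := by
  rw [kInner_self_re]
  exact add_nonneg (gradInner_self_nonneg G v)
    (mul_nonneg (sq_nonneg _) (l2Inner_self_nonneg G v))

theorem kNorm_sq (κ : ℝ) (G : Set Plane) (v : Plane → ℂ) :
    kNorm κ G v ^ 2 = (kInner κ G v v).re := Real.sq_sqrt (kInner_self_nonneg κ G v)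

theorem kNorm_nonneg (κ : ℝ) (G : Set Plane) (v : Plane → ℂ) : 0 ≤ kNorm κ G v :=
  Real.sqrt_nonneg _

theorem eqOn_zero_of_l2Inner_self {v : Plane → ℂ} (hT : ∀ τ ∈ T, IsTriangle τ)
    (hv : v ∈ piecewisePoly T) (h : (l2Inner (interior (region T)) v v).re = 0) :
    ∀ x ∈ region T, v x = 0 := by
  rw [l2Inner_self, Complex.ofReal_re,
    integral_eq_zero_iff_of_nonneg (fun _ => sq_nonneg _) (memLp_region hv).integrable_norm_pow'] at h
  have hae : v =ᵐ[volume.restrict (interior (region T))] fun _ => 0 := by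
    filter_upwards [h] with x hx
    simpa using hx
  have hcont := continuousOn_of_mem_piecewisePoly hv
  have hint : Set.EqOn v (fun _ => 0) (interior (region T)) :=
    Measure.eqOn_open_of_ae_eq hae isOpen_interior (hcont.mono interior_subset) continuousOn_const
  exact hint.of_subset_closure hcont continuousOn_const interior_subset
    (closure_interior_region hT).ge

theorem helmholtzForm_self (κ ε : ℝ) (G : Set Plane) (v : Plane → ℂ) :
    (helmholtzForm κ ε G v v).re = (gradInner G v v).re - κ ^ 2 * (l2Inner G v v).re ∧
    -(helmholtzForm κ ε G v v).im = ε * (l2Inner G v v).re + κ * (bdryInner G v v).re := by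
  rw [helmholtzForm, gradInner_self, l2Inner_self, bdryInner_self]
  constructor
  · simp [← Complex.ofReal_pow]
  · simp [← Complex.ofReal_pow]; ring

/-- In the imaginary part absorption and impedance have the same sign, so `κ²‖v‖²` is at most
`(κ²/ε)|a|`. The weighted energy is the real part of `a` plus twice `κ²‖v‖²`, and `1 ≤ κ²/ε` absorbs
the real part; this makes the factor `3`. -/
theorem helmholtzForm_coercive {κ ε : ℝ} (hκ : 0 < κ) (hε : 0 < ε) (hεκ : ε ≤ κ ^ 2)
    (G : Set Plane) (v : Plane → ℂ) :
    kNorm κ G v ^ 2 ≤ 3 * (κ ^ 2 / ε) * ‖helmholtzForm κ ε G v v‖ := by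
  obtain ⟨h1, h2⟩ := helmholtzForm_self κ ε G v
  rw [kNorm_sq, kInner_self_re]
  set a := helmholtzForm κ ε G v v
  have hre := Complex.re_le_norm a
  have him := (neg_le_abs a.im).trans (Complex.abs_im_le_norm a)
  have hB := mul_nonneg hκ.le (bdryInner_self_nonneg G v)
  have hq : 1 ≤ κ ^ 2 / ε := (one_le_div hε).2 hεκ
  have h3 : κ ^ 2 * (l2Inner G v v).re ≤ κ ^ 2 / ε * ‖a‖ := by
    have : (l2Inner G v v).re ≤ ‖a‖ / ε := by
      rw [le_div_iff₀ hε]; linarith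
    calc κ ^ 2 * (l2Inner G v v).re ≤ κ ^ 2 * (‖a‖ / ε) := by gcongr
      _ = _ := by ring
  have h4 : ‖a‖ ≤ κ ^ 2 / ε * ‖a‖ := le_mul_of_one_le_left (norm_nonneg _) hq
  linarith

theorem eqOn_zero_of_helmholtzForm_self {κ ε : ℝ} (hκ : 0 < κ) (hε : 0 < ε)
    (hT : ∀ τ ∈ T, IsTriangle τ) {v : Plane → ℂ} (hv : v ∈ piecewisePoly T)
    (h : helmholtzForm κ ε (interior (region T)) v v = 0) : ∀ x ∈ region T, v x = 0 := by
  refine eqOn_zero_of_l2Inner_self hT hv ?_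
  have h2 := (helmholtzForm_self κ ε (interior (region T)) v).2
  rw [h, Complex.zero_im] at h2
  have hB := mul_nonneg hκ.le (bdryInner_self_nonneg (interior (region T)) v)
  have hL := l2Inner_self_nonneg (interior (region T)) v
  have : ε * (l2Inner (interior (region T)) v v).re = 0 := by
    have := mul_nonneg hε.le hL
    linarith
  exact (mul_eq_zero.1 this).resolve_left hε.ne'

theorem eqOn_zero_of_kInner_self {κ : ℝ} (hκ : 0 < κ)
    (hT : ∀ τ ∈ T, IsTriangle τ) {v : Plane → ℂ} (hv : v ∈ piecewisePoly T)
    (h : kInner κ (interior (region T)) v v = 0) : ∀ x ∈ region T, v x = 0 := by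
  refine eqOn_zero_of_l2Inner_self hT hv ?_
  have h2 := kInner_self_re κ (interior (region T)) v
  rw [h, Complex.zero_re] at h2
  have hG := gradInner_self_nonneg (interior (region T)) v
  have hL := l2Inner_self_nonneg (interior (region T)) v
  have : κ ^ 2 * (l2Inner (interior (region T)) v v).re = 0 := by
    have := mul_nonneg (sq_nonneg κ) hL
    linarith
  exact (mul_eq_zero.1 this).resolve_left (by positivity)

theorem norm_le_mul_of_sq_le {a s t u w : ℝ} (h : a ^ 2 ≤ s * t) (hs : s ≤ u ^ 2) (ht : t ≤ w ^ 2)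
    (ht0 : 0 ≤ t) (hu : 0 ≤ u) (hw : 0 ≤ w) : a ≤ u * w := by
  refine le_of_sq_le_sq ?_ (mul_nonneg hu hw)
  rw [mul_pow]
  exact h.trans (mul_le_mul hs ht ht0 (sq_nonneg u))

/-- Cauchy–Schwarz term by term: the gradient contributes `1`, the mass term `2` because `|κ² + iε|
≤ 2κ²`, and the boundary term `C²`, one trace inequality for each argument. -/
theorem norm_helmholtzForm_le {κ ε : ℝ} (hκ : 0 < κ) (hε : 0 < ε) (hεκ : ε ≤ κ ^ 2)
    (hT : ∀ τ ∈ T, IsTriangle τ) {C : ℝ} (hC : 0 ≤ C)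
    (htr : ∀ v ∈ piecewisePoly T, κ * (bdryInner (interior (region T)) v v).re
      ≤ C ^ 2 * kNorm κ (interior (region T)) v ^ 2)
    {v w : Plane → ℂ} (hv : v ∈ piecewisePoly T) (hw : w ∈ piecewisePoly T) :
    ‖helmholtzForm κ ε (interior (region T)) v w‖ ≤
      (3 + C ^ 2) * (kNorm κ (interior (region T)) v * kNorm κ (interior (region T)) w) := by
  set G := interior (region T)
  have hN := fun u => kNorm_nonneg κ G u
  have hsq := fun u => (kNorm_sq κ G u).trans (kInner_self_re κ G u)
  have hG0 := fun u => gradInner_self_nonneg G u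
  have hL0 := fun u => mul_nonneg (sq_nonneg κ) (l2Inner_self_nonneg G u)
  have h1 : ‖gradInner G v w‖ ≤ kNorm κ G v * kNorm κ G w := by
    have := cauchySchwarz_psd (gradForm T) conj_gradForm
      (fun u => by rw [gradForm_apply]; exact gradInner_self_nonneg _ _) ⟨v, hv⟩ ⟨w, hw⟩
    simp only [gradForm_apply] at this
    exact norm_le_mul_of_sq_le this (by linarith [hsq v, hL0 v]) (by linarith [hsq w, hL0 w])
      (hG0 w) (hN v) (hN w)
  have h2 : κ ^ 2 * ‖l2Inner G v w‖ ≤ kNorm κ G v * kNorm κ G w := by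
    have := cauchySchwarz_psd (l2Form T) (fun _ _ => conj_l2Inner _ _ _)
      (fun u => l2Inner_self_nonneg _ _) ⟨v, hv⟩ ⟨w, hw⟩
    simp only [l2Form_apply] at this
    refine norm_le_mul_of_sq_le (s := κ ^ 2 * (l2Inner G v v).re) (t := κ ^ 2 * (l2Inner G w w).re)
      ?_ (by linarith [hsq v, hG0 v]) (by linarith [hsq w, hG0 w]) (hL0 w) (hN v) (hN w)
    calc (κ ^ 2 * ‖l2Inner G v w‖) ^ 2 = (κ ^ 2) ^ 2 * ‖l2Inner G v w‖ ^ 2 := by ring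
      _ ≤ (κ ^ 2) ^ 2 * ((l2Inner G v v).re * (l2Inner G w w).re) := by gcongr
      _ = _ := by ring
  have h3 : κ * ‖bdryInner G v w‖ ≤ C ^ 2 * (kNorm κ G v * kNorm κ G w) := by
    have := cauchySchwarz_psd (bdryForm hT) (fun _ _ => conj_bdryInner _ _ _)
      (fun u => bdryInner_self_nonneg _ _) ⟨v, hv⟩ ⟨w, hw⟩
    simp only [bdryForm_apply hT] at this
    have h4 : κ * ‖bdryInner G v w‖ ≤ (C * kNorm κ G v) * (C * kNorm κ G w) := by
      refine norm_le_mul_of_sq_le (s := κ * (bdryInner G v v).re) (t := κ * (bdryInner G w w).re)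
        ?_ ((htr v hv).trans_eq (by ring)) ((htr w hw).trans_eq (by ring))
        (mul_nonneg hκ.le (bdryInner_self_nonneg G w)) (mul_nonneg hC (hN v))
        (mul_nonneg hC (hN w))
      calc (κ * ‖bdryInner G v w‖) ^ 2 = κ ^ 2 * ‖bdryInner G v w‖ ^ 2 := by ring
        _ ≤ κ ^ 2 * ((bdryInner G v v).re * (bdryInner G w w).re) := by gcongr
        _ = _ := by ring
    linarith
  have h5 : ‖(κ : ℂ) ^ 2 + Complex.I * (ε : ℂ)‖ ≤ 2 * κ ^ 2 := by
    refine (norm_add_le _ _).trans ?_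
    rw [norm_pow, norm_mul, Complex.norm_I, one_mul, Complex.norm_real, Complex.norm_real,
      Real.norm_of_nonneg hκ.le, Real.norm_of_nonneg hε.le]
    linarith
  calc ‖helmholtzForm κ ε G v w‖
      ≤ ‖gradInner G v w‖ + ‖((κ : ℂ) ^ 2 + Complex.I * (ε : ℂ)) * l2Inner G v w‖
        + ‖Complex.I * (κ : ℂ) * bdryInner G v w‖ :=
      (norm_sub_le _ _).trans (add_le_add_left (norm_sub_le _ _) _)
    _ ≤ ‖gradInner G v w‖ + 2 * κ ^ 2 * ‖l2Inner G v w‖ + κ * ‖bdryInner G v w‖ := by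
      rw [norm_mul, norm_mul, norm_mul, Complex.norm_I, one_mul, Complex.norm_real,
        Real.norm_of_nonneg hκ.le]
      gcongr
    _ ≤ _ := by linarith

/-! #### Locality -/

theorem partialDeriv_congr {G : Set Plane} (hG : IsOpen G) {v w : Plane → ℂ}
    (h : Set.EqOn v w G) {x : Plane} (hx : x ∈ G) (i : Fin 2) :
    partialDeriv i v x = partialDeriv i w x := by
  have : v =ᶠ[nhds x] w := Filter.eventually_of_mem (hG.mem_nhds hx) fun y hy => h hy
  rw [partialDeriv, partialDeriv, this.fderiv_eq]

theorem helmholtzForm_congr (hT : ∀ τ ∈ T, IsTriangle τ) (κ ε : ℝ) {v v' w : Plane → ℂ}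
    (h : Set.EqOn v v' (region T)) :
    helmholtzForm κ ε (interior (region T)) v w = helmholtzForm κ ε (interior (region T)) v' w := by
  have h1 : gradInner (interior (region T)) v w = gradInner (interior (region T)) v' w := by
    refine setIntegral_congr_fun isOpen_interior.measurableSet fun x hx => ?_
    refine Finset.sum_congr rfl fun i _ => ?_
    exact congrArg (· * _) (partialDeriv_congr isOpen_interior (h.mono interior_subset) hx i)
  have h2 : l2Inner (interior (region T)) v w = l2Inner (interior (region T)) v' w :=
    setIntegral_congr_fun isOpen_interior.measurableSet fun x hx =>
      congrArg (· * _) (h (interior_subset hx))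
  have h3 : bdryInner (interior (region T)) v w = bdryInner (interior (region T)) v' w :=
    setIntegral_congr_fun isClosed_frontier.measurableSet fun x hx =>
      congrArg (· * _) (h (frontier_interior_region_subset_region hT hx))
  rw [helmholtzForm, helmholtzForm, h1, h2, h3]

/-! ### The boundary of a regular open set has positive length -/

/-- Near `x` there are a disc in `U` and a disc in the exterior. Every segment parallel to `z - y`
from one to the other crosses the frontier, so the projection along `z - y` maps the frontier onto a
set containing an interval. Lipschitz maps preserve null sets, so the frontier is not null. The
second closure condition rules out slits. -/
theorem hausdorffMeasure_frontier_inter_ball_ne_zero {U : Set Plane} (hU : IsOpen U) {x : Plane}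
    (hx : x ∈ closure U) (hx' : x ∈ closure (closure U)ᶜ) {r : ℝ} (hr : 0 < r) :
    Measure.hausdorffMeasure 1 (frontier U ∩ Metric.ball x r) ≠ 0 := by
  intro h0
  obtain ⟨y, hyB, hyU⟩ := mem_closure_iff.1 hx _ Metric.isOpen_ball (Metric.mem_ball_self hr)
  obtain ⟨z, hzB, hzU⟩ := mem_closure_iff.1 hx' _ Metric.isOpen_ball (Metric.mem_ball_self hr)
  have hVo : IsOpen (closure U)ᶜ := isClosed_closure.isOpen_compl
  obtain ⟨δ₁, hδ₁, hy⟩ := Metric.isOpen_iff.1 (hU.inter Metric.isOpen_ball) y ⟨hyU, hyB⟩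
  obtain ⟨δ₂, hδ₂, hz⟩ := Metric.isOpen_iff.1 (hVo.inter Metric.isOpen_ball) z ⟨hzU, hzB⟩
  have hyz : z - y ≠ 0 := by
    rw [sub_ne_zero]; rintro rfl; exact hzU (subset_closure hyU)
  -- The vector `z - y` turned by a right angle; `φ` is the inner product with it and is constant
  -- along the connecting segments.
  let n : Plane := !₂[-(z - y) 1, (z - y) 0]
  have hn : n ≠ 0 := by
    intro h
    apply hyz
    have h0 := congrArg (fun p : Plane => p 0) h
    have h1 := congrArg (fun p : Plane => p 1) h
    ext i
    fin_cases i
    · simpa [n] using h1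
    · exact neg_eq_zero.1 h0
  have hnd : inner ℝ n (z - y) = 0 := by
    simp [n, PiLp.inner_apply, Fin.sum_univ_two]; ring
  have hnpos : 0 < ‖n‖ := norm_pos_iff.2 hn
  let δ := min δ₁ δ₂ / ‖n‖
  have hδ : 0 < δ := div_pos (lt_min hδ₁ hδ₂) hnpos
  let φ : Plane → ℝ := fun p => inner ℝ n p
  have hφ : LipschitzWith ‖n‖₊ φ := by
    have := (innerSL ℝ n).lipschitz
    refine this.weaken ?_
    rw [← NNReal.coe_le_coe]
    simp [innerSL_apply_norm]
  have himg : Set.Ioo (φ y) (φ y + δ * ‖n‖ ^ 2) ⊆ φ '' (frontier U ∩ Metric.ball x r) := by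
    rintro c ⟨hc1, hc2⟩
    let t := (c - φ y) / ‖n‖ ^ 2
    have ht0 : 0 < t := div_pos (sub_pos.2 hc1) (by positivity)
    have htδ : t < δ := by
      rw [div_lt_iff₀ (by positivity)]; linarith
    have htn : ‖t • n‖ < min δ₁ δ₂ := by
      rw [norm_smul, Real.norm_of_nonneg ht0.le]
      calc t * ‖n‖ < δ * ‖n‖ := by gcongr
        _ = min δ₁ δ₂ := div_mul_cancel₀ _ hnpos.ne'
    have hy' : y + t • n ∈ U ∩ Metric.ball x r := hy (by
      rw [Metric.mem_ball, dist_eq_norm, add_sub_cancel_left]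
      exact htn.trans_le (min_le_left _ _))
    have hz' : z + t • n ∈ (closure U)ᶜ ∩ Metric.ball x r := hz (by
      rw [Metric.mem_ball, dist_eq_norm, add_sub_cancel_left]
      exact htn.trans_le (min_le_right _ _))
    have hseg : segment ℝ (y + t • n) (z + t • n) ⊆ Metric.ball x r :=
      (convex_ball x r).segment_subset hy'.2 hz'.2
    have hpc : IsPreconnected (segment ℝ (y + t • n) (z + t • n)) :=
      (convex_segment _ _).isPreconnected
    have hex : ∃ p ∈ segment ℝ (y + t • n) (z + t • n), p ∈ frontier U := by
      by_contra hcon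
      push Not at hcon
      obtain ⟨p, -, hp1, hp2⟩ := hpc U (closure U)ᶜ hU hVo (fun p hp => by
          by_cases hpU : p ∈ U
          · exact Or.inl hpU
          · refine Or.inr fun hpc => hcon p hp ⟨hpc, ?_⟩
            rwa [hU.interior_eq])
        ⟨_, left_mem_segment ℝ _ _, hy'.1⟩ ⟨_, right_mem_segment ℝ _ _, hz'.1⟩
      exact hp2 (subset_closure hp1)
    obtain ⟨p, hp, hpf⟩ := hex
    refine ⟨p, ⟨hpf, hseg hp⟩, ?_⟩
    rw [segment_eq_image'] at hp
    obtain ⟨s, -, rfl⟩ := hp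
    have hd : z + t • n - (y + t • n) = z - y := by abel
    change inner ℝ n (y + t • n + s • (z + t • n - (y + t • n))) = c
    rw [hd, inner_add_right, inner_add_right, inner_smul_right, inner_smul_right, hnd,
      real_inner_self_eq_norm_sq, mul_zero, add_zero, div_mul_cancel₀ _ (by positivity)]
    change φ y + (c - φ y) = c
    ring
  have h1 : volume (φ '' (frontier U ∩ Metric.ball x r)) = 0 := by
    rw [← hausdorffMeasure_real]
    have := hφ.hausdorffMeasure_image_le zero_le_one (frontier U ∩ Metric.ball x r)
    rw [h0, mul_zero] at this
    exact nonpos_iff_eq_zero.1 this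
  have h2 := measure_mono_null himg h1
  rw [Real.volume_Ioo, ENNReal.ofReal_eq_zero] at h2
  have : 0 < δ * ‖n‖ ^ 2 := by positivity
  linarith

/-- A nonzero boundary value persists, by continuity, on a piece of the frontier inside a small
ball, and that piece has positive length. Since the region is the closure of its interior, every
frontier point is also a limit of exterior points. -/
theorem eqOn_frontier_of_bdryInner_self {T : Finset (Finset Plane)}
    (hT : ∀ τ ∈ T, IsTriangle τ) {v : Plane → ℂ} (hv : v ∈ piecewisePoly T)
    (h : bdryInner (interior (region T)) v v = 0) :
    ∀ x ∈ frontier (interior (region T)), v x = 0 := by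
  rw [bdryInner_self, Complex.ofReal_eq_zero,
    integral_eq_zero_iff_of_nonneg (fun _ => sq_nonneg _)
      ((memLp_two_iff_integrable_sq_norm (memLp_frontier hT hv).1).1 (memLp_frontier hT hv)),
    Filter.EventuallyEq, ae_restrict_iff' isClosed_frontier.measurableSet] at h
  intro x hx
  by_contra hvx
  have hsub := frontier_interior_region_subset_region hT
  have hcont := (continuousOn_of_mem_piecewisePoly hv) x (hsub hx)
  have hne : ∀ᶠ y in 𝓝[region T] x, v y ≠ 0 := hcont.eventually_ne hvx
  obtain ⟨r, hr, hball⟩ := Metric.mem_nhdsWithin_iff.1 hne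
  refine hausdorffMeasure_frontier_inter_ball_ne_zero isOpen_interior hx.1 ?_ hr
    (measure_mono_null (fun y hy => ?_) (ae_iff.1 h))
  · rw [closure_interior_region hT, closure_compl]
    rw [frontier, interior_interior] at hx
    exact hx.2
  · rw [Set.mem_ofPred_eq, Classical.not_imp]
    refine ⟨hy.1, fun hy0 => hball ⟨hy.2, hsub hy.1⟩ ?_⟩
    simpa using hy0

/-! ### Piecewise polynomial functions on segments -/

theorem exists_lipschitz_bound {T : Finset (Finset Plane)} {v : Plane → ℂ}
    (hv : v ∈ piecewisePoly T) :
    ∃ K : ℝ, 0 ≤ K ∧ ∀ τ ∈ T, ∀ x ∈ hull τ, ∀ y ∈ hull τ, ‖v y - v x‖ ≤ K * ‖y - x‖ := by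
  have h : ∀ τ ∈ T, ∃ K : ℝ, ∀ x ∈ hull τ, ∀ y ∈ hull τ, ‖v y - v x‖ ≤ K * ‖y - x‖ := by
    intro τ hτ
    obtain ⟨d, f, hf, hvf⟩ := hv τ hτ
    obtain ⟨K, hK⟩ := (isCompact_hull τ).exists_bound_of_continuousOn
      (hf.contDiff.continuous_fderiv one_ne_zero).continuousOn
    refine ⟨K, fun x hx y hy => ?_⟩
    rw [hvf hx, hvf hy]
    exact (convex_convexHull ℝ _).norm_image_sub_le_of_norm_fderiv_le
      (fun z _ => hf.contDiff.differentiable one_ne_zero z) hK hx hy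
  choose! K hK using h
  obtain ⟨K', hK'⟩ := (T.image K).bddAbove
  refine ⟨max K' 0, le_max_right _ _, fun τ hτ x hx y hy => (hK τ hτ x hx y hy).trans ?_⟩
  gcongr
  exact (hK' (Finset.mem_coe.2 (Finset.mem_image_of_mem K hτ))).trans (le_max_left _ _)

/-- Subdividing the segment along the triangles is avoided: it suffices to bound right difference
quotients arbitrarily close to each `t`, by the comparison principle for lower right derivatives. -/
theorem exists_lipschitzOnWith_segment {T : Finset (Finset Plane)} {v : Plane → ℂ}
    (hv : v ∈ piecewisePoly T) {x w : Plane} (hxw : ∀ t ∈ Set.Icc (0 : ℝ) 1, x + t • w ∈ region T) :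
    ∃ K : ℝ≥0, LipschitzOnWith K (fun t : ℝ => v (x + t • w)) (Set.Icc 0 1) := by
  obtain ⟨K, hK0, hK⟩ := exists_lipschitz_bound hv
  let f : ℝ → ℂ := fun t => v (x + t • w)
  have hline : Continuous fun t : ℝ => x + t • w := by fun_prop
  have hf : ContinuousOn f (Set.Icc 0 1) :=
    (continuousOn_of_mem_piecewisePoly hv).comp hline.continuousOn hxw
  have hpiece : ∀ τ ∈ T, ∀ s t : ℝ, s ≤ t → x + s • w ∈ hull τ → x + t • w ∈ hull τ →
      ‖f t - f s‖ ≤ K * ‖w‖ * (t - s) := by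
    intro τ hτ s t hst hs ht
    refine (hK τ hτ _ hs _ ht).trans_eq ?_
    rw [add_sub_add_left_eq_sub, ← sub_smul, norm_smul, Real.norm_of_nonneg (sub_nonneg.2 hst)]
    ring
  have key : ∀ a ∈ Set.Icc (0 : ℝ) 1, ∀ b ∈ Set.Icc (0 : ℝ) 1, a ≤ b →
      ‖f b - f a‖ ≤ K * ‖w‖ * (b - a) := by
    intro a ha b hb hab
    have hsub : Set.Icc a b ⊆ Set.Icc 0 1 := Set.Icc_subset_Icc ha.1 hb.2
    refine image_le_of_liminf_slope_right_le_deriv_boundary (a := a) (b := b)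
      (f := fun t => ‖f t - f a‖) (B := fun t => K * ‖w‖ * (t - a)) (B' := fun _ => K * ‖w‖)
      ((hf.mono hsub).sub continuousOn_const).norm (by simp) (by fun_prop) (fun t _ => ?_)
      (fun t ht r hr => ?_) (Set.right_mem_Icc.2 hab)
    · simpa using (((hasDerivAt_id t).sub_const a).const_mul (K * ‖w‖)).hasDerivWithinAt
    · have hev : ∀ᶠ z in 𝓝[>] t, z ∈ Set.Ioc t b := Ioc_mem_nhdsGT ht.2
      -- There are finitely many triangles, so one of them contains points of the segment
      -- arbitrarily close to `t` from the right, and being closed it contains the point at `t` as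
      -- well.
      have hex : ∃ τ ∈ T, ∃ᶠ z in 𝓝[>] t, x + z • w ∈ hull τ := by
        by_contra hcon
        simp only [not_exists, not_and, Filter.not_frequently] at hcon
        have h1 := (Filter.eventually_all_finset T).2 hcon
        obtain ⟨z, hz1, hz2⟩ := (h1.and hev).exists
        obtain ⟨τ, hτ, hzτ⟩ := mem_region.1 (hxw z (hsub ⟨ht.1.trans hz2.1.le, hz2.2⟩))
        exact hz1 τ hτ hzτ
      obtain ⟨τ, hτ, hfr⟩ := hex
      have htτ : x + t • w ∈ hull τ :=
        (isClosed_hull τ).mem_of_frequently_of_tendsto hfr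
          ((hline.tendsto t).mono_left nhdsWithin_le_nhds)
      refine (hfr.and_eventually hev).mono fun z ⟨hz1, hz2⟩ => lt_of_le_of_lt ?_ hr
      rw [slope_def_field, div_le_iff₀ (sub_pos.2 hz2.1)]
      refine le_trans ?_ (hpiece τ hτ t z hz2.1.le htτ hz1)
      have := norm_sub_norm_le (f z - f a) (f t - f a)
      rwa [sub_sub_sub_cancel_right] at this
  refine ⟨(K * ‖w‖).toNNReal, LipschitzOnWith.of_dist_le_mul fun s hs t ht => ?_⟩
  rw [Real.coe_toNNReal _ (by positivity), dist_eq_norm, Real.dist_eq]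
  rcases le_total s t with hst | hst
  · rw [← norm_neg, neg_sub, abs_sub_comm, abs_of_nonneg (sub_nonneg.2 hst)]
    exact key s hs t ht hst
  · rw [abs_of_nonneg (sub_nonneg.2 hst)]
    exact key t ht s hs hst

/-! ### A trace inequality -/

/-- Compare `|f(0)|²` with `|f(t)|²` by the fundamental theorem of calculus, multiply by `κ`, and
average over `t`. Here `2κ|f||f'| ≤ κ²|f|² + |f'|²` gives the constant `1`, and `κ ≤ κ₀⁻¹κ²` gives
`κ₀⁻¹`. -/
theorem trace_inequality_interval {f f' : ℝ → ℂ} {K : ℝ≥0}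
    (hf : LipschitzOnWith K f (Set.Icc 0 1))
    (hf' : ∀ᵐ t : ℝ, t ∈ Set.Ioo (0 : ℝ) 1 → HasDerivAt f (f' t) t)
    {κ₀ κ : ℝ} (hκ₀ : 0 < κ₀) (hκ : κ₀ ≤ κ) :
    ENNReal.ofReal (κ * ‖f 0‖ ^ 2) ≤ ENNReal.ofReal (1 + κ₀⁻¹) *
      ∫⁻ t in Set.Ioo (0 : ℝ) 1, ENNReal.ofReal (κ ^ 2 * ‖f t‖ ^ 2 + ‖f' t‖ ^ 2) := by
  have hκpos : 0 < κ := hκ₀.trans_le hκ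
  let g : ℝ → ℝ := fun t => ‖f t‖ ^ 2
  obtain ⟨B, hB⟩ := isCompact_Icc.exists_bound_of_continuousOn hf.continuousOn
  have hg : LipschitzOnWith (2 * B.toNNReal * K) g (Set.Icc 0 1) := by
    refine LipschitzOnWith.of_dist_le_mul fun s hs t ht => ?_
    have hB0 : 0 ≤ B := (norm_nonneg _).trans (hB s hs)
    have h1 : |‖f s‖ - ‖f t‖| ≤ K * dist s t :=
      (abs_norm_sub_norm_le _ _).trans (by rw [← dist_eq_norm]; exact hf.dist_le_mul s hs t ht)
    have h2 : |‖f s‖ + ‖f t‖| ≤ 2 * B := by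
      rw [abs_of_nonneg (by positivity)]; linarith [hB s hs, hB t ht]
    rw [Real.dist_eq, show g s - g t = (‖f s‖ + ‖f t‖) * (‖f s‖ - ‖f t‖) by simp only [g]; ring,
      abs_mul]
    push_cast
    rw [Real.coe_toNNReal B hB0, mul_assoc]
    exact mul_le_mul h2 h1 (abs_nonneg _) (by positivity)
  have hac : AbsolutelyContinuousOnInterval g 0 1 := by
    apply LipschitzOnWith.absolutelyContinuousOnInterval (K := 2 * B.toNNReal * K)
    rwa [Set.uIcc_of_le zero_le_one]
  set J := ∫⁻ t in Set.Ioo (0 : ℝ) 1, ENNReal.ofReal (κ ^ 2 * ‖f t‖ ^ 2 + ‖f' t‖ ^ 2) with hJ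
  set I := ∫⁻ t in Set.Ioo (0 : ℝ) 1, ENNReal.ofReal (κ * |deriv g t|) with hI
  have hIJ : I ≤ J := by
    refine setLIntegral_mono_ae' measurableSet_Ioo ?_
    filter_upwards [hf'] with t ht htI
    refine ENNReal.ofReal_le_ofReal ?_
    have hd : HasDerivAt g (2 * inner ℝ (f t) (f' t)) t := (ht htI).norm_sq
    rw [hd.deriv, abs_mul, abs_two]
    have := abs_real_inner_le_norm (f t) (f' t)
    nlinarith [sq_nonneg (κ * ‖f t‖ - ‖f' t‖)]
  have hpt : ∀ t ∈ Set.Ioo (0 : ℝ) 1,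
      ENNReal.ofReal (κ * ‖f 0‖ ^ 2) ≤ ENNReal.ofReal (κ * ‖f t‖ ^ 2) + I := by
    intro t ht
    have hac' : AbsolutelyContinuousOnInterval g 0 t :=
      hac.mono (by
        rw [Set.uIcc_of_le ht.1.le, Set.uIcc_of_le zero_le_one]
        exact Set.Icc_subset_Icc le_rfl ht.2.le)
    have hftc := hac'.integral_deriv_eq_sub
    have h1 : κ * ‖f 0‖ ^ 2 ≤ κ * ‖f t‖ ^ 2 + ∫ s in (0 : ℝ)..t, κ * |deriv g s| := by
      rw [intervalIntegral.integral_const_mul, ← mul_add]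
      have := intervalIntegral.abs_integral_le_integral_abs (f := deriv g) (μ := volume) ht.1.le
      rw [hftc] at this
      have h2 := neg_abs_le (g t - g 0)
      have : g 0 ≤ g t + ∫ s in (0 : ℝ)..t, |deriv g s| := by linarith
      exact mul_le_mul_of_nonneg_left this hκpos.le
    refine (ENNReal.ofReal_le_ofReal h1).trans (ENNReal.ofReal_add_le.trans ?_)
    gcongr
    rw [intervalIntegral.integral_of_le ht.1.le, ofReal_integral_eq_lintegral_ofReal]
    · exact lintegral_mono_set fun s hs => ⟨hs.1, hs.2.trans_lt ht.2⟩
    · have := (hac'.intervalIntegrable_deriv).abs.const_mul κ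
      exact (intervalIntegrable_iff_integrableOn_Ioc_of_le ht.1.le).1 this
    · exact Filter.Eventually.of_forall fun s => by positivity
  have h3 : ENNReal.ofReal (κ * ‖f 0‖ ^ 2) ≤
      (∫⁻ t in Set.Ioo (0 : ℝ) 1, ENNReal.ofReal (κ * ‖f t‖ ^ 2)) + I := by
    have h4 := setLIntegral_mono' (μ := volume) measurableSet_Ioo hpt
    rw [lintegral_add_right _ measurable_const] at h4
    simpa using h4
  have h5 : (∫⁻ t in Set.Ioo (0 : ℝ) 1, ENNReal.ofReal (κ * ‖f t‖ ^ 2))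
      ≤ ENNReal.ofReal κ₀⁻¹ * J := by
    rw [hJ, ← lintegral_const_mul' _ _ ENNReal.ofReal_ne_top]
    refine lintegral_mono fun t => ?_
    rw [← ENNReal.ofReal_mul (by positivity)]
    refine ENNReal.ofReal_le_ofReal ?_
    have h6 : κ * ‖f t‖ ^ 2 ≤ κ₀⁻¹ * (κ ^ 2 * ‖f t‖ ^ 2) := by
      rw [← mul_assoc]
      refine mul_le_mul_of_nonneg_right ?_ (sq_nonneg _)
      rw [inv_mul_eq_div, le_div_iff₀ hκ₀, sq]
      exact mul_le_mul_of_nonneg_left hκ hκpos.le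
    refine h6.trans (mul_le_mul_of_nonneg_left ?_ (by positivity))
    linarith [sq_nonneg ‖f' t‖]
  calc ENNReal.ofReal (κ * ‖f 0‖ ^ 2) ≤ ENNReal.ofReal κ₀⁻¹ * J + J := h3.trans (by gcongr)
    _ = ENNReal.ofReal (1 + κ₀⁻¹) * J := by
      rw [ENNReal.ofReal_add zero_le_one (by positivity), ENNReal.ofReal_one]; ring

/-- The density of `‖v‖_{1,κ}²`. -/
def energyDensity (κ : ℝ) (v : Plane → ℂ) (x : Plane) : ℝ≥0∞ :=
  ENNReal.ofReal (κ ^ 2 * ‖v x‖ ^ 2 + ∑ i, ‖partialDeriv i v x‖ ^ 2)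

theorem norm_fderiv_apply_sq_le (v : Plane → ℂ) (x w : Plane) :
    ‖fderiv ℝ v x w‖ ^ 2 ≤ ‖w‖ ^ 2 * ∑ i, ‖partialDeriv i v x‖ ^ 2 := by
  have hw : w = ∑ i, w i • EuclideanSpace.single i (1 : ℝ) := by
    ext j; fin_cases j <;> simp
  have h1 : ‖fderiv ℝ v x w‖ ≤ ∑ i, |w i| * ‖partialDeriv i v x‖ := by
    conv_lhs => rw [hw, map_sum]
    refine (norm_sum_le _ _).trans_eq (Finset.sum_congr rfl fun i _ => ?_)
    rw [map_smul, norm_smul, Real.norm_eq_abs, partialDeriv]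
  calc ‖fderiv ℝ v x w‖ ^ 2 ≤ (∑ i, |w i| * ‖partialDeriv i v x‖) ^ 2 := by gcongr
    _ ≤ (∑ i, |w i| ^ 2) * ∑ i, ‖partialDeriv i v x‖ ^ 2 :=
      Finset.sum_mul_sq_le_sq_mul_sq _ _ _
    _ = _ := by rw [EuclideanSpace.real_norm_sq_eq]; simp only [sq_abs]

/-- The parametrisation is Lipschitz with constant `‖u‖`, so length on the segment is dominated by
`‖u‖` times the image of Lebesgue measure. Only this inequality is needed, and it requires no
measurability of `g`. -/
theorem lintegral_segment_le (x u : Plane) (g : Plane → ℝ≥0∞) :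
    ∫⁻ y in segment ℝ x (x + u), g y ∂(Measure.hausdorffMeasure 1) ≤
      ‖u‖₊ * ∫⁻ s in Set.Ioo (0 : ℝ) 1, g (x + s • u) := by
  let γ : ℝ → Plane := fun s => x + s • u
  have hγ : Continuous γ := by fun_prop
  have hlip : LipschitzWith ‖u‖₊ γ := LipschitzWith.of_dist_le_mul fun s t => by
    simp only [γ]
    rw [dist_add_left, dist_eq_norm, ← sub_smul, norm_smul, mul_comm, Real.dist_eq]
    rfl
  have hseg : segment ℝ x (x + u) = γ '' Set.Icc 0 1 := by
    rw [segment_eq_image']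
    simp [γ]
  have hle : (Measure.hausdorffMeasure 1).restrict (segment ℝ x (x + u)) ≤
      (‖u‖₊ : ℝ≥0∞) • (volume.restrict (Set.Icc (0 : ℝ) 1)).map γ := by
    refine Measure.le_iff.2 fun A hA => ?_
    rw [Measure.restrict_apply hA, Measure.smul_apply, Measure.map_apply hγ.measurable hA,
      Measure.restrict_apply (hγ.measurable hA), hseg, smul_eq_mul, ← hausdorffMeasure_real]
    have h1 := hlip.hausdorffMeasure_image_le zero_le_one (γ ⁻¹' A ∩ Set.Icc 0 1)
    rw [ENNReal.rpow_one] at h1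
    rwa [Set.image_preimage_inter] at h1
  calc _ ≤ ∫⁻ y, g y ∂((‖u‖₊ : ℝ≥0∞) • (volume.restrict (Set.Icc (0 : ℝ) 1)).map γ) :=
        lintegral_mono' hle le_rfl
    _ = ‖u‖₊ * ∫⁻ y, g y ∂((volume.restrict (Set.Icc (0 : ℝ) 1)).map γ) := by
        rw [lintegral_smul_measure, smul_eq_mul]
    _ ≤ ‖u‖₊ * ∫⁻ s in Set.Icc (0 : ℝ) 1, g (γ s) := by
        gcongr; exact lintegral_map_le _ _
    _ = _ := by rw [setLIntegral_congr Ioo_ae_eq_Icc.symm]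

/-- Apply the interval inequality along the lines in direction `w` issuing from the segment and
integrate over the segment by Fubini. The constant is chosen before the triangles `T`, so it depends
on the parallelogram and `κ₀` alone. -/
theorem exists_trace_parallelogram {κ₀ : ℝ} (hκ₀ : 0 < κ₀) {x u w : Plane}
    (hli : ∀ s t : ℝ, s • u + t • w = 0 → s = 0 ∧ t = 0) :
    ∃ K : ℝ≥0, ∀ T : Finset (Finset Plane),
      (∀ s ∈ Set.Icc (0 : ℝ) 1, ∀ t ∈ Set.Icc (0 : ℝ) 1, x + s • u + t • w ∈ region T) →
      (∀ s ∈ Set.Ioo (0 : ℝ) 1, ∀ t ∈ Set.Ioo (0 : ℝ) 1,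
        x + s • u + t • w ∈ interior (region T)) →
      ∀ κ, κ₀ ≤ κ → ∀ v ∈ piecewisePoly T,
        ∫⁻ y in segment ℝ x (x + u), ENNReal.ofReal (κ * ‖v y‖ ^ 2) ∂(Measure.hausdorffMeasure 1)
          ≤ K * ∫⁻ y in interior (region T), energyDensity κ v y := by
  let L₀ : ℝ × ℝ →ₗ[ℝ] Plane :=
    (LinearMap.fst ℝ ℝ ℝ).smulRight u + (LinearMap.snd ℝ ℝ ℝ).smulRight w
  have hL₀ : Function.Injective L₀ := by
    rw [← LinearMap.ker_eq_bot, LinearMap.ker_eq_bot']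
    intro p hp
    obtain ⟨h1, h2⟩ := hli p.1 p.2 hp
    exact Prod.ext h1 h2
  let L : (ℝ × ℝ) ≃L[ℝ] Plane :=
    (L₀.linearEquivOfInjective hL₀ (by simp)).toContinuousLinearEquiv
  have hL : ∀ p, L p = p.1 • u + p.2 • w := fun _ => rfl
  let Φ : ℝ × ℝ → Plane := fun p => x + L p
  have hΦ : ∀ s t : ℝ, Φ (s, t) = x + s • u + t • w := fun s t => by
    simp only [Φ, hL]; rw [add_assoc]
  have hΦe : MeasurableEmbedding Φ :=
    (Homeomorph.addLeft x).measurableEmbedding.comp L.toHomeomorph.measurableEmbedding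
  -- The inverse Jacobian of the affine chart, obtained from uniqueness of translation-invariant
  -- measures.
  obtain ⟨c, hc⟩ : ∃ c : ℝ≥0, (volume : Measure (ℝ × ℝ)).map Φ = c • (volume : Measure Plane) := by
    refine ⟨((volume : Measure (ℝ × ℝ)).map L).addHaarScalarFactor volume, ?_⟩
    have h1 : (volume : Measure (ℝ × ℝ)).map Φ
        = (((volume : Measure (ℝ × ℝ)).map L).map (x + ·)) := by
      rw [Measure.map_map (measurable_const_add x) L.continuous.measurable]; rfl
    rw [h1, map_add_left_eq_self]
    exact Measure.isAddLeftInvariant_eq_smul _ _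
  refine ⟨‖u‖₊ * ((1 + κ₀⁻¹).toNNReal * ((1 + ‖w‖ ^ 2).toNNReal * c)), ?_⟩
  intro T hT hT' κ hκ v hv
  set G := interior (region T) with hG
  have hGm : MeasurableSet G := isOpen_interior.measurableSet
  let F : Plane → ℝ≥0∞ := G.indicator (energyDensity κ v)
  have hF : Measurable F := by
    classical
    have h1 : Measurable (G.piecewise v 0) :=
      ((continuousOn_of_mem_piecewisePoly hv).mono interior_subset).measurable_piecewise
        continuousOn_const hGm
    have h2 : F = G.indicator fun y => ENNReal.ofReal
        (κ ^ 2 * ‖G.piecewise v 0 y‖ ^ 2 + ∑ i, ‖partialDeriv i v y‖ ^ 2) := by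
      refine Set.indicator_congr fun y hy => ?_
      rw [energyDensity, Set.piecewise_eq_of_mem _ _ _ hy]
    rw [h2]
    refine Measurable.indicator (Measurable.ennreal_ofReal ?_) hGm
    refine Measurable.add (by fun_prop) (Finset.measurable_fun_sum _ fun i _ => ?_)
    exact ((measurable_fderiv_apply_const ℝ v _).norm).pow_const 2
  -- A line may run along an edge of the mesh, where derivatives are not available; since the edges
  -- are null, Fubini excludes this for almost every `s`.
  have hae : ∀ᵐ s : ℝ, ∀ᵐ t : ℝ, Φ (s, t) ∈ region T → ∃ τ ∈ T, Φ (s, t) ∈ interior (hull τ) := by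
    refine Measure.ae_ae_of_ae_prod (p := fun q : ℝ × ℝ =>
      Φ q ∈ region T → ∃ τ ∈ T, Φ q ∈ interior (hull τ)) ?_
    have h1 : ∀ᵐ y ∂((volume : Measure (ℝ × ℝ)).map Φ),
        y ∈ region T → ∃ τ ∈ T, y ∈ interior (hull τ) := by
      rw [hc]; exact Measure.ae_smul_measure (ae_mem_interior_hull T) c
    exact ae_of_ae_map hΦe.measurable.aemeasurable h1
  have hfib : ∀ᵐ s : ℝ, s ∈ Set.Ioo (0 : ℝ) 1 → ENNReal.ofReal (κ * ‖v (x + s • u)‖ ^ 2) ≤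
      ENNReal.ofReal (1 + κ₀⁻¹) * (ENNReal.ofReal (1 + ‖w‖ ^ 2) * ∫⁻ t, F (Φ (s, t))) := by
    filter_upwards [hae] with s hs hsI
    have hsI' := Set.Ioo_subset_Icc_self hsI
    obtain ⟨K, hK⟩ := exists_lipschitzOnWith_segment hv (x := x + s • u) (w := w) (hT s hsI')
    have hder : ∀ᵐ t : ℝ, t ∈ Set.Ioo (0 : ℝ) 1 → HasDerivAt (fun t : ℝ => v (x + s • u + t • w))
        (fderiv ℝ v (x + s • u + t • w) w) t := by
      filter_upwards [hs] with t ht htI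
      rw [hΦ] at ht
      obtain ⟨τ, hτ, hin⟩ := ht (hT s hsI' t (Set.Ioo_subset_Icc_self htI))
      have h1 := (differentiableAt_of_mem_interior hv hτ hin).hasFDerivAt
      have h2 : HasDerivAt (fun t : ℝ => x + s • u + t • w) w t := by
        simpa using ((hasDerivAt_id t).smul_const w).const_add (x + s • u)
      exact h1.comp_hasDerivAt t h2
    have h3 := trace_inequality_interval hK hder hκ₀ hκ
    rw [zero_smul, add_zero] at h3
    refine h3.trans ?_
    gcongr
    rw [← lintegral_const_mul' _ _ ENNReal.ofReal_ne_top, ← lintegral_indicator measurableSet_Ioo]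
    refine lintegral_mono fun t => ?_
    by_cases ht : t ∈ Set.Ioo (0 : ℝ) 1
    swap
    · rw [Set.indicator_of_notMem ht]; exact zero_le
    rw [Set.indicator_of_mem ht]
    have hmem := hT' s hsI t ht
    rw [hΦ, show F (x + s • u + t • w) = _ from Set.indicator_of_mem hmem _, energyDensity, ← ENNReal.ofReal_mul (by positivity)]
    refine ENNReal.ofReal_le_ofReal ?_
    have h4 := norm_fderiv_apply_sq_le v (x + s • u + t • w) w
    have h5 : 0 ≤ ∑ i, ‖partialDeriv i v (x + s • u + t • w)‖ ^ 2 := by positivity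
    have h6 : 0 ≤ ‖w‖ ^ 2 * (κ ^ 2 * ‖v (x + s • u + t • w)‖ ^ 2) := by positivity
    linarith
  calc _ ≤ ‖u‖₊ * ∫⁻ s in Set.Ioo (0 : ℝ) 1, ENNReal.ofReal (κ * ‖v (x + s • u)‖ ^ 2) :=
        lintegral_segment_le x u _
    _ ≤ ‖u‖₊ * ∫⁻ s, ENNReal.ofReal (1 + κ₀⁻¹) *
          (ENNReal.ofReal (1 + ‖w‖ ^ 2) * ∫⁻ t, F (Φ (s, t))) := by
        refine mul_le_mul' le_rfl ?_
        exact (setLIntegral_mono_ae' measurableSet_Ioo hfib).trans (setLIntegral_le_lintegral _ _)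
    _ = ‖u‖₊ * (ENNReal.ofReal (1 + κ₀⁻¹) * (ENNReal.ofReal (1 + ‖w‖ ^ 2) *
          ∫⁻ p, F (Φ p))) := by
        rw [lintegral_const_mul' _ _ ENNReal.ofReal_ne_top,
          lintegral_const_mul' _ _ ENNReal.ofReal_ne_top, Measure.volume_eq_prod,
          lintegral_prod (fun p => F (Φ p)) (hF.comp hΦe.measurable).aemeasurable]
    _ = _ := by
        rw [← hΦe.lintegral_map, hc, lintegral_smul_measure, lintegral_indicator hGm]
        push_cast
        rw [ENNReal.ofReal, ENNReal.ofReal, ENNReal.smul_def, smul_eq_mul]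
        simp only [mul_assoc]

theorem IsTriangle.bary_combination_three {τ : Finset Plane} (h : IsTriangle τ) {a b c : Plane}
    (ha : a ∈ τ) (hb : b ∈ τ) (hc : c ∈ τ) (hba : b ≠ a) (hca : c ≠ a) (hbc : b ≠ c) (s t : ℝ) :
    bary τ a (b + s • (c - b) + t • (a - b)) = t ∧ bary τ c (b + s • (c - b) + t • (a - b)) = s ∧
      bary τ b (b + s • (c - b) + t • (a - b)) = 1 - s - t ∧
      ∀ d ∈ τ, d = a ∨ d = b ∨ d = c := by
  classical
  have hτ : ({a, b, c} : Finset Plane) = τ := by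
    refine Finset.eq_of_subset_of_card_le ?_ ?_
    · intro d hd
      simp only [Finset.mem_insert, Finset.mem_singleton] at hd
      rcases hd with rfl | rfl | rfl <;> assumption
    · rw [h.1, Finset.card_eq_three.2 ⟨a, b, c, hba.symm, hca.symm, hbc, rfl⟩]
  let w : Plane → ℝ := fun d => if d = a then t else if d = c then s else 1 - s - t
  have wa : w a = t := by simp [w]
  have wb : w b = 1 - s - t := by simp [w, hba, hbc]
  have wc : w c = s := by simp [w, hca]
  have hsum : ∀ {M : Type} [AddCommMonoid M] (f : Plane → M), ∑ d ∈ τ, f d = f a + (f b + f c) := by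
    intro M _ f
    rw [← hτ, Finset.sum_insert (by simp [hba.symm, hca.symm]), Finset.sum_insert (by simp [hbc]),
      Finset.sum_singleton]
  have h1 : ∑ d ∈ τ, w d = 1 := by rw [hsum, wa, wb, wc]; ring
  have h2 : b + s • (c - b) + t • (a - b) = ∑ d ∈ τ, w d • d := by
    rw [hsum, wa, wb, wc]; module
  rw [h2]
  refine ⟨(h.bary_combination h1 ha).trans wa, (h.bary_combination h1 hc).trans wc,
    (h.bary_combination h1 hb).trans wb, fun d hd => ?_⟩
  rw [← hτ] at hd
  simpa using hd

/-- The parallelogram at `b` with sides `(c - b)/2` and `(a - b)/2` stays inside the triangle: its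
points have barycentric coordinates `t/2`, `s/2` and `1 - (s + t)/2`. A full edge is covered by the
two halves seen from its endpoints. -/
theorem IsTriangle.exists_trace_half_edge {κ₀ : ℝ} (hκ₀ : 0 < κ₀) {τ : Finset Plane}
    (h : IsTriangle τ) {a b c : Plane} (ha : a ∈ τ) (hb : b ∈ τ) (hc : c ∈ τ) (hba : b ≠ a)
    (hca : c ≠ a) (hbc : b ≠ c) :
    ∃ K : ℝ≥0, ∀ T : Finset (Finset Plane), hull τ ⊆ region T →
      ∀ κ, κ₀ ≤ κ → ∀ v ∈ piecewisePoly T,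
        ∫⁻ y in segment ℝ b (midpoint ℝ b c), ENNReal.ofReal (κ * ‖v y‖ ^ 2)
          ∂(Measure.hausdorffMeasure 1)
          ≤ K * ∫⁻ y in interior (region T), energyDensity κ v y := by
  have hpt : ∀ s t : ℝ, b + s • ((2⁻¹ : ℝ) • (c - b)) + t • ((2⁻¹ : ℝ) • (a - b))
      = b + (s * 2⁻¹) • (c - b) + (t * 2⁻¹) • (a - b) := fun s t => by
    rw [smul_smul, smul_smul]
  have hbary := h.bary_combination_three ha hb hc hba hca hbc
  have hli : ∀ s t : ℝ, s • ((2⁻¹ : ℝ) • (c - b)) + t • ((2⁻¹ : ℝ) • (a - b)) = 0 →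
      s = 0 ∧ t = 0 := by
    intro s t hst
    have h1 : b + s • ((2⁻¹ : ℝ) • (c - b)) + t • ((2⁻¹ : ℝ) • (a - b))
        = b + (0 : ℝ) • (c - b) + (0 : ℝ) • (a - b) := by
      rw [add_assoc, hst]; simp
    rw [hpt] at h1
    have h2 := (hbary (s * 2⁻¹) (t * 2⁻¹))
    rw [h1] at h2
    have h3 := hbary 0 0
    exact ⟨by linarith [h2.2.1.symm.trans h3.2.1], by linarith [h2.1.symm.trans h3.1]⟩
  obtain ⟨K, hK⟩ := exists_trace_parallelogram (x := b) hκ₀ hli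
  refine ⟨K, fun T hT κ hκ v hv => ?_⟩
  have hmid : midpoint ℝ b c = b + (2⁻¹ : ℝ) • (c - b) := by
    rw [midpoint_eq_smul_add, invOf_eq_inv]; module
  rw [hmid]
  refine hK T (fun s hs t ht => hT ?_) (fun s hs t ht => interior_mono hT ?_) κ hκ v hv
  · rw [hpt, h.mem_hull]
    intro d hd
    obtain ⟨h1, h2, h3, h4⟩ := hbary (s * 2⁻¹) (t * 2⁻¹)
    rcases h4 d hd with rfl | rfl | rfl
    · rw [h1]; linarith [ht.1]
    · rw [h3]; linarith [ht.2, hs.2]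
    · rw [h2]; linarith [hs.1]
  · rw [hpt, h.interior_hull]
    intro d hd
    obtain ⟨h1, h2, h3, h4⟩ := hbary (s * 2⁻¹) (t * 2⁻¹)
    rcases h4 d hd with rfl | rfl | rfl
    · rw [h1]; linarith [ht.1]
    · rw [h3]; linarith [ht.2, hs.2]
    · rw [h2]; linarith [hs.1]

theorem segment_subset_union_midpoint (b c : Plane) :
    segment ℝ b c ⊆ segment ℝ b (midpoint ℝ b c) ∪ segment ℝ c (midpoint ℝ c b) := by
  have key : ∀ (b c : Plane) (s : ℝ), 0 ≤ s → s ≤ 2⁻¹ →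
      b + s • (c - b) ∈ segment ℝ b (midpoint ℝ b c) := by
    intro b c s hs0 hs1
    rw [segment_eq_image']
    refine ⟨2 * s, ⟨by linarith, by linarith⟩, ?_⟩
    beta_reduce
    rw [midpoint_eq_smul_add, invOf_eq_inv]
    module
  rw [segment_eq_image' ℝ b c]
  rintro _ ⟨s, hs, rfl⟩
  rcases le_total s 2⁻¹ with h | h
  · exact Or.inl (key b c s hs.1 h)
  · right
    have := key c b (1 - s) (by linarith [hs.2]) (by linarith)
    have heq : c + (1 - s) • (b - c) = b + s • (c - b) := by module
    rwa [heq] at this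

theorem IsTriangle.exists_trace_edge [DecidableEq Plane] {κ₀ : ℝ} (hκ₀ : 0 < κ₀)
    {τ : Finset Plane} (h : IsTriangle τ) {a : Plane} (ha : a ∈ τ) :
    ∃ K : ℝ≥0, ∀ T : Finset (Finset Plane), hull τ ⊆ region T →
      ∀ κ, κ₀ ≤ κ → ∀ v ∈ piecewisePoly T,
        ∫⁻ y in hull (τ.erase a), ENNReal.ofReal (κ * ‖v y‖ ^ 2) ∂(Measure.hausdorffMeasure 1)
          ≤ K * ∫⁻ y in interior (region T), energyDensity κ v y := by
  obtain ⟨b, c, hb, hc, hbc, hba, hca, heq⟩ := hull_erase_eq_segment h.1 ha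
  obtain ⟨K₁, hK₁⟩ := h.exists_trace_half_edge hκ₀ ha hb hc hba hca hbc
  obtain ⟨K₂, hK₂⟩ := h.exists_trace_half_edge hκ₀ ha hc hb hca hba hbc.symm
  refine ⟨K₁ + K₂, fun T hT κ hκ v hv => ?_⟩
  rw [heq]
  refine (lintegral_mono_set (segment_subset_union_midpoint b c)).trans
    ((lintegral_union_le _ _ _).trans ?_)
  rw [ENNReal.coe_add, add_mul]
  exact add_le_add (hK₁ T hT κ hκ v hv) (hK₂ T hT κ hκ v hv)

theorem lintegral_biUnion_finset_le {ι X : Type*} [MeasurableSpace X] (μ : Measure X)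
    (s : Finset ι) (A : ι → Set X) (f : X → ℝ≥0∞) :
    ∫⁻ x in ⋃ i ∈ s, A i, f x ∂μ ≤ ∑ i ∈ s, ∫⁻ x in A i, f x ∂μ := by
  classical
  induction s using Finset.induction_on with
  | empty => simp
  | insert i s hi ih =>
    rw [Finset.set_biUnion_insert, Finset.sum_insert hi]
    exact (lintegral_union_le _ _ _).trans (by gcongr)

/-- The edges and their parallelograms come from the mesh `m`, while `v` is polynomial on the
unrelated triangles `T` covering the same domain. This separation makes the constant independent of
the discretization. -/
theorem Mesh.exists_trace {Ω : Set Plane} (m : Mesh Ω) {κ₀ : ℝ} (hκ₀ : 0 < κ₀) :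
    ∃ K : ℝ≥0, ∀ T : Finset (Finset Plane), (∀ τ ∈ T, IsTriangle τ) → interior (region T) = Ω →
      ∀ κ, κ₀ ≤ κ → ∀ v ∈ piecewisePoly T,
        ∫⁻ y in frontier Ω, ENNReal.ofReal (κ * ‖v y‖ ^ 2) ∂(Measure.hausdorffMeasure 1)
          ≤ K * ∫⁻ y in Ω, energyDensity κ v y := by
  classical
  have hedge : ∀ τ ∈ m.elems, ∀ a ∈ τ, ∃ K : ℝ≥0, ∀ T : Finset (Finset Plane),
      hull τ ⊆ region T → ∀ κ, κ₀ ≤ κ → ∀ v ∈ piecewisePoly T,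
        ∫⁻ y in hull (τ.erase a), ENNReal.ofReal (κ * ‖v y‖ ^ 2) ∂(Measure.hausdorffMeasure 1)
          ≤ K * ∫⁻ y in interior (region T), energyDensity κ v y :=
    fun τ hτ a ha => (m.isTriangle hτ).exists_trace_edge hκ₀ ha
  choose! K hK using hedge
  refine ⟨∑ τ ∈ m.elems, ∑ a ∈ τ, K τ a, fun T hT hTΩ κ hκ v hv => ?_⟩
  have hreg : region T = region m.elems := by
    rw [m.region_eq, ← closure_interior_region hT, hTΩ]
  have hfr : frontier Ω ⊆ ⋃ τ ∈ m.elems, ⋃ a ∈ τ, hull (τ.erase a) := by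
    have := frontier_interior_region_subset fun τ hτ => m.isTriangle hτ
    rwa [m.cover] at this
  refine (lintegral_mono_set hfr).trans ((lintegral_biUnion_finset_le _ _ _ _).trans ?_)
  push_cast
  rw [Finset.sum_mul]
  refine Finset.sum_le_sum fun τ hτ => (lintegral_biUnion_finset_le _ _ _ _).trans ?_
  rw [Finset.sum_mul]
  refine Finset.sum_le_sum fun a ha => ?_
  rw [← hTΩ]
  exact hK τ hτ a ha T (hreg ▸ hull_subset_region hτ) κ hκ v hv

theorem integrable_energy {T : Finset (Finset Plane)} (κ : ℝ) {v : Plane → ℂ}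
    (hv : v ∈ piecewisePoly T) :
    Integrable (fun x => κ ^ 2 * ‖v x‖ ^ 2 + ∑ i, ‖partialDeriv i v x‖ ^ 2)
      (volume.restrict (interior (region T))) := by
  refine Integrable.add ((memLp_region hv).integrable_norm_pow'.const_mul _)
    (integrable_finsetSum _ fun i _ => ?_)
  exact (memLp_partialDeriv i hv).integrable_norm_pow'

theorem kInner_self_eq_integral {T : Finset (Finset Plane)} (κ : ℝ) {v : Plane → ℂ}
    (hv : v ∈ piecewisePoly T) :
    (kInner κ (interior (region T)) v v).re =
      ∫ x in interior (region T), (κ ^ 2 * ‖v x‖ ^ 2 + ∑ i, ‖partialDeriv i v x‖ ^ 2) := by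
  rw [kInner_self_re, gradInner_self, l2Inner_self, Complex.ofReal_re, Complex.ofReal_re,
    ← integral_const_mul, add_comm, ← integral_add]
  · exact (memLp_region hv).integrable_norm_pow'.const_mul _
  · exact integrable_finsetSum _ fun i _ => (memLp_partialDeriv i hv).integrable_norm_pow'

theorem Mesh.exists_trace_constant {Ω : Set Plane} (m : Mesh Ω) {κ₀ : ℝ} (hκ₀ : 0 < κ₀) :
    ∃ C : ℝ, 0 ≤ C ∧ ∀ T : Finset (Finset Plane), (∀ τ ∈ T, IsTriangle τ) →
      interior (region T) = Ω → ∀ κ, κ₀ ≤ κ → ∀ v ∈ piecewisePoly T,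
        κ * (bdryInner Ω v v).re ≤ C ^ 2 * kNorm κ Ω v ^ 2 := by
  obtain ⟨K, hK⟩ := m.exists_trace hκ₀
  refine ⟨Real.sqrt K, Real.sqrt_nonneg _, fun T hT hTΩ κ hκ v hv => ?_⟩
  have h := hK T hT hTΩ κ hκ v hv
  rw [Real.sq_sqrt K.coe_nonneg, kNorm_sq]
  subst hTΩ
  have hκ0 : 0 ≤ κ := hκ₀.le.trans hκ
  rw [kInner_self_eq_integral κ hv, bdryInner_self, Complex.ofReal_re, ← integral_const_mul]
  have hi := ((memLp_two_iff_integrable_sq_norm (memLp_frontier hT hv).1).1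
    (memLp_frontier hT hv)).const_mul κ
  rw [← ofReal_integral_eq_lintegral_ofReal hi (Filter.Eventually.of_forall fun _ => by positivity)]
    at h
  simp only [energyDensity] at h
  rw [← ofReal_integral_eq_lintegral_ofReal (integrable_energy κ hv)
    (Filter.Eventually.of_forall fun _ => by positivity), ← ENNReal.ofReal_coe_nnreal,
    ← ENNReal.ofReal_mul K.coe_nonneg] at h
  refine (ENNReal.ofReal_le_ofReal_iff (mul_nonneg K.coe_nonneg (integral_nonneg fun _ => ?_))).1 h
  positivity

/-! ### Galerkin problems and linearity of the forms -/

theorem galerkinSolution_spec {V : Set (Plane → ℂ)} {a : (Plane → ℂ) → (Plane → ℂ) → ℂ}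
    {F : (Plane → ℂ) → ℂ} (h : ∃ u ∈ V, ∀ w ∈ V, a u w = F w) :
    galerkinSolution V a F ∈ V ∧ ∀ w ∈ V, a (galerkinSolution V a F) w = F w := by
  rw [galerkinSolution, dif_pos h]
  exact h.choose_spec

/-- The pull-back of a sesquilinear form along a linear map. -/
def pullForm {V W : Type*} [AddCommGroup V] [Module ℂ V] [AddCommGroup W] [Module ℂ W]
    (b : W →ₗ[ℂ] W →ₗ⋆[ℂ] ℂ) (f : V →ₗ[ℂ] W) : V →ₗ[ℂ] V →ₗ⋆[ℂ] ℂ :=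
  LinearMap.mk₂'ₛₗ _ _ (fun v w => b (f v) (f w)) (by intros; simp) (by intros; simp)
    (by intros; simp) (by intros; simp)

section Forms

variable {T : Finset (Finset Plane)} {v v' w w' : Plane → ℂ}

/-- Vanishing off the region is needed for uniqueness: the form controls a function only on the
region, while equality is meant on the whole plane. -/
theorem exists_galerkin_solution {κ ε : ℝ} (hκ : 0 < κ) (hε : 0 < ε)
    (hT : ∀ τ ∈ T, IsTriangle τ) {S : Submodule ℂ (Plane → ℂ)} [FiniteDimensional ℂ S]
    (hS : S ≤ piecewisePoly T) (hS0 : ∀ v ∈ S, ∀ x, x ∉ region T → v x = 0) (F : S →ₗ⋆[ℂ] ℂ) :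
    ∃ u ∈ S, ∀ w, ∀ hw : w ∈ S, helmholtzForm κ ε (interior (region T)) u w = F ⟨w, hw⟩ := by
  obtain ⟨u, hu⟩ := galerkin_exists (pullForm (hForm hT κ ε) (Submodule.inclusion hS))
    (fun u hu => by
      have h : helmholtzForm κ ε (interior (region T)) u.1 u.1 = 0 := by
        rw [← hu]; exact (hForm_apply hT κ ε ⟨u.1, hS u.2⟩ ⟨u.1, hS u.2⟩).symm
      refine Subtype.ext (funext fun x => ?_)
      by_cases hx : x ∈ region T
      · exact eqOn_zero_of_helmholtzForm_self hκ hε hT (hS u.2) h x hx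
      · exact hS0 u.1 u.2 x hx) F
  refine ⟨u.1, u.2, fun w hw => ?_⟩
  rw [← hu]
  exact (hForm_apply hT κ ε ⟨u.1, hS u.2⟩ ⟨w, hS hw⟩).symm

theorem helmholtzForm_add_left (hT : ∀ τ ∈ T, IsTriangle τ) (κ ε : ℝ)
    (hv : v ∈ piecewisePoly T) (hv' : v' ∈ piecewisePoly T) (hw : w ∈ piecewisePoly T) :
    helmholtzForm κ ε (interior (region T)) (v + v') w =
      helmholtzForm κ ε (interior (region T)) v w +
        helmholtzForm κ ε (interior (region T)) v' w := by
  have := hForm_apply hT κ ε (⟨v, hv⟩ + ⟨v', hv'⟩) ⟨w, hw⟩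
  rw [map_add, LinearMap.add_apply, hForm_apply, hForm_apply] at this
  exact this.symm

theorem helmholtzForm_smul_left (hT : ∀ τ ∈ T, IsTriangle τ) (κ ε : ℝ) (c : ℂ)
    (hv : v ∈ piecewisePoly T) (hw : w ∈ piecewisePoly T) :
    helmholtzForm κ ε (interior (region T)) (c • v) w =
      c * helmholtzForm κ ε (interior (region T)) v w := by
  have := hForm_apply hT κ ε (c • ⟨v, hv⟩) ⟨w, hw⟩
  rw [map_smul, LinearMap.smul_apply, hForm_apply] at this
  exact this.symm

theorem helmholtzForm_sub_left (hT : ∀ τ ∈ T, IsTriangle τ) (κ ε : ℝ)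
    (hv : v ∈ piecewisePoly T) (hv' : v' ∈ piecewisePoly T) (hw : w ∈ piecewisePoly T) :
    helmholtzForm κ ε (interior (region T)) (v - v') w =
      helmholtzForm κ ε (interior (region T)) v w -
        helmholtzForm κ ε (interior (region T)) v' w := by
  have := hForm_apply hT κ ε (⟨v, hv⟩ - ⟨v', hv'⟩) ⟨w, hw⟩
  rw [map_sub, LinearMap.sub_apply, hForm_apply, hForm_apply] at this
  exact this.symm

theorem helmholtzForm_sub_right (hT : ∀ τ ∈ T, IsTriangle τ) (κ ε : ℝ)
    (hv : v ∈ piecewisePoly T) (hw : w ∈ piecewisePoly T) (hw' : w' ∈ piecewisePoly T) :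
    helmholtzForm κ ε (interior (region T)) v (w - w') =
      helmholtzForm κ ε (interior (region T)) v w -
        helmholtzForm κ ε (interior (region T)) v w' := by
  have := hForm_apply hT κ ε ⟨v, hv⟩ (⟨w, hw⟩ - ⟨w', hw'⟩)
  rw [map_sub, hForm_apply, hForm_apply] at this
  exact this.symm

theorem bdryInner_add_left (hT : ∀ τ ∈ T, IsTriangle τ)
    (hv : v ∈ piecewisePoly T) (hv' : v' ∈ piecewisePoly T) (hw : w ∈ piecewisePoly T) :
    bdryInner (interior (region T)) (v + v') w =
      bdryInner (interior (region T)) v w + bdryInner (interior (region T)) v' w := by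
  have := bdryForm_apply hT (⟨v, hv⟩ + ⟨v', hv'⟩) ⟨w, hw⟩
  rw [map_add, LinearMap.add_apply, bdryForm_apply, bdryForm_apply] at this
  exact this.symm

theorem bdryInner_smul_left (hT : ∀ τ ∈ T, IsTriangle τ) (c : ℂ)
    (hv : v ∈ piecewisePoly T) (hw : w ∈ piecewisePoly T) :
    bdryInner (interior (region T)) (c • v) w = c * bdryInner (interior (region T)) v w := by
  have := bdryForm_apply hT (c • ⟨v, hv⟩) ⟨w, hw⟩
  rw [map_smul, LinearMap.smul_apply, bdryForm_apply] at this
  exact this.symm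

end Forms

namespace Discretization

variable {Ω : Set Plane} (D : Discretization Ω)

theorem isTriangle_elems : ∀ τ ∈ D.mesh.elems, IsTriangle τ := fun _ hτ => D.mesh.isTriangle hτ

theorem sub_subset (l : Fin D.N) : D.sub l ⊆ Ω :=
  (interior_mono (region_mono (D.subElems_subset l))).trans D.mesh.cover.subset

theorem measurableSet_sub (l : Fin D.N) : MeasurableSet (D.sub l) :=
  isOpen_interior.measurableSet

theorem eq_zero_of_notMem_region {v : Plane → ℂ} (hv : v ∈ D.feSubmodule) {x : Plane}
    (hx : x ∉ region D.mesh.elems) : v x = 0 :=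
  hv.2.2 x (by rwa [D.mesh.region_eq] at hx)

/-! ### The local problems -/

theorem localProj_spec {κ ε : ℝ} (hκ : 0 < κ) (hε : 0 < ε) (l : Fin D.N) {v : Plane → ℂ}
    (hv : v ∈ D.feSubmodule) :
    D.localProj κ ε l v ∈ D.localSubmodule l ∧ ∀ w ∈ D.localSubmodule l,
      helmholtzForm κ ε (D.sub l) (D.localProj κ ε l v) w
        = helmholtzForm κ ε Ω v (D.prolong l w) := by
  apply galerkinSolution_spec
  let P : D.localSubmodule l →ₗ[ℂ] piecewisePoly D.mesh.elems :=
    ((D.prolongLin l).comp (D.localSubmodule l).subtype).codRestrict _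
      fun w => D.feSubmodule_le (D.interp_spec _).1
  obtain ⟨u, hu, h⟩ := exists_galerkin_solution hκ hε D.isTriangle_sub (D.localSubmodule_le l)
    (fun v hv x hx => D.localSubmodule_eq_zero hv hx)
    ((hForm D.isTriangle_elems κ ε ⟨v, D.feSubmodule_le hv⟩).comp P)
  refine ⟨u, hu, fun w hw => (h w hw).trans ?_⟩
  rw [LinearMap.comp_apply, hForm_apply, D.mesh.cover]
  rfl

/-- Off `Ω_l` both `w` and its gradient vanish almost everywhere. The boundary terms drop out on
both sides, because a point of `∂Ω` in the closed subdomain lies on `∂Ω_l`. -/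
theorem helmholtzForm_eq_of_frontier {κ ε : ℝ} (l : Fin D.N) (v : Plane → ℂ) {w : Plane → ℂ}
    (hw : w ∈ D.localSubmodule l) (h0 : ∀ x ∈ frontier (D.sub l), w x = 0) :
    helmholtzForm κ ε Ω v w = helmholtzForm κ ε (D.sub l) v w := by
  obtain ⟨-, hout⟩ := D.mem_feSpace_of_frontier hw h0
  have hsub := D.sub_subset l
  have hΩm : MeasurableSet Ω := by
    rw [← D.mesh.cover]; exact isOpen_interior.measurableSet
  have hae : ∀ᵐ x : Plane, x ∈ Ω \ D.sub l → w x = 0 ∧ ∀ i, partialDeriv i w x = 0 := by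
    filter_upwards [ae_mem_interior_hull D.mesh.elems] with x hx hxΩ
    rw [D.mesh.region_eq] at hx
    obtain ⟨τ, hτ, hxτ⟩ := hx (subset_closure hxΩ.1)
    have hτl : τ ∉ D.subElems l := fun h =>
      hxΩ.2 (interior_mono (hull_subset_region h) hxτ)
    have heq : Set.EqOn w 0 (interior (hull τ)) := fun y hy =>
      hout τ hτ hτl y (interior_subset hy)
    refine ⟨heq hxτ, fun i => ?_⟩
    rw [partialDeriv_congr isOpen_interior heq hxτ i, partialDeriv]
    simp
  have hgrad : gradInner Ω v w = gradInner (D.sub l) v w := by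
    refine setIntegral_eq_of_subset_of_ae_sdiff_eq_zero hΩm.nullMeasurableSet hsub ?_
    filter_upwards [hae] with x hx hxΩ
    refine Finset.sum_eq_zero fun i _ => ?_
    have := (hx hxΩ).2 i
    rw [partialDeriv] at this
    rw [this, map_zero, mul_zero]
  have hl2 : l2Inner Ω v w = l2Inner (D.sub l) v w := by
    refine setIntegral_eq_of_subset_of_ae_sdiff_eq_zero hΩm.nullMeasurableSet hsub ?_
    filter_upwards [hae] with x hx hxΩ
    rw [(hx hxΩ).1, map_zero, mul_zero]
  have hb0 : ∀ G : Set Plane, (∀ x ∈ frontier G, w x = 0) → bdryInner G v w = 0 := fun G hG => by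
    rw [bdryInner, setIntegral_congr_fun (g := fun _ => (0 : ℂ)) isClosed_frontier.measurableSet]
    · simp
    · intro x hx
      simp [hG x hx]
  have hΩ0 : ∀ x ∈ frontier Ω, w x = 0 := fun x hx => by
    by_cases hxl : x ∈ D.closedSub l
    · apply h0
      rw [frontier, D.closure_interior_closedSub]
      refine ⟨hxl, fun h => hx.2 ?_⟩
      exact interior_mono hsub h
    · exact D.localSubmodule_eq_zero hw hxl
  rw [helmholtzForm, helmholtzForm, hgrad, hl2, hb0 _ h0, hb0 _ hΩ0]

theorem restr_mem {l : Fin D.N} {v : Plane → ℂ} (hv : v ∈ D.feSubmodule) :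
    D.restr l v ∈ D.localSubmodule l := ⟨v, hv, rfl⟩

/-- On test functions with zero trace on `∂Ω_l`, `P_{ε,l} v` and `R_l v` give the same value of the
local form, so the residual functional annihilates the null vectors of the boundary form.
`riesz_psd` then represents it by boundary data from the local space. -/
theorem localDefect_mem {κ ε : ℝ} (hκ : 0 < κ) (hε : 0 < ε) (l : Fin D.N) {v : Plane → ℂ}
    (hv : v ∈ D.feSubmodule) : D.localDefect κ ε v l ∈ D.harmonicSpace κ ε l := by
  obtain ⟨hP, hP'⟩ := D.localProj_spec hκ hε l hv
  have hmem : D.localDefect κ ε v l ∈ D.localSubmodule l :=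
    (D.localSubmodule l).sub_mem hP (D.restr_mem hv)
  have hle := D.localSubmodule_le l
  have hT : ∀ τ ∈ D.subElems l, IsTriangle τ := D.isTriangle_sub
  let ι : D.localSubmodule l →ₗ[ℂ] piecewisePoly (D.subElems l) := Submodule.inclusion hle
  obtain ⟨g, hg⟩ := riesz_psd (pullForm (bdryForm hT) ι)
    (fun _ _ => conj_bdryInner _ _ _) (fun _ => bdryInner_self_nonneg _ _)
    ((hForm hT κ ε ⟨_, hle hmem⟩).comp ι) (fun w hw => by
      have h0 := eqOn_frontier_of_bdryInner_self hT (hle w.2) hw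
      rw [LinearMap.comp_apply, hForm_apply]
      change helmholtzForm κ ε (D.sub l) (D.localProj κ ε l v - D.restr l v) w.1 = 0
      have h1 := helmholtzForm_sub_left hT κ ε (hle hP) (hle (D.restr_mem hv)) (hle w.2)
      refine h1.trans ?_
      rw [sub_eq_zero]
      refine (hP' w.1 w.2).trans ?_
      rw [D.prolong_eq_self w.2 h0, D.helmholtzForm_eq_of_frontier l v w.2 h0]
      exact helmholtzForm_congr hT κ ε fun x hx => (Set.indicator_of_mem hx v).symm)
  refine ⟨hmem, g.1, g.2, fun w hw => ?_⟩
  have h := LinearMap.congr_fun hg ⟨w, hw⟩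
  rw [LinearMap.comp_apply, hForm_apply] at h
  exact h.symm

/-- The space `V_h^∂(Ω_l)` as a submodule. -/
def harmonicSubmodule (κ ε : ℝ) (l : Fin D.N) : Submodule ℂ (Plane → ℂ) where
  carrier := D.harmonicSpace κ ε l
  zero_mem' := ⟨(D.localSubmodule l).zero_mem, 0, (D.localSubmodule l).zero_mem, fun w hw => by
    have h1 := helmholtzForm_smul_left D.isTriangle_sub κ ε 0 (D.localSubmodule l |>.zero_mem |>
      D.localSubmodule_le l) (D.localSubmodule_le l hw)
    have h2 := bdryInner_smul_left D.isTriangle_sub 0 (D.localSubmodule l |>.zero_mem |>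
      D.localSubmodule_le l) (D.localSubmodule_le l hw)
    rw [zero_smul, zero_mul] at h1 h2
    exact h1.trans h2.symm⟩
  add_mem' := fun {u v} ⟨hu, g, hg, hug⟩ ⟨hv, k, hk, hvk⟩ =>
    ⟨(D.localSubmodule l).add_mem hu hv, g + k, (D.localSubmodule l).add_mem hg hk, fun w hw => by
      have hle := D.localSubmodule_le l
      refine (helmholtzForm_add_left D.isTriangle_sub κ ε (hle hu) (hle hv) (hle hw)).trans ?_
      refine Eq.trans ?_
        (bdryInner_add_left D.isTriangle_sub (hle hg) (hle hk) (hle hw)).symm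
      exact congrArg₂ _ (hug w hw) (hvk w hw)⟩
  smul_mem' := fun c v ⟨hv, k, hk, hvk⟩ =>
    ⟨(D.localSubmodule l).smul_mem c hv, c • k, (D.localSubmodule l).smul_mem c hk, fun w hw => by
      have hle := D.localSubmodule_le l
      refine (helmholtzForm_smul_left D.isTriangle_sub κ ε c (hle hv) (hle hw)).trans ?_
      refine Eq.trans ?_ (bdryInner_smul_left D.isTriangle_sub c (hle hk) (hle hw)).symm
      exact congrArg (c * ·) (hvk w hw)⟩

theorem harmonicSubmodule_le (κ ε : ℝ) (l : Fin D.N) :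
    D.harmonicSubmodule κ ε l ≤ D.localSubmodule l := fun _ hv => hv.1

instance (κ ε : ℝ) (l : Fin D.N) : FiniteDimensional ℂ (D.harmonicSubmodule κ ε l) :=
  Submodule.finiteDimensional_of_le (D.harmonicSubmodule_le κ ε l)

/-- Spectral truncation at `t = ρ²` inside `V_h^∂(Ω_l)`; the eigenvalue problem tests only against
this space, which is why `v` must belong to it. -/
theorem exists_localCoarse_approx {κ : ℝ} (hκ : 0 < κ) (ε ρ : ℝ) (l : Fin D.N) {v : Plane → ℂ}
    (hv : v ∈ D.harmonicSpace κ ε l) :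
    ∃ z ∈ D.localCoarse κ ε ρ l,
      kNorm κ (D.sub l) (D.weightedProlong l (v - z)) ^ 2 ≤ ρ ^ 2 * kNorm κ (D.sub l) v ^ 2 := by
  have hT : ∀ τ ∈ D.subElems l, IsTriangle τ := D.isTriangle_sub
  have hle : D.harmonicSubmodule κ ε l ≤ piecewisePoly (D.subElems l) :=
    (D.harmonicSubmodule_le κ ε l).trans (D.localSubmodule_le l)
  let W : D.harmonicSubmodule κ ε l →ₗ[ℂ] piecewisePoly (D.subElems l) :=
    ((D.weightedProlong l).comp (D.harmonicSubmodule κ ε l).subtype).codRestrict _ fun w =>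
      piecewisePoly_anti (D.subElems_subset l) (D.feSubmodule_le (D.weightedProlong_mem l _))
  let B := pullForm (kForm (D.subElems l) κ) (Submodule.inclusion hle)
  let b := pullForm (kForm (D.subElems l) κ) W
  have hB : ∀ u w, B u w = kInner κ (D.sub l) u.1 w.1 := fun u w => kForm_apply κ _ _
  have hb : ∀ u w, b u w =
      kInner κ (D.sub l) (D.weightedProlong l u.1) (D.weightedProlong l w.1) :=
    fun u w => kForm_apply κ _ _
  obtain ⟨z, hz, hzv⟩ := exists_span_eigen_approx B b (fun _ _ => conj_kForm κ _ _)
    (fun u => by rw [hB]; exact kInner_self_nonneg _ _ _)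
    (fun u hu => by
      rw [hB] at hu
      refine Subtype.ext (funext fun x => ?_)
      by_cases hx : x ∈ region (D.subElems l)
      · exact eqOn_zero_of_kInner_self hκ hT (hle u.2) hu x hx
      · exact D.localSubmodule_eq_zero (D.harmonicSubmodule_le κ ε l u.2) hx)
    (fun _ _ => conj_kForm κ _ _) (ρ ^ 2) (sq_nonneg ρ) ⟨v, hv⟩
  refine ⟨z.1, ?_, ?_⟩
  · have h1 := Submodule.mem_map_of_mem (f := (D.harmonicSubmodule κ ε l).subtype) hz
    rw [Submodule.map_span] at h1
    refine Submodule.span_mono ?_ h1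
    rintro _ ⟨ξ, ⟨μ, hμ, h⟩, rfl⟩
    refine ⟨μ, hμ, ξ.2, fun θ hθ => ?_⟩
    have h2 := h ⟨θ, hθ⟩
    rwa [hb, hB] at h2
  · rw [hb, hB] at hzv
    rw [kNorm_sq, kNorm_sq]
    exact hzv

/-! ### Finite overlap -/

/-- Subdomains sharing an element all contain its interior, so they are neighbours of any one among
them. -/
theorem card_filter_mem_subElems_le {M : ℕ} (hM : ∀ l, (D.neighbours l).ncard ≤ M)
    {τ : Finset Plane} (hτ : τ ∈ D.mesh.elems) [DecidablePred fun l => τ ∈ D.subElems l] :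
    (Finset.univ.filter fun l => τ ∈ D.subElems l).card ≤ M := by
  rcases (Finset.univ.filter fun l => τ ∈ D.subElems l).eq_empty_or_nonempty with h | ⟨l, hl⟩
  · rw [h]; exact Nat.zero_le _
  · refine le_trans ?_ (hM l)
    rw [← Set.ncard_coe_finset]
    refine Set.ncard_le_ncard (fun j hj => ?_) (Set.toFinite _)
    obtain ⟨x, hx⟩ := (D.mesh.isTriangle hτ).interior_nonempty
    exact ⟨x, interior_mono (hull_subset_region (Finset.mem_filter.1 hj).2) hx,
      interior_mono (hull_subset_region (Finset.mem_filter.1 hl).2) hx⟩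

/-- Inside an element at most `M` summands are nonzero, so Cauchy–Schwarz bounds the energy density
of the sum by `M` times the sum of the densities. Each density counted at such a point belongs to a
subdomain containing the point. -/
theorem kNorm_sum_sq_le {M : ℕ} (hM : ∀ l, (D.neighbours l).ncard ≤ M) (κ : ℝ)
    {u : Fin D.N → Plane → ℂ} (hu : ∀ l, u l ∈ D.feSubmodule)
    (hu0 : ∀ l, ∀ τ ∈ D.mesh.elems, τ ∉ D.subElems l → ∀ x ∈ hull τ, u l x = 0) :
    kNorm κ Ω (∑ l, u l) ^ 2 ≤ M * ∑ l, kNorm κ (D.sub l) (u l) ^ 2 := by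
  classical
  let e : (Plane → ℂ) → Plane → ℝ := fun v x =>
    κ ^ 2 * ‖v x‖ ^ 2 + ∑ i, ‖partialDeriv i v x‖ ^ 2
  have he0 : ∀ v x, 0 ≤ e v x := fun v x => by positivity
  have hsub := D.sub_subset
  have hsum : (∑ l, u l) ∈ D.feSubmodule := Submodule.sum_mem _ fun l _ => hu l
  have hNΩ : ∀ v ∈ D.feSubmodule, kNorm κ Ω v ^ 2 = ∫ x in Ω, e v x ∧
      Integrable (e v) (volume.restrict Ω) := by
    intro v hv
    have h1 := kInner_self_eq_integral κ (D.feSubmodule_le hv)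
    have h2 := integrable_energy κ (D.feSubmodule_le hv)
    rw [D.mesh.cover] at h1 h2
    exact ⟨(kNorm_sq _ _ _).trans h1, h2⟩
  have hNl : ∀ l, kNorm κ (D.sub l) (u l) ^ 2 = ∫ x in Ω, (D.sub l).indicator (e (u l)) x := by
    intro l
    rw [setIntegral_indicator (D.measurableSet_sub l), Set.inter_eq_right.2 (hsub l), kNorm_sq]
    exact kInner_self_eq_integral κ
      (piecewisePoly_anti (D.subElems_subset l) (D.feSubmodule_le (hu l)))
  have hint : ∀ l, Integrable ((D.sub l).indicator (e (u l))) (volume.restrict Ω) := fun l =>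
    (hNΩ _ (hu l)).2.indicator (D.measurableSet_sub l)
  simp only [hNl]
  rw [(hNΩ _ hsum).1, ← integral_finsetSum _ fun l _ => hint l, ← integral_const_mul]
  refine integral_mono_ae (hNΩ _ hsum).2
    ((integrable_finsetSum _ fun l _ => hint l).const_mul _) ?_
  have hΩm : MeasurableSet Ω := by
    rw [← D.mesh.cover]; exact isOpen_interior.measurableSet
  rw [Filter.EventuallyLE, ae_restrict_iff' hΩm]
  filter_upwards [ae_mem_interior_hull D.mesh.elems] with x hx hxΩ
  rw [D.mesh.region_eq] at hx
  obtain ⟨τ, hτ, hxτ⟩ := hx (subset_closure hxΩ)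
  set A := Finset.univ.filter fun l => τ ∈ D.subElems l with hA
  have hAM : (A.card : ℝ) ≤ M := by exact_mod_cast D.card_filter_mem_subElems_le hM hτ
  have hzero : ∀ l ∉ A, Set.EqOn (u l) 0 (interior (hull τ)) := fun l hl y hy =>
    hu0 l τ hτ (fun h => hl (by simp [hA, h])) y (interior_subset hy)
  have hval : (∑ l, u l) x = ∑ l ∈ A, u l x := by
    rw [Finset.sum_apply]
    exact (Finset.sum_subset (Finset.subset_univ A) fun l _ hl => hzero l hl hxτ).symm
  have hder : ∀ i, partialDeriv i (∑ l, u l) x = ∑ l ∈ A, partialDeriv i (u l) x := by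
    intro i
    rw [partialDeriv, fderiv_sum fun l _ =>
      differentiableAt_of_mem_interior (D.feSubmodule_le (hu l)) hτ hxτ,
      _root_.sum_apply]
    refine (Finset.sum_subset (Finset.subset_univ A) fun l _ hl => ?_).symm
    have := partialDeriv_congr isOpen_interior (hzero l hl) hxτ i
    rw [partialDeriv] at this
    rw [this, partialDeriv]
    simp
  have hcs : ∀ c : Fin D.N → ℂ, ‖∑ l ∈ A, c l‖ ^ 2 ≤ M * ∑ l ∈ A, ‖c l‖ ^ 2 := by
    intro c
    calc ‖∑ l ∈ A, c l‖ ^ 2 ≤ (∑ l ∈ A, ‖c l‖) ^ 2 := by gcongr; exact norm_sum_le _ _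
      _ ≤ A.card * ∑ l ∈ A, ‖c l‖ ^ 2 := sq_sum_le_card_mul_sum_sq
      _ ≤ _ := by gcongr
  calc e (∑ l, u l) x
      = κ ^ 2 * ‖∑ l ∈ A, u l x‖ ^ 2 + ∑ i, ‖∑ l ∈ A, partialDeriv i (u l) x‖ ^ 2 := by
        simp only [e, hval, hder]
    _ ≤ κ ^ 2 * (M * ∑ l ∈ A, ‖u l x‖ ^ 2) + ∑ i, M * ∑ l ∈ A, ‖partialDeriv i (u l) x‖ ^ 2 := by
        gcongr
        · exact hcs _
        · exact hcs _
    _ = M * ∑ l ∈ A, e (u l) x := by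
        simp only [e, Finset.sum_add_distrib, ← Finset.mul_sum]
        rw [Finset.sum_comm]
        ring
    _ ≤ M * ∑ l, (D.sub l).indicator (e (u l)) x := by
        gcongr
        rw [Finset.sum_congr rfl fun l hl => (Set.indicator_of_mem (s := D.sub l)
          (interior_mono (hull_subset_region (Finset.mem_filter.1 hl).2) hxτ) (e (u l))).symm]
        exact Finset.sum_le_sum_of_subset_of_nonneg (Finset.subset_univ A) fun l _ _ =>
          Set.indicator_nonneg (fun y _ => he0 _ y) x

/-! ### The coarse problem -/

/-- The coarse space as a submodule. -/
def coarseSubmodule (κ ε ρ : ℝ) : Submodule ℂ (Plane → ℂ) where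
  carrier := D.coarseSpace κ ε ρ
  zero_mem' := ⟨0, fun l => (D.localCoarse κ ε ρ l).zero_mem, by
    simp only [← weightedProlong_apply]; simp⟩
  add_mem' := by
    rintro _ _ ⟨y, hy, rfl⟩ ⟨z, hz, rfl⟩
    refine ⟨y + z, fun l => (D.localCoarse κ ε ρ l).add_mem (hy l) (hz l), ?_⟩
    simp only [← weightedProlong_apply, Pi.add_apply, map_add, Finset.sum_add_distrib]
  smul_mem' := by
    rintro c _ ⟨y, hy, rfl⟩
    refine ⟨c • y, fun l => (D.localCoarse κ ε ρ l).smul_mem c (hy l), ?_⟩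
    simp only [← weightedProlong_apply, Pi.smul_apply, map_smul, Finset.smul_sum]

theorem coarseSubmodule_le (κ ε ρ : ℝ) : D.coarseSubmodule κ ε ρ ≤ D.feSubmodule := by
  rintro _ ⟨y, -, rfl⟩
  exact Submodule.sum_mem _ fun l _ => D.weightedProlong_mem l _

theorem coarseProj_spec {κ ε : ℝ} (hκ : 0 < κ) (hε : 0 < ε) (ρ : ℝ) {v : Plane → ℂ}
    (hv : v ∈ D.feSubmodule) :
    D.coarseProj κ ε ρ v ∈ D.coarseSubmodule κ ε ρ ∧ ∀ w ∈ D.coarseSubmodule κ ε ρ,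
      helmholtzForm κ ε Ω (D.coarseProj κ ε ρ v) w = helmholtzForm κ ε Ω v w := by
  have hle := D.coarseSubmodule_le κ ε ρ
  have : FiniteDimensional ℂ (D.coarseSubmodule κ ε ρ) := Submodule.finiteDimensional_of_le hle
  apply galerkinSolution_spec
  obtain ⟨u, hu, h⟩ := exists_galerkin_solution hκ hε D.isTriangle_elems
    (hle.trans D.feSubmodule_le) (fun v hv x hx => D.eq_zero_of_notMem_region (hle hv) hx)
    ((hForm D.isTriangle_elems κ ε ⟨v, D.feSubmodule_le hv⟩).comp
      (Submodule.inclusion (hle.trans D.feSubmodule_le)))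
  refine ⟨u, hu, fun w hw => ?_⟩
  have h1 := h w hw
  rw [LinearMap.comp_apply, hForm_apply, D.mesh.cover] at h1
  exact h1

/-- Céa's lemma: Galerkin orthogonality replaces `P` by any coarse `w` in the second slot, then
coercivity and continuity are combined. -/
theorem kNorm_sub_coarseProj_le {κ ε : ℝ} (hκ : 0 < κ) (hε : 0 < ε) (hεκ : ε ≤ κ ^ 2) (ρ : ℝ)
    {C : ℝ} (hC : 0 ≤ C)
    (htr : ∀ v ∈ piecewisePoly D.mesh.elems, κ * (bdryInner Ω v v).re ≤ C ^ 2 * kNorm κ Ω v ^ 2)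
    {v w : Plane → ℂ} (hv : v ∈ D.feSubmodule) (hw : w ∈ D.coarseSubmodule κ ε ρ) :
    kNorm κ Ω (v - D.coarseProj κ ε ρ v) ≤
      3 * (3 + C ^ 2) * (κ ^ 2 / ε) * kNorm κ Ω (v - w) := by
  obtain ⟨hP, hP'⟩ := D.coarseProj_spec hκ hε ρ hv
  set P := D.coarseProj κ ε ρ v
  have hT := D.isTriangle_elems
  have hcov := D.mesh.cover
  have hle : D.coarseSubmodule κ ε ρ ≤ piecewisePoly D.mesh.elems :=
    (D.coarseSubmodule_le κ ε ρ).trans D.feSubmodule_le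
  have hv' := D.feSubmodule_le hv
  have heq : helmholtzForm κ ε Ω (v - P) (v - P) = helmholtzForm κ ε Ω (v - P) (v - w) := by
    have h1 := helmholtzForm_sub_right hT κ ε (Submodule.sub_mem _ hv' (hle hP))
      (Submodule.sub_mem _ hv' (hle hP)) (Submodule.sub_mem _ hv' (hle hw))
    have h2 := helmholtzForm_sub_left hT κ ε hv' (hle hP) (hle (Submodule.sub_mem _ hw hP))
    rw [hcov] at h1 h2
    rw [hP' _ (Submodule.sub_mem _ hw hP), sub_self] at h2
    rw [sub_sub_sub_cancel_left, h2] at h1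
    exact (sub_eq_zero.1 h1.symm)
  have hcoer := helmholtzForm_coercive hκ hε hεκ Ω (v - P)
  have hcont : ‖helmholtzForm κ ε Ω (v - P) (v - w)‖ ≤
      (3 + C ^ 2) * (kNorm κ Ω (v - P) * kNorm κ Ω (v - w)) := by
    have := norm_helmholtzForm_le hκ hε hεκ hT hC (by rw [hcov]; exact htr)
      (Submodule.sub_mem _ hv' (hle hP)) (Submodule.sub_mem _ hv' (hle hw))
    rwa [hcov] at this
  rw [heq] at hcoer
  have hn := kNorm_nonneg κ Ω (v - P)
  have hn' := kNorm_nonneg κ Ω (v - w)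
  rcases hn.eq_or_lt with h0 | hpos
  · rw [← h0]; positivity
  · refine le_of_mul_le_mul_left ?_ hpos
    calc kNorm κ Ω (v - P) * kNorm κ Ω (v - P) = kNorm κ Ω (v - P) ^ 2 := (sq _).symm
      _ ≤ 3 * (κ ^ 2 / ε) * ((3 + C ^ 2) * (kNorm κ Ω (v - P) * kNorm κ Ω (v - w))) :=
        hcoer.trans (by gcongr)
      _ = _ := by ring

/-- The competitor in Céa's lemma is assembled from the local truncations. Linearity of `D_l E_l`
turns the error into a sum of local remainders, each carrying a factor `ρ`. -/
theorem kNorm_defect_sub_coarseProj_le {κ₀ κ ε ρ : ℝ} (hκ₀ : 0 < κ₀) (hκ : κ₀ ≤ κ) (hε : 0 < ε)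
    (hεκ : ε ≤ κ ^ 2) (hρ : 0 < ρ) {C : ℝ} (hC : 0 ≤ C)
    (htr : ∀ v ∈ piecewisePoly D.mesh.elems, κ * (bdryInner Ω v v).re ≤ C ^ 2 * kNorm κ Ω v ^ 2)
    {M : ℕ} (hM : ∀ l, (D.neighbours l).ncard ≤ M) {v : Plane → ℂ} (hv : v ∈ D.feSubmodule) :
    kNorm κ Ω (D.defect κ ε v - D.coarseProj κ ε ρ (D.defect κ ε v)) ≤
      3 * (3 + C ^ 2) * Real.sqrt M * (ρ * κ ^ 2 / ε) *
        Real.sqrt (∑ l, kNorm κ (D.sub l) (D.localDefect κ ε v l) ^ 2) := by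
  have hκpos : 0 < κ := hκ₀.trans_le hκ
  choose z hz hzv using fun l => D.exists_localCoarse_approx hκpos ε ρ l
    (D.localDefect_mem hκpos hε l hv)
  have hdef : D.defect κ ε v = ∑ l, D.weightedProlong l (D.localDefect κ ε v l) := rfl
  have hdm : D.defect κ ε v ∈ D.feSubmodule := by
    rw [hdef]; exact Submodule.sum_mem _ fun l _ => D.weightedProlong_mem l _
  have hw : ∑ l, D.weightedProlong l (z l) ∈ D.coarseSubmodule κ ε ρ := ⟨z, hz, rfl⟩
  have h1 := D.kNorm_sub_coarseProj_le hκpos hε hεκ ρ hC htr hdm hw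
  have h2 : D.defect κ ε v - ∑ l, D.weightedProlong l (z l)
      = ∑ l, D.weightedProlong l (D.localDefect κ ε v l - z l) := by
    rw [hdef, ← Finset.sum_sub_distrib]
    exact Finset.sum_congr rfl fun l _ => (map_sub _ _ _).symm
  set S := ∑ l, kNorm κ (D.sub l) (D.localDefect κ ε v l) ^ 2
  have h3 : kNorm κ Ω (D.defect κ ε v - ∑ l, D.weightedProlong l (z l)) ^ 2 ≤ M * (ρ ^ 2 * S) := by
    rw [h2]
    refine (D.kNorm_sum_sq_le hM κ (fun l => D.weightedProlong_mem l _)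
      fun l τ hτ hτl => D.weightedProlong_eq_zero l _ hτ hτl).trans ?_
    refine mul_le_mul_of_nonneg_left ?_ (Nat.cast_nonneg M)
    exact (Finset.sum_le_sum fun l _ => hzv l).trans_eq (Finset.mul_sum _ _ _).symm
  have h4 : kNorm κ Ω (D.defect κ ε v - ∑ l, D.weightedProlong l (z l))
      ≤ Real.sqrt M * (ρ * Real.sqrt S) := by
    refine (Real.le_sqrt_of_sq_le h3).trans_eq ?_
    rw [Real.sqrt_mul (Nat.cast_nonneg M), Real.sqrt_mul (sq_nonneg ρ), Real.sqrt_sq hρ.le]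
  calc _ ≤ _ := h1
    _ ≤ 3 * (3 + C ^ 2) * (κ ^ 2 / ε) * (Real.sqrt M * (ρ * Real.sqrt S)) := by gcongr
    _ = _ := by ring

end Discretization

end

end HelmholtzDD

theorem mainTheorem4 (Ω : Set HelmholtzDD.Plane) (κ₀ : ℝ) (hκ₀ : 0 < κ₀) (M : ℕ) :
    ∃ C : ℝ, 0 < C ∧
      ∀ D : HelmholtzDD.Discretization Ω,
        (∀ l, (D.neighbours l).ncard ≤ M) →
        ∀ κ ε ρ : ℝ, κ₀ ≤ κ → 0 < ε → ε ≤ κ ^ 2 → 0 < ρ → ρ < 1 →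
        ∀ v ∈ D.feSpace,
          HelmholtzDD.kNorm κ Ω (D.defect κ ε v - D.coarseProj κ ε ρ (D.defect κ ε v))
            ≤ C * (ρ * κ ^ 2 / ε) *
              Real.sqrt (∑ l, HelmholtzDD.kNorm κ (D.sub l) (D.localDefect κ ε v l) ^ 2) := by
  -- With no discretization the claim is vacuous; otherwise any one of them supplies the reference
  -- mesh for the trace constant of `Ω`.
  rcases isEmpty_or_nonempty (HelmholtzDD.Discretization Ω) with hD | ⟨⟨D₀⟩⟩
  · exact ⟨1, one_pos, fun D => (hD.false D).elim⟩
  obtain ⟨C, hC, htr⟩ := D₀.mesh.exists_trace_constant hκ₀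
  -- The added `1` keeps the constant positive when `M = 0`.
  refine ⟨3 * (3 + C ^ 2) * Real.sqrt M + 1, by positivity, ?_⟩
  intro D hM κ ε ρ hκ hε hεκ hρ _ v hv
  refine (D.kNorm_defect_sub_coarseProj_le hκ₀ hκ hε hεκ hρ hC
    (htr D.mesh.elems D.isTriangle_elems D.mesh.cover κ hκ) hM hv).trans ?_
  gcongr
  linarith
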